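/- Let $R$ be a commutative ring with unit. Graded modules are $\mathbb Z$-graded $R$-modules, $\underline a$ denotes an element $a$ placed in shifted degree $|\underline a|=|a|-1$, an operation $\varphi$ has the shifted version $\underline\varphi=\mathfrak s\circ\varphi\circ(\mathfrak s^{-1}\otimes\cdots\otimes\mathfrak s^{-1})$, and all signs are Koszul signs with respect to the shifted degrees. **Structures.** An $A_\infty$ algebra $(A,\mu)$ has maps $\mu_k:A^{\otimes k}\to A$ ($k\ge 1$) of degree $2-k$ with $\sum\underline{\mu}(\mathrm{id}^{\otimes i}\otimes\underline{\mu}\otimes \mathrm{id}^{\otimes j})=0$. A morphism $f:A\to B$ has maps $f_k$ ($k\ge1$) of degree $1-k$ with $\sum \underline f(\mathrm{id}^{\otimes i}\otimes\underline\mu\otimes\mathrm{id}^{\otimes j})=\sum\underline\nu(\underline f\otimes\cdots\otimes\underline f)$. An $A_\infty$ module $(M,\beta)$ over $A$ has maps $\beta_{k,\ell}:A^{\otimes k}\otimes M\otimes A^{\otimes\ell}\to M$ of degree $1-k-\ell$ with $\beta^2=0$ (the sum of all ways of applying one $\underline\mu$ or one $\underline\beta$ and then $\underline\beta$ vanishes).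 A morphism $F:M\to N$ of $A_\infty$ modules of degree $|F|$ over $f$ has maps $F_{k,\ell}:A^{\otimes k}\otimes M\otimes A^{\otimes \ell}\to N$ of degree $|F|-k-\ell$ such that the sum of all ways of applying one $\underline\mu$ or one $\underline\beta$ and then $\underline F$ equals $(-1)^{|F|}\sum\underline\gamma(\underline f\otimes\cdots\otimes\underline f\otimes\underline F\otimes\underline f\otimes\cdots\otimes\underline f)$. The dual $M^*$ carries the module structure $$\underline{\beta'}(\underline{a_1},\dots,\underline{a_k},\underline{m^*},\underline{\tilde a_1},\dots,\underline{\tilde a_\ell})(\underline{\tilde m})=-(-1)^{\varepsilon}\,\underline{m^*}\big(\underline\beta(\underline{\tilde a_1},\dots,\underline{\tilde a_\ell},\underline{\tilde m},\underline{a_1},\dots,\underline{a_k})\big),$$ where $(-1)^\varepsilon$ is the Koszul sign. For a family $G$ of maps $A^{\otimes k}\otimes M\otimes A^{\otimes\ell}\to M^*$ of degree $|G|-k-\ell$ put $\delta(G)=G\circ\beta-(-1)^{|G|}\beta'\circ G$. An $A_\infty$ inner product on $M$ is a family $I$ with $\delta(I)=0$, that is, a morphism of $A_\infty$ modules $I:M\to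 M^*$ over $\mathrm{id}_A$. **Morphisms and equivalence.** A morphism $(f,F):(A,M,I)\to(B,N,J)$ consists of a morphism $f:A\to B$ of $A_\infty$ algebras and a morphism $F:M\to N$ of $A_\infty$ modules over $f$ such that $F^\sharp(J)-I=\delta(G)$ for some family $G$, where $F^\sharp(J)=F^*\circ J\circ F$. The triples $(A,M,I)$ and $(B,N,J)$ are equivalent if there are morphisms $(f,F):(A,M,I)\to(B,N,J)$ and $(g,G):(B,N,J)\to(A,M,I)$ such that $(f_1)_*:H(A)\to H(B)$ and $(g_1)_*$ are inverse to each other, and $(F_{0,0})_*:H(M)\to H(N)$ and $(G_{0,0})_*$ are inverse to each other. **Massey inner products.** Let $k+\ell\ge 1$, $n=k+\ell+2$, and let $(x_{1,1},\dots,x_{n,n})\in A^{\times k}\times M\times A^{\times\ell}\times M$ be a tuple of homogeneous elements of specified degrees. Count positions cyclically modulo $n$. A cyclic defining system consists of homogeneous elements $x_{i,j}$, with $|\underline{x_{i,j}}|=\sum_{t}|\underline{x_{t,t}}|$ over the positions $t$ of the cyclic interval $[i,j]$, for every cyclic interval $[i,j]$ contained in $[1,k+\ell+1]$ or in $[k+2,\,n+k]$,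 where $x_{i,j}\in M$ if $[i,j]$ contains one of the positions $k+1$, $n$, and $x_{i,j}\in A$ otherwise, with the given diagonal elements $x_{i,i}$, such that for all these $i,j$, including the two largest intervals, $$\underline{d(x_{i,j})}=-\sum \underline{\mu_r}\ (\text{resp. }\underline{\beta_{r,s}})\,(\underline{x_{i,j_1}},\underline{x_{j_1+1,j_2}},\dots),$$ the sum being over all ways of cutting $[i,j]$ into at least two consecutive intervals. Its staircase inner product is $$\mathcal I=\sum(-1)^{\varepsilon}\,\underline{I_{r,s}}\big(\underline{x_{i_0,i_1}},\dots,\underline{x_{i_{r-1}+1,i_r}},\underline{x_{i_r+1,j_0}},\underline{x_{j_0+1,j_1}},\dots,\underline{x_{j_{s-1}+1,j_s}}\big)\big(\underline{x_{j_s+1,i_0-1}}\big)\in R,$$ over all ways of cutting the circle of positions into consecutive intervals such that $k+1$ lies in the interval of the $M$-entry among the arguments of $I_{r,s}$ and $n$ lies in the interval $[j_s+1,i_0-1]$ (with $1\le i_0\le k+1$, and $i_0-1$ read as $n$ if $i_0=1$); $(-1)^\varepsilon$ is the Koszul sign of moving $\underline{x_{1,1}},\dots,\underline{x_{i_0-1,i_0-1}}$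 to the end. The Massey inner product set $\langle x_{1,1},\dots,x_{n,n}\rangle_I\subseteq R$ is the set of the values $\mathcal I$ of all cyclic defining systems. **Corollary.** Suppose that $(A,M,I)$ and $(B,N,J)$ are equivalent through morphisms $(f,F)$ and $(g,G)$ as above. Then for all $k,\ell\ge 0$ with $k+\ell\geq 1$ and all homogeneous cocycles $a_{1,1},\dots,a_{k,k}\in A$, $m_{k+1,k+1}\in M$, $a_{k+2,k+2},\dots,a_{k+\ell+1,k+\ell+1}\in A$, $m_{k+\ell+2,k+\ell+2}\in M$, $$\langle a_{1,1},\dots,m_{k+1,k+1},\dots,m_{k+\ell+2,k+\ell+2}\rangle_I=\langle f_1(a_{1,1}),\dots,F_{0,0}(m_{k+1,k+1}),\dots,F_{0,0}(m_{k+\ell+2,k+\ell+2})\rangle_J .$$ -/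

import Mathlib

namespace AInf

/-! ### Words, their splittings and their cuttings

A *letter* is a pair `(s, a)` consisting of an element `a` of a graded module together with its
*shifted* degree `s = |a| - 1`.  Words (lists of letters) are the arguments of the operations. -/

section Words

variable {α : Type*}

/-- All ways of writing a word as a concatenation `u ++ v`. -/
def splits : List α → List (List α × List α)
  | [] => [([], [])]
  | x :: w => ([], x :: w) :: (splits w).map fun p => (x :: p.1, p.2)

/-- Put a letter in front of the first block of a cut word. -/
def glue (x : α) : List (List α) → List (List α)
  | [] => [[x]]
  | b :: c => (x :: b) :: c

/-- All ways of cutting a word into consecutive non-empty blocks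
(for a word of length `n`, these are the compositions of `n`). -/
def cuts : List α → List (List (List α))
  | [] => [[]]
  | [x] => [[[x]]]
  | x :: y :: w => ((cuts (y :: w)).map fun c => [x] :: c) ++ ((cuts (y :: w)).map (glue x))

/-- `∑_{i ∈ l} φ i`. -/
def lsum {W : Type*} [AddCommMonoid W] (l : List α) (φ : α → W) : W := (l.map φ).sum

/-- The total shifted degree of a word. -/
def sdeg (w : List (ℤ × α)) : ℤ := (w.map Prod.fst).sum

/-- The exponent `s₁ (k - 1) + s₂ (k - 2) + ⋯ + s_{k-1}` in the sign relating an operation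
and its shifted version. -/
def shiftExp : List ℤ → ℤ
  | [] => 0
  | s :: t => s * (t.length : ℤ) + shiftExp t

end Words

/-! ### Families of multilinear maps and their shifted versions -/

section Operations

variable {R A M N : Type*} [CommRing R] [AddCommGroup A] [Module R A]
  [AddCommGroup M] [Module R M] [AddCommGroup N] [Module R N]

/-- `R`-multilinear maps `A^{⊗ k} ⊗ M ⊗ A^{⊗ l} → N`. -/
abbrev BiMultilinear (R A M N : Type*) [CommRing R] [AddCommGroup A] [Module R A]
    [AddCommGroup M] [Module R M] [AddCommGroup N] [Module R N] (k l : ℕ) :=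
  MultilinearMap R (fun _ : Fin k => A) (M →ₗ[R] MultilinearMap R (fun _ : Fin l => A) N)

/-- A letter `(s, a)` is homogeneous if `a` has degree `s + 1`, i.e. shifted degree `s`. -/
def IsHomog (𝒜 : ℤ → Submodule R A) (x : ℤ × A) : Prop := x.2 ∈ 𝒜 (x.1 + 1)

/-- The shifted operation `s ∘ φ_k ∘ (s⁻¹ ⊗ ⋯ ⊗ s⁻¹)` of a family `φ_k : A^{⊗ k} → N`, applied to
a word of length `k`. -/
def opEval (φ : ∀ k, MultilinearMap R (fun _ : Fin k => A) N) (w : List (ℤ × A)) : N :=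
  (shiftExp (w.map Prod.fst)).negOnePow • φ w.length fun i => (w.get i).2

/-- The shifted operation of a family `φ_{k,l} : A^{⊗ k} ⊗ M ⊗ A^{⊗ l} → N`, applied to
`(u, m, v)`. -/
def biEval (φ : ∀ k l, BiMultilinear R A M N k l) (u : List (ℤ × A)) (m : ℤ × M)
    (v : List (ℤ × A)) : N :=
  (shiftExp (u.map Prod.fst ++ m.1 :: v.map Prod.fst)).negOnePow •
    φ u.length v.length (fun i => (u.get i).2) m.2 fun i => (v.get i).2

/-- The letter given by applying a family of shifted degree `e` to the word `w`. -/
def opLetter (e : ℤ) (φ : ∀ k, MultilinearMap R (fun _ : Fin k => A) N) (w : List (ℤ × A)) :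
    ℤ × N :=
  (sdeg w + e, opEval φ w)

/-- The letter given by applying a family of shifted degree `e` to `(u, m, v)`. -/
def biLetter (e : ℤ) (φ : ∀ k l, BiMultilinear R A M N k l) (u : List (ℤ × A)) (m : ℤ × M)
    (v : List (ℤ × A)) : ℤ × N :=
  (sdeg u + m.1 + sdeg v + e, biEval φ u m v)

/-- `∑ ± φ(u₁, μ(u₂), u₃)` over all `w = u₁ ++ u₂ ++ u₃`, with the Koszul sign of `μ`
(of shifted degree one) moving past `u₁`. -/
def opPrecomp (μ : ∀ k, MultilinearMap R (fun _ : Fin k => A) A)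
    (φ : ∀ k, MultilinearMap R (fun _ : Fin k => A) N) (w : List (ℤ × A)) : N :=
  lsum (splits w) fun p => lsum (splits p.2) fun q =>
    (sdeg p.1).negOnePow • opEval φ (p.1 ++ opLetter 1 μ q.1 :: q.2)

/-- The sum of all terms obtained by first applying one `μ` to the left of the module element,
one `β` around the module element, or one `μ` to the right of the module element, and then `φ`,
with the Koszul sign of moving `μ` resp. `β` into place. -/
def biPrecomp (μ : ∀ k, MultilinearMap R (fun _ : Fin k => A) A)
    (β : ∀ k l, BiMultilinear R A M M k l) (φ : ∀ k l, BiMultilinear R A M N k l)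
    (u : List (ℤ × A)) (m : ℤ × M) (v : List (ℤ × A)) : N :=
  (lsum (splits u) fun p => lsum (splits p.2) fun q =>
    (sdeg p.1).negOnePow • biEval φ (p.1 ++ opLetter 1 μ q.1 :: q.2) m v)
  + (lsum (splits u) fun p => lsum (splits v) fun q =>
    (sdeg p.1).negOnePow • biEval φ p.1 (biLetter 1 β p.2 m q.1) q.2)
  + (lsum (splits v) fun p => lsum (splits p.2) fun q =>
    (sdeg u + m.1 + sdeg p.1).negOnePow • biEval φ u m (p.1 ++ opLetter 1 μ q.1 :: q.2))

/-- A family of maps `F_{k,l} : A^{⊗ k} ⊗ M ⊗ A^{⊗ l} → N` with `|F_{k,l}| = e - k - l`. -/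
structure BiFamily (𝒜 : ℤ → Submodule R A) (ℳ : ℤ → Submodule R M) (𝒩 : ℤ → Submodule R N)
    (e : ℤ) where
  map : ∀ k l, BiMultilinear R A M N k l
  map_mem : ∀ (k l : ℕ) (c : Fin k → ℤ) (p : ℤ) (d : Fin l → ℤ)
    (a : Fin k → A) (m : M) (b : Fin l → A),
    (∀ i, a i ∈ 𝒜 (c i)) → m ∈ ℳ p → (∀ i, b i ∈ 𝒜 (d i)) →
      map k l a m b ∈ 𝒩 (∑ i, c i + p + ∑ i, d i + e - k - l)

end Operations

/-! ### `A_∞` algebras, modules and their morphisms -/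

section Structures

variable {R A B M N : Type*} [CommRing R] [AddCommGroup A] [Module R A]
  [AddCommGroup B] [Module R B] [AddCommGroup M] [Module R M] [AddCommGroup N] [Module R N]

/-- An `A_∞` algebra structure on the graded module `A = ⨁ 𝒜 n`: maps `μ_k` of degree `2 - k` for
`k ≥ 1` (there is no `μ_0`, which is recorded as `μ_0 = 0`) with `μ² = 0`. -/
structure Alg (𝒜 : ℤ → Submodule R A) where
  mu : ∀ k, MultilinearMap R (fun _ : Fin k => A) A
  mu_zero : mu 0 = 0
  mu_mem : ∀ (k : ℕ) (d : Fin k → ℤ) (a : Fin k → A), (∀ i, a i ∈ 𝒜 (d i)) →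
    mu k a ∈ 𝒜 (∑ i, d i + 2 - k)
  rel : ∀ w : List (ℤ × A), (∀ x ∈ w, IsHomog 𝒜 x) → opPrecomp mu mu w = 0

/-- A morphism of `A_∞` algebras: maps `f_k` of degree `1 - k` for `k ≥ 1`
with `f ∘ μ = ν ∘ f`. -/
structure AlgHom {𝒜 : ℤ → Submodule R A} {ℬ : ℤ → Submodule R B} (X : Alg 𝒜) (Y : Alg ℬ) where
  map : ∀ k, MultilinearMap R (fun _ : Fin k => A) B
  map_zero : map 0 = 0
  map_mem : ∀ (k : ℕ) (d : Fin k → ℤ) (a : Fin k → A), (∀ i, a i ∈ 𝒜 (d i)) →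
    map k a ∈ ℬ (∑ i, d i + 1 - k)
  rel : ∀ w : List (ℤ × A), (∀ x ∈ w, IsHomog 𝒜 x) →
    opPrecomp X.mu map w = lsum (cuts w) fun c => opEval Y.mu (c.map (opLetter 0 map))

/-- An `A_∞` module structure on the graded module `M = ⨁ ℳ n` over an `A_∞` algebra: maps
`β_{k,l}` of degree `1 - k - l` with `β² = 0`. -/
structure Bimod {𝒜 : ℤ → Submodule R A} (X : Alg 𝒜) (ℳ : ℤ → Submodule R M) extends
    BiFamily 𝒜 ℳ ℳ 1 where
  rel : ∀ (u : List (ℤ × A)) (m : ℤ × M) (v : List (ℤ × A)),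
    (∀ x ∈ u, IsHomog 𝒜 x) → IsHomog ℳ m → (∀ x ∈ v, IsHomog 𝒜 x) →
      biPrecomp X.mu map map u m v = 0

/-- A morphism of `A_∞` modules `F : M → N` of degree `e` over a morphism `f` of `A_∞` algebras. -/
structure ModHom {𝒜 : ℤ → Submodule R A} {ℬ : ℤ → Submodule R B}
    {ℳ : ℤ → Submodule R M} {𝒩 : ℤ → Submodule R N} {X : Alg 𝒜} {Y : Alg ℬ}
    (f : AlgHom X Y) (P : Bimod X ℳ) (Q : Bimod Y 𝒩) (e : ℤ) extends BiFamily 𝒜 ℳ 𝒩 e where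
  rel : ∀ (u : List (ℤ × A)) (m : ℤ × M) (v : List (ℤ × A)),
    (∀ x ∈ u, IsHomog 𝒜 x) → IsHomog ℳ m → (∀ x ∈ v, IsHomog 𝒜 x) →
      biPrecomp X.mu P.map map u m v =
        e.negOnePow • lsum (splits u) fun p => lsum (splits v) fun q =>
          lsum (cuts p.1) fun c => lsum (cuts q.2) fun d =>
            (e * sdeg p.1).negOnePow •
              biEval Q.map (c.map (opLetter 0 f.map)) (biLetter e map p.2 m q.1)
                (d.map (opLetter 0 f.map))

/-! ### Differentials, cohomology and induced maps -/

/-- The differential `d = μ_1` of an `A_∞` algebra. -/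
def Alg.d {𝒜 : ℤ → Submodule R A} (X : Alg 𝒜) : A →ₗ[R] A :=
  (MultilinearMap.ofSubsingleton R A A (0 : Fin 1)).symm (X.mu 1)

/-- The component `f_1` of a morphism of `A_∞` algebras. -/
def AlgHom.one {𝒜 : ℤ → Submodule R A} {ℬ : ℤ → Submodule R B} {X : Alg 𝒜} {Y : Alg ℬ}
    (f : AlgHom X Y) : A →ₗ[R] B :=
  (MultilinearMap.ofSubsingleton R A B (0 : Fin 1)).symm (f.map 1)

/-- The component `φ_{0,0} : M → N` of a family. -/
def biZero (φ : ∀ k l, BiMultilinear R A M N k l) : M →ₗ[R] N where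
  toFun m := φ 0 0 Fin.elim0 m Fin.elim0
  map_add' := by simp
  map_smul' := by simp

/-- The differential `d = β_{0,0}` of an `A_∞` module. -/
def Bimod.d {𝒜 : ℤ → Submodule R A} {X : Alg 𝒜} {ℳ : ℤ → Submodule R M} (P : Bimod X ℳ) :
    M →ₗ[R] M :=
  biZero P.map

/-- The component `F_{0,0}` of a morphism of `A_∞` modules. -/
def ModHom.zero {𝒜 : ℤ → Submodule R A} {ℬ : ℤ → Submodule R B}
    {ℳ : ℤ → Submodule R M} {𝒩 : ℤ → Submodule R N} {X : Alg 𝒜} {Y : Alg ℬ}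
    {f : AlgHom X Y} {P : Bimod X ℳ} {Q : Bimod Y 𝒩} {e : ℤ} (F : ModHom f P Q e) : M →ₗ[R] N :=
  biZero F.map

/-- The cohomology `ker d / im d`. -/
abbrev Coh (d : M →ₗ[R] M) := LinearMap.ker d ⧸ (LinearMap.range d).submoduleOf (LinearMap.ker d)

theorem lsum_singleton {α W : Type*} [AddCommMonoid W] (x : α) (φ : α → W) :
    lsum [x] φ = φ x := by
  simp [lsum]

theorem opEval_nil (μ : ∀ k, MultilinearMap R (fun _ : Fin k => A) A) (hμ : μ 0 = 0) :
    opEval μ [] = 0 := by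
  unfold opEval
  change _ • μ 0 _ = 0
  rw [hμ, zero_apply, smul_zero]

theorem opEval_nil_letter (μ : ∀ k, MultilinearMap R (fun _ : Fin k => A) A) (hμ : μ 0 = 0)
    (φ : ∀ k, MultilinearMap R (fun _ : Fin k => A) B) (u v : List (ℤ × A)) :
    opEval φ (u ++ opLetter 1 μ [] :: v) = 0 := by
  have h0 := opEval_nil μ hμ
  unfold opEval
  rw [MultilinearMap.map_coord_zero _ (⟨u.length, by simp⟩ : Fin (u ++ _ :: v).length), smul_zero]
  simp [opLetter, h0]

theorem opEval_single (φ : ∀ k, MultilinearMap R (fun _ : Fin k => A) B) (x : ℤ × A) :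
    opEval φ [x] = (MultilinearMap.ofSubsingleton R A B (0 : Fin 1)).symm (φ 1) x.2 := by
  have : shiftExp [x.1] = 0 := by simp [shiftExp]
  simp only [opEval, List.map_cons, List.map_nil, this, Int.negOnePow_zero, one_smul]
  change φ 1 _ = φ 1 _
  congr 1
  funext i
  fin_cases i
  rfl

theorem opPrecomp_single (μ : ∀ k, MultilinearMap R (fun _ : Fin k => A) A) (hμ : μ 0 = 0)
    (φ : ∀ k, MultilinearMap R (fun _ : Fin k => A) B) (x : ℤ × A) :
    opPrecomp μ φ [x] = (MultilinearMap.ofSubsingleton R A B (0 : Fin 1)).symm (φ 1)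
      ((MultilinearMap.ofSubsingleton R A A (0 : Fin 1)).symm (μ 1) x.2) := by
  have h1 := opEval_nil_letter μ hμ φ [] [x]
  have h2 := opEval_nil_letter μ hμ φ [x] []
  rw [List.nil_append] at h1
  simp only [opPrecomp, splits, lsum, List.map_cons, List.map_nil, List.sum_cons, List.sum_nil,
    h1, h2, smul_zero, zero_add, add_zero, List.nil_append]
  rw [opEval_single]
  simp [sdeg, opLetter, opEval_single]

theorem cuts_single_sum (ν : ∀ k, MultilinearMap R (fun _ : Fin k => B) B)
    (φ : ∀ k, MultilinearMap R (fun _ : Fin k => A) B) (x : ℤ × A) :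
    (lsum (cuts [x]) fun c => opEval ν (c.map (opLetter 0 φ))) =
      (MultilinearMap.ofSubsingleton R B B (0 : Fin 1)).symm (ν 1)
        ((MultilinearMap.ofSubsingleton R A B (0 : Fin 1)).symm (φ 1) x.2) := by
  simp [cuts, lsum, opEval_single, opLetter]

theorem biEval_nil (φ : ∀ k l, BiMultilinear R A M N k l) (m : ℤ × M) :
    biEval φ [] m [] = biZero φ m.2 := by
  have : shiftExp [m.1] = 0 := by simp [shiftExp]
  simp only [biEval, List.map_nil, List.nil_append, this, Int.negOnePow_zero, one_smul]
  have h : ∀ a a' b b' : Fin 0 → A, φ 0 0 a m.2 b = φ 0 0 a' m.2 b' := by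
    intro a a' b b'
    rw [Subsingleton.elim a a', Subsingleton.elim b b']
  exact h _ _ _ _

theorem biEval_nil_letter_left (μ : ∀ k, MultilinearMap R (fun _ : Fin k => A) A) (hμ : μ 0 = 0)
    (φ : ∀ k l, BiMultilinear R A M N k l) (m : ℤ × M) :
    biEval φ [opLetter 1 μ []] m [] = 0 := by
  have h0 := opEval_nil μ hμ
  unfold biEval
  rw [MultilinearMap.map_coord_zero _ (⟨0, by simp⟩ : Fin [opLetter 1 μ []].length)]
  · simp
  · simp [opLetter, h0]

theorem biEval_nil_letter_right (μ : ∀ k, MultilinearMap R (fun _ : Fin k => A) A) (hμ : μ 0 = 0)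
    (φ : ∀ k l, BiMultilinear R A M N k l) (m : ℤ × M) :
    biEval φ [] m [opLetter 1 μ []] = 0 := by
  have h0 := opEval_nil μ hμ
  unfold biEval
  rw [MultilinearMap.map_coord_zero _ (⟨0, by simp⟩ : Fin [opLetter 1 μ []].length), smul_zero]
  simp [opLetter, h0]

theorem biPrecomp_nil (μ : ∀ k, MultilinearMap R (fun _ : Fin k => A) A) (hμ : μ 0 = 0)
    (β : ∀ k l, BiMultilinear R A M M k l) (φ : ∀ k l, BiMultilinear R A M N k l) (m : ℤ × M) :
    biPrecomp μ β φ [] m [] = biZero φ (biZero β m.2) := by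
  simp only [biPrecomp, splits, lsum_singleton, List.nil_append, biEval_nil_letter_left μ hμ,
    biEval_nil_letter_right μ hμ, smul_zero, zero_add, add_zero, biEval_nil, biLetter]
  simp [sdeg]

theorem ker_aux {dM : M →ₗ[R] M} {dN : N →ₗ[R] N} {φ : M →ₗ[R] N} {ε : ℤˣ}
    (h : ∀ x, φ (dM x) = ε • dN (φ x)) :
    ∀ x ∈ LinearMap.ker dM, φ x ∈ LinearMap.ker dN := by
  intro x hx
  have h1 := h x
  rw [LinearMap.mem_ker.1 hx, map_zero] at h1
  rw [LinearMap.mem_ker]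
  have h2 : ε⁻¹ • ε • dN (φ x) = 0 := by rw [← h1, smul_zero]
  rwa [inv_smul_smul] at h2

/-- The map on cohomology induced by a linear map that commutes with the differentials
up to a global sign. -/
def cohMap {dM : M →ₗ[R] M} {dN : N →ₗ[R] N} (φ : M →ₗ[R] N) (ε : ℤˣ)
    (h : ∀ x, φ (dM x) = ε • dN (φ x)) : Coh dM →ₗ[R] Coh dN :=
  Submodule.mapQ _ _ (φ.restrict (ker_aux h)) (by
    rintro ⟨x, hx⟩ ⟨z, hz⟩
    refine ⟨ε • φ z, ?_⟩
    have hz' : dM z = x := hz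
    have h1 := h z
    rw [hz'] at h1
    change dN (ε • φ z) = φ x
    rw [h1]
    rcases Int.units_eq_one_or ε with rfl | rfl <;> simp [Units.smul_def])

theorem AlgHom.one_d {𝒜 : ℤ → Submodule R A} {ℬ : ℤ → Submodule R B} [DirectSum.Decomposition 𝒜]
    {X : Alg 𝒜} {Y : Alg ℬ} (f : AlgHom X Y) (x : A) :
    f.one (X.d x) = (1 : ℤˣ) • Y.d (f.one x) := by
  rw [one_smul]
  induction x using DirectSum.Decomposition.inductionOn 𝒜 with
  | zero => simp
  | add x y hx hy => simp only [map_add, hx, hy]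
  | @homogeneous d x =>
    have h := f.rel [(d - 1, (x : A))] (by simp [IsHomog])
    rw [opPrecomp_single X.mu X.mu_zero, cuts_single_sum] at h
    exact h

theorem ModHom.zero_d {𝒜 : ℤ → Submodule R A} {ℬ : ℤ → Submodule R B}
    {ℳ : ℤ → Submodule R M} {𝒩 : ℤ → Submodule R N} [DirectSum.Decomposition ℳ]
    {X : Alg 𝒜} {Y : Alg ℬ} {f : AlgHom X Y} {P : Bimod X ℳ} {Q : Bimod Y 𝒩} {e : ℤ}
    (F : ModHom f P Q e) (x : M) :
    F.zero (P.d x) = e.negOnePow • Q.d (F.zero x) := by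
  induction x using DirectSum.Decomposition.inductionOn ℳ with
  | zero => simp
  | add x y hx hy => simp only [map_add, hx, hy, smul_add]
  | @homogeneous d x =>
    have h := F.rel [] (d - 1, (x : M)) [] (by simp) (by simp [IsHomog]) (by simp)
    rw [biPrecomp_nil X.mu X.mu_zero] at h
    simp only [splits, cuts, lsum_singleton, List.map_nil, sdeg, List.sum_nil, mul_zero,
      Int.negOnePow_zero, one_smul, biEval_nil, biLetter] at h
    exact h

/-- `(f_1)_* : H(A) → H(B)`. -/
def AlgHom.coh {𝒜 : ℤ → Submodule R A} {ℬ : ℤ → Submodule R B} [DirectSum.Decomposition 𝒜]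
    {X : Alg 𝒜} {Y : Alg ℬ} (f : AlgHom X Y) : Coh X.d →ₗ[R] Coh Y.d :=
  cohMap f.one 1 f.one_d

/-- `(F_{0,0})_* : H(M) → H(N)`. -/
def ModHom.coh {𝒜 : ℤ → Submodule R A} {ℬ : ℤ → Submodule R B}
    {ℳ : ℤ → Submodule R M} {𝒩 : ℤ → Submodule R N} [DirectSum.Decomposition ℳ]
    {X : Alg 𝒜} {Y : Alg ℬ} {f : AlgHom X Y} {P : Bimod X ℳ} {Q : Bimod Y 𝒩} {e : ℤ}
    (F : ModHom f P Q e) : Coh P.d →ₗ[R] Coh Q.d :=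
  cohMap F.zero e.negOnePow F.zero_d

end Structures

/-! ### `A_∞` inner products -/

section InnerProducts

variable {R A B M N : Type*} [CommRing R] [AddCommGroup A] [Module R A]
  [AddCommGroup B] [Module R B] [AddCommGroup M] [Module R M] [AddCommGroup N] [Module R N]

/-- The grading of the dual: a functional has degree `n` if it vanishes on all homogeneous elements
of degree different from `-n`. -/
def dualGrading (ℳ : ℤ → Submodule R M) (n : ℤ) : Submodule R (Module.Dual R M) where
  carrier := {φ | ∀ j, j ≠ -n → ∀ m ∈ ℳ j, φ m = 0}
  add_mem' := by
    intro φ ψ hφ hψ j hj m hm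
    simp [hφ j hj m hm, hψ j hj m hm]
  zero_mem' := by
    intro j _ m _
    simp
  smul_mem' := by
    intro c φ hφ j hj m hm
    simp [hφ j hj m hm]

/-- The evaluation of shifted functionals on shifted elements, `ev ∘ (s⁻¹ ⊗ s⁻¹)`. -/
def pair (φ : ℤ × Module.Dual R M) (m : ℤ × M) : R := φ.1.negOnePow • φ.2 m.2

/-- The shifted operation `β'` of the dual module `M^*`, applied to `(u, φ, v)` and evaluated on
the letter `n` of `M`. -/
def dualEval {𝒜 : ℤ → Submodule R A} {X : Alg 𝒜} {ℳ : ℤ → Submodule R M} (P : Bimod X ℳ)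
    (u : List (ℤ × A)) (φ : ℤ × Module.Dual R M) (v : List (ℤ × A)) (n : ℤ × M) : R :=
  -((sdeg u * (φ.1 + sdeg v + n.1) + φ.1).negOnePow • pair φ (biLetter 1 P.map v n u))

/-- `δ(G) = G ∘ β - (-1)^{|G|} β' ∘ G` for a family `G` of maps `A^{⊗ k} ⊗ M ⊗ A^{⊗ l} → M^*` of
degree `e`; the functional `δ(G)(u, m, v)`, of shifted degree `sdeg u + m.1 + sdeg v + e + 1`, is
evaluated on the letter `n`. -/
def deltaEval {𝒜 : ℤ → Submodule R A} {X : Alg 𝒜} {ℳ : ℤ → Submodule R M} (P : Bimod X ℳ)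
    {e : ℤ} (G : BiFamily 𝒜 ℳ (dualGrading ℳ) e)
    (u : List (ℤ × A)) (m : ℤ × M) (v : List (ℤ × A)) (n : ℤ × M) : R :=
  pair (sdeg u + m.1 + sdeg v + e + 1, biPrecomp X.mu P.map G.map u m v) n
  - e.negOnePow • lsum (splits u) fun p => lsum (splits v) fun q =>
      (e * sdeg p.1).negOnePow • dualEval P p.1 (biLetter e G.map p.2 m q.1) q.2 n

/-- An `A_∞` inner product of degree `e` on `M`: a morphism of `A_∞` modules `I : M → M^*` over the
identity of `A`, i.e. a family with `δ(I) = 0`. -/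
structure InnerProd {𝒜 : ℤ → Submodule R A} {X : Alg 𝒜} {ℳ : ℤ → Submodule R M} (P : Bimod X ℳ)
    (e : ℤ) extends BiFamily 𝒜 ℳ (dualGrading ℳ) e where
  rel : ∀ (u : List (ℤ × A)) (m : ℤ × M) (v : List (ℤ × A)) (n : ℤ × M),
    (∀ x ∈ u, IsHomog 𝒜 x) → IsHomog ℳ m → (∀ x ∈ v, IsHomog 𝒜 x) → IsHomog ℳ n →
      deltaEval P toBiFamily u m v n = 0

/-- The value `I(u, m, v)(n)` of the shifted family `I`. -/
def ipEval {𝒜 : ℤ → Submodule R A} {ℳ : ℤ → Submodule R M} {e : ℤ}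
    (I : BiFamily 𝒜 ℳ (dualGrading ℳ) e)
    (u : List (ℤ × A)) (m : ℤ × M) (v : List (ℤ × A)) (n : ℤ × M) : R :=
  pair (biLetter e I.map u m v) n

/-- The pullback `F^♯(J) = F^* ∘ J ∘ F` of an `A_∞` inner product `J` (of degree `j`) along a
morphism `F` (of degree `e`), as the function `F^♯(J)(u, m, v)(n)`.
Here `u = u₁ ++ p₁ ++ p₂` and `v = q₁ ++ q₂ ++ v₂`; the blocks of `p₁` and `q₂` go into components
of `f`, while `F` is applied to `(p₂, m, q₁)` and to `(v₂, n, u₁)`.  The sign is the Koszul sign of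
the rearrangement of `F^*, J, F, u₁, p₁, p₂, m, q₁, q₂, v₂, n` into
`J, p₁, F, p₂, m, q₁, q₂, F^*, v₂, n, u₁`. -/
def pullbackEval {𝒜 : ℤ → Submodule R A} {ℬ : ℤ → Submodule R B}
    {ℳ : ℤ → Submodule R M} {𝒩 : ℤ → Submodule R N} {X : Alg 𝒜} {Y : Alg ℬ}
    {f : AlgHom X Y} {P : Bimod X ℳ} {Q : Bimod Y 𝒩} {e j : ℤ}
    (F : ModHom f P Q e) (J : BiFamily ℬ 𝒩 (dualGrading 𝒩) j)
    (u : List (ℤ × A)) (m : ℤ × M) (v : List (ℤ × A)) (n : ℤ × M) : R :=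
  lsum (splits u) fun s => lsum (splits v) fun t =>
    lsum (splits s.2) fun p => lsum (splits t.1) fun q =>
      lsum (cuts p.1) fun c => lsum (cuts q.2) fun d =>
        (sdeg s.1 * (sdeg s.2 + m.1 + sdeg v + n.1) + e * sdeg p.1
            + e * (j + e + sdeg s.2 + m.1 + sdeg t.1)).negOnePow •
          ipEval J (c.map (opLetter 0 f.map)) (biLetter e F.map p.2 m q.1)
            (d.map (opLetter 0 f.map)) (biLetter e F.map t.2 n s.1)

/-- A morphism `(f, F) : (A, M, I) → (B, N, J)` of `A_∞` algebras with `A_∞` modules and `A_∞`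
inner products: the difference `F^♯(J) - I` has to be exact, i.e. of the form `δ(G)`. -/
structure IPHom {𝒜 : ℤ → Submodule R A} {ℬ : ℤ → Submodule R B}
    {ℳ : ℤ → Submodule R M} {𝒩 : ℤ → Submodule R N} {X : Alg 𝒜} {Y : Alg ℬ}
    {P : Bimod X ℳ} {Q : Bimod Y 𝒩} {i j : ℤ} (I : InnerProd P i) (J : InnerProd Q j) where
  algHom : AlgHom X Y
  degree : ℤ
  modHom : ModHom algHom P Q degree
  exact : ∃ (g : ℤ) (G : BiFamily 𝒜 ℳ (dualGrading ℳ) g),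
    ∀ (u : List (ℤ × A)) (m : ℤ × M) (v : List (ℤ × A)) (n : ℤ × M),
      (∀ x ∈ u, IsHomog 𝒜 x) → IsHomog ℳ m → (∀ x ∈ v, IsHomog 𝒜 x) → IsHomog ℳ n →
        pullbackEval modHom J.toBiFamily u m v n - ipEval I.toBiFamily u m v n
          = deltaEval P G u m v n

/-- Two morphisms `(f, F) : (A, M, I) → (B, N, J)` and `(g, G) : (B, N, J) → (A, M, I)` are
quasi-inverses of each other if `(f_1)_*` and `(g_1)_*` are inverse to each other, and
`(F_{0,0})_*` and `(G_{0,0})_*` are inverse to each other. -/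
structure IsQuasiInverse {𝒜 : ℤ → Submodule R A} {ℬ : ℤ → Submodule R B}
    {ℳ : ℤ → Submodule R M} {𝒩 : ℤ → Submodule R N}
    [DirectSum.Decomposition 𝒜] [DirectSum.Decomposition ℬ]
    [DirectSum.Decomposition ℳ] [DirectSum.Decomposition 𝒩]
    {X : Alg 𝒜} {Y : Alg ℬ} {P : Bimod X ℳ} {Q : Bimod Y 𝒩} {i j : ℤ}
    {I : InnerProd P i} {J : InnerProd Q j} (Φ : IPHom I J) (Ψ : IPHom J I) : Prop where
  alg_left : Ψ.algHom.coh ∘ₗ Φ.algHom.coh = LinearMap.id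
  alg_right : Φ.algHom.coh ∘ₗ Ψ.algHom.coh = LinearMap.id
  mod_left : Ψ.modHom.coh ∘ₗ Φ.modHom.coh = LinearMap.id
  mod_right : Φ.modHom.coh ∘ₗ Ψ.modHom.coh = LinearMap.id

end InnerProducts

/-! ### Massey inner products -/

section Massey

variable {R A B M N : Type*} [CommRing R] [AddCommGroup A] [Module R A]
  [AddCommGroup B] [Module R B] [AddCommGroup M] [Module R M] [AddCommGroup N] [Module R N]

/-- A tuple in `A^{× k} × M × A^{× l} × M`, together with the (unshifted) degrees of its entries. -/
structure CyclicTuple (A M : Type*) (k l : ℕ) where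
  aDeg : Fin k → ℤ
  a : Fin k → A
  mDeg : ℤ
  m : M
  bDeg : Fin l → ℤ
  b : Fin l → A
  nDeg : ℤ
  n : M

/-- The entries are homogeneous of the given degrees, and they are cocycles. -/
structure CyclicTuple.IsCocycle {𝒜 : ℤ → Submodule R A} {X : Alg 𝒜} {ℳ : ℤ → Submodule R M}
    (P : Bimod X ℳ) {k l : ℕ} (t : CyclicTuple A M k l) : Prop where
  a_mem : ∀ i, t.a i ∈ 𝒜 (t.aDeg i)
  m_mem : t.m ∈ ℳ t.mDeg
  b_mem : ∀ i, t.b i ∈ 𝒜 (t.bDeg i)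
  n_mem : t.n ∈ ℳ t.nDeg
  a_closed : ∀ i, X.d (t.a i) = 0
  m_closed : P.d t.m = 0
  b_closed : ∀ i, X.d (t.b i) = 0
  n_closed : P.d t.n = 0

/-- The image of a tuple under `f_1` and `F_{0,0}`. -/
def CyclicTuple.image {𝒜 : ℤ → Submodule R A} {ℬ : ℤ → Submodule R B}
    {ℳ : ℤ → Submodule R M} {𝒩 : ℤ → Submodule R N} {X : Alg 𝒜} {Y : Alg ℬ}
    {f : AlgHom X Y} {P : Bimod X ℳ} {Q : Bimod Y 𝒩} {e : ℤ} (F : ModHom f P Q e) {k l : ℕ}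
    (t : CyclicTuple A M k l) : CyclicTuple B N k l where
  aDeg := t.aDeg
  a i := f.one (t.a i)
  mDeg := t.mDeg + e
  m := F.zero t.m
  bDeg := t.bDeg
  b i := f.one (t.b i)
  nDeg := t.nDeg + e
  n := F.zero t.n

/-- The shifted degree of the `p`-th entry of a tuple; the positions `1, …, k + l + 2` are continued
periodically. -/
def CyclicTuple.sdegAt {k l : ℕ} (t : CyclicTuple A M k l) (p : ℕ) : ℤ :=
  let r := (p - 1) % (k + l + 2)
  if h : r < k then t.aDeg ⟨r, h⟩ - 1
  else if r = k then t.mDeg - 1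
  else if h : r - (k + 1) < l then t.bDeg ⟨r - (k + 1), h⟩ - 1
  else t.nDeg - 1

/-- The entries of a triangular system with one module element on the diagonal, say at position `c`.
The entry at `(i, j)` is `a i j` if `c ∉ [i, j]`, and `m i j` if `c ∈ [i, j]`. -/
structure TriSystem (A M : Type*) where
  a : ℕ → ℕ → A
  m : ℕ → ℕ → M

/-- The letter `x_{i,j}` of `A` for a block `[i, i + 1, …, j]` of positions; `D` gives the shifted
degrees of the diagonal entries. -/
def TriSystem.aLetter (D : ℕ → ℤ) (x : TriSystem A M) (b : List ℕ) : ℤ × A :=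
  ((b.map D).sum, x.a b.headI b.getLastI)

/-- The letter `x_{i,j}` of `M` for a block `[i, i + 1, …, j]` of positions. -/
def TriSystem.mLetter (D : ℕ → ℤ) (x : TriSystem A M) (b : List ℕ) : ℤ × M :=
  ((b.map D).sum, x.m b.headI b.getLastI)

/-- The staircase product over `[i, j]` in `A`: the sum over all ways of cutting `[i, …, j]` into
at least two consecutive blocks. -/
def stairA {𝒜 : ℤ → Submodule R A} (X : Alg 𝒜) (D : ℕ → ℤ) (x : TriSystem A M) (i j : ℕ) : A :=
  lsum ((cuts (List.range' i (j + 1 - i))).filter fun c => 2 ≤ c.length) fun c =>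
    opEval X.mu (c.map (x.aLetter D))

/-- The staircase product over `[i, j] ∋ c` in `M`: the sum over all ways of cutting `[i, …, j]`
into at least two consecutive blocks, one of which contains the position `c`. -/
def stairM {𝒜 : ℤ → Submodule R A} {X : Alg 𝒜} {ℳ : ℤ → Submodule R M} (P : Bimod X ℳ)
    (D : ℕ → ℤ) (c : ℕ) (x : TriSystem A M) (i j : ℕ) : M :=
  lsum (splits (List.range' i (c - i))) fun p => lsum (splits (List.range' (c + 1) (j - c))) fun q =>
    lsum (cuts p.1) fun y => lsum (cuts q.2) fun z =>
      if 1 ≤ y.length + z.length then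
        biEval P.map (y.map (x.aLetter D)) (x.mLetter D (p.2 ++ c :: q.1)) (z.map (x.aLetter D))
      else 0

/-- A triangular system on the positions `p, …, q` with module element at position `c`, including
the top left corner, which satisfies `d(x_{i,j}) = -S^{i,j}` everywhere. -/
structure IsDefiningSystem {𝒜 : ℤ → Submodule R A} {X : Alg 𝒜} {ℳ : ℤ → Submodule R M}
    (P : Bimod X ℳ) (D : ℕ → ℤ) (p c q : ℕ) (x : TriSystem A M) : Prop where
  a_mem : ∀ i j, p ≤ i → i ≤ j → j ≤ q → (j < c ∨ c < i) →
    x.a i j ∈ 𝒜 (∑ t ∈ Finset.Icc i j, D t + 1)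
  m_mem : ∀ i j, p ≤ i → i ≤ c → c ≤ j → j ≤ q →
    x.m i j ∈ ℳ (∑ t ∈ Finset.Icc i j, D t + 1)
  a_eq : ∀ i j, p ≤ i → i ≤ j → j ≤ q → (j < c ∨ c < i) →
    X.d (x.a i j) = -stairA X D x i j
  m_eq : ∀ i j, p ≤ i → i ≤ c → c ≤ j → j ≤ q →
    P.d (x.m i j) = -stairM P D c x i j

/-- A cyclic defining system for a tuple: a defining system `x` for
`(a_1, …, a_k, m, b_1, …, b_l)` on the positions `1, …, k + l + 1`, and a defining system `x'` for
`(b_1, …, b_l, n, a_1, …, a_k)` on the positions `k + 2, …, 2k + l + 2` (the position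
`k + l + 2 + i` being the position `i`), which coincide on their common part. -/
structure IsCyclicDefiningSystem {𝒜 : ℤ → Submodule R A} {X : Alg 𝒜} {ℳ : ℤ → Submodule R M}
    (P : Bimod X ℳ) {k l : ℕ} (t : CyclicTuple A M k l) (x x' : TriSystem A M) : Prop where
  lower : IsDefiningSystem P t.sdegAt 1 (k + 1) (k + l + 1) x
  upper : IsDefiningSystem P t.sdegAt (k + 2) (k + l + 2) (2 * k + l + 2) x'
  diag_a : ∀ i : Fin k, x.a (i + 1) (i + 1) = t.a i
  diag_m : x.m (k + 1) (k + 1) = t.m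
  diag_b : ∀ i : Fin l, x.a (k + 2 + i) (k + 2 + i) = t.b i
  diag_n : x'.m (k + l + 2) (k + l + 2) = t.n
  overlap_a : ∀ i j, 1 ≤ i → i ≤ j → j ≤ k →
    x'.a (i + (k + l + 2)) (j + (k + l + 2)) = x.a i j
  overlap_b : ∀ i j, k + 2 ≤ i → i ≤ j → j ≤ k + l + 1 → x'.a i j = x.a i j

/-- The staircase inner product of `x, x'`.  With `[1, …, k] = s₁ ++ p₁ ++ p₂` and
`[k + 2, …, k + l + 1] = q₁ ++ q₂ ++ t₂`, the positions in `p₁` and `q₂` are cut into blocks, the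
first module entry has the block `p₂, k + 1, q₁`, and the second one has the block
`t₂, k + l + 2, s₁`.  The sign is the Koszul sign of moving the diagonal entries with positions in
`s₁` to the end. -/
def stairIP {𝒜 : ℤ → Submodule R A} {ℳ : ℤ → Submodule R M} {e : ℤ}
    (I : BiFamily 𝒜 ℳ (dualGrading ℳ) e) {k l : ℕ} (t : CyclicTuple A M k l)
    (x x' : TriSystem A M) : R :=
  let D := t.sdegAt
  let n := k + l + 2
  lsum (splits (List.range' 1 k)) fun s => lsum (splits (List.range' (k + 2) l)) fun r =>
    lsum (splits s.2) fun p => lsum (splits r.1) fun q =>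
      lsum (cuts p.1) fun y => lsum (cuts q.2) fun z =>
        ((s.1.map D).sum *
            ((s.2.map D).sum + D (k + 1) + ((List.range' (k + 2) l).map D).sum + D n)).negOnePow •
          ipEval I (y.map (x.aLetter D)) (x.mLetter D (p.2 ++ (k + 1) :: q.1))
            (z.map (x.aLetter D)) (x'.mLetter D (r.2 ++ n :: s.1.map (· + n)))

/-- The `(k, l)`-th Massey inner product set of a tuple. -/
def masseyIP {𝒜 : ℤ → Submodule R A} {X : Alg 𝒜} {ℳ : ℤ → Submodule R M} {P : Bimod X ℳ} {e : ℤ}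
    (I : InnerProd P e) {k l : ℕ} (t : CyclicTuple A M k l) : Set R :=
  {ρ | ∃ x x' : TriSystem A M, IsCyclicDefiningSystem P t x x' ∧ ρ = stairIP I.toBiFamily t x x'}

end Massey

end AInf

/-! A cyclic defining system is a solution of a Maurer-Cartan equation. Its entries are regarded as
functions on blocks of positions. Then d(x) = -S says that, for every block, the sum of μ resp. β
over all cuttings, the trivial cutting included, is zero (`IsSystem`). The staircase inner product
is the sum of I over the cuttings of the cyclic word (`ipsum`); `mem_masseyIP_iff` translates
between the two descriptions.

Two identities for sums over cuttings carry the proof. First, precomposing with μ or β before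
summing amounts to marking one block and placing its Maurer-Cartan sum there (`csum_precomp`,
`bsum_precomp`, `ipsum_deltaEval`). On a system such sums vanish, a combinatorial Stokes theorem.
Second, applying f and F to the blocks and cutting again is composition (`csum_push`, `bsum_push`,
`ipsum_push`). Together with f ∘ μ = ν ∘ f and its module version they show that the image of a
system is a system (`IsSystem.push`). Together with F^♯(J) - I = δ(G) they show that the value is
preserved up to a sign depending only on degrees (`IsSystem.ipsum_eq_push`).

The round trip through both morphisms changes each entry within its cohomology class, so Massey
inner products must be seen to depend on classes only. `IsSystem.gauge` extends a change of one
diagonal entry by a coboundary to a change of the whole system. Each position occurs once in the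
word, so the change is exactly linear, without higher order terms. The Maurer-Cartan sums change by
an expression in μ² or β², the value by one in δ(I), and both are zero.

What remains is degrees and signs, since the module morphisms may have any degrees e and e'. A
nonzero value determines the total degree of the tuple (`total_eq_of_mem_masseyIP`). If e + e' ≠ 0,
the round trip therefore excludes nonzero values on both sides. The given module entries are then
coboundaries, and only solvability of the equations is at stake, where module entries may be taken
to be zero (`zero_mem_masseyIP`). If e + e' = 0 and both sides have nonzero values, degrees force i
= j + 2e. At least one of the two signs is then 1 (`units_eq_one_or_eq_one_of_degrees`), which
suffices because signs square to 1. -/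

namespace AInf

set_option linter.unusedSectionVars false

/-! ### Sums over splittings and cuttings -/

section Combinatorics

variable {α β W : Type*} [AddCommMonoid W]

theorem lsum_nil (φ : α → W) : lsum [] φ = 0 := rfl

theorem lsum_cons (x : α) (l : List α) (φ : α → W) : lsum (x :: l) φ = φ x + lsum l φ := by
  simp [lsum]

theorem lsum_append (l l' : List α) (φ : α → W) : lsum (l ++ l') φ = lsum l φ + lsum l' φ := by
  simp [lsum]

theorem lsum_map (l : List α) (g : α → β) (φ : β → W) :
    lsum (l.map g) φ = lsum l fun x => φ (g x) := by
  simp [lsum, Function.comp_def]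

theorem lsum_congr {l : List α} {φ ψ : α → W} (h : ∀ x ∈ l, φ x = ψ x) : lsum l φ = lsum l ψ := by
  unfold lsum
  rw [List.map_congr_left h]

theorem lsum_zero (l : List α) : lsum l (fun _ => (0 : W)) = 0 := by
  simp [lsum]

theorem lsum_eq_zero {l : List α} {φ : α → W} (h : ∀ x ∈ l, φ x = 0) : lsum l φ = 0 := by
  rw [lsum_congr h, lsum_zero]

theorem lsum_add (l : List α) (φ ψ : α → W) :
    (lsum l fun x => φ x + ψ x) = lsum l φ + lsum l ψ := by
  simp [lsum, List.sum_map_add]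

theorem lsum_comm (l : List α) (l' : List β) (φ : α → β → W) :
    (lsum l fun x => lsum l' fun y => φ x y) = lsum l' fun y => lsum l fun x => φ x y := by
  induction l with
  | nil => simp [lsum_nil, lsum_zero]
  | cons x l ih => simp only [lsum_cons, ih, lsum_add]

theorem map_lsum {V : Type*} [AddCommMonoid V] (f : W →+ V) (l : List α) (φ : α → W) :
    f (lsum l φ) = lsum l fun x => f (φ x) := by
  simp [lsum, map_list_sum, Function.comp_def]

theorem lsum_smul {W : Type*} [AddCommGroup W] (ε : ℤˣ) (l : List α) (φ : α → W) :
    (lsum l fun x => ε • φ x) = ε • lsum l φ :=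
  (map_lsum (DistribSMul.toAddMonoidHom W ε) l φ).symm

theorem lsum_sub {W : Type*} [AddCommGroup W] (l : List α) (φ ψ : α → W) :
    (lsum l fun x => φ x - ψ x) = lsum l φ - lsum l ψ := by
  rw [eq_sub_iff_add_eq, ← lsum_add]
  simp

theorem splits_map (g : α → β) (w : List α) :
    splits (w.map g) = (splits w).map fun p => (p.1.map g, p.2.map g) := by
  induction w with
  | nil => rfl
  | cons x w ih => simp [splits, ih]

theorem lsum_splits_map (g : α → β) (w : List α) (Φ : List β × List β → W) :
    lsum (splits (w.map g)) Φ = lsum (splits w) fun p => Φ (p.1.map g, p.2.map g) := by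
  rw [splits_map, lsum_map]

theorem mem_splits {w : List α} {p : List α × List α} : p ∈ splits w ↔ p.1 ++ p.2 = w := by
  induction w generalizing p with
  | nil => simp [splits, Prod.ext_iff]
  | cons x w ih =>
    obtain ⟨p, q⟩ := p
    simp only [splits, List.mem_cons, List.mem_map, Prod.exists, ih, Prod.mk.injEq]
    cases p with
    | nil => simp
    | cons y p => simp [eq_comm, and_comm]

theorem lsum_splits_nil (Φ : List α × List α → W) : lsum (splits []) Φ = Φ ([], []) := by
  simp [splits, lsum]

theorem lsum_splits_cons (x : α) (w : List α) (Φ : List α × List α → W) :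
    lsum (splits (x :: w)) Φ = Φ ([], x :: w) + lsum (splits w) fun p => Φ (x :: p.1, p.2) := by
  rw [splits, lsum_cons, lsum_map]

/-- The cut point lies either before or after the distinguished letter. -/
theorem lsum_splits_append_cons (w : List α) (i : α) (w' : List α) (Φ : List α × List α → W) :
    lsum (splits (w ++ i :: w')) Φ = (lsum (splits w) fun p => Φ (p.1, p.2 ++ i :: w'))
      + lsum (splits w') fun q => Φ (w ++ i :: q.1, q.2) := by
  induction w generalizing Φ with
  | nil => simp [lsum_splits_cons, lsum_splits_nil]
  | cons x w ih =>
    rw [List.cons_append, lsum_splits_cons, ih, lsum_splits_cons, ← add_assoc]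
    rfl

/-- Coassociativity of deconcatenation: both sides run over the splittings into three parts. -/
theorem lsum_splits_assoc (w : List α) (Φ : List α → List α → List α → W) :
    (lsum (splits w) fun p => lsum (splits p.1) fun q => Φ q.1 q.2 p.2) =
      lsum (splits w) fun p => lsum (splits p.2) fun q => Φ p.1 q.1 q.2 := by
  induction w generalizing Φ with
  | nil => simp [lsum_splits_nil]
  | cons x w ih =>
    simp only [lsum_splits_cons, lsum_splits_nil, lsum_add]
    rw [ih fun p q r => Φ (x :: p) q r]
    abel

/-- A cutting of a non-empty word is a first block followed by a cutting of the rest. This recursion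
replaces the two-branch definition of `cuts` when sums are manipulated. -/
theorem lsum_cuts_cons (x : α) (w : List α) (Φ : List (List α) → W) :
    lsum (cuts (x :: w)) Φ =
      lsum (splits w) fun p => lsum (cuts p.2) fun c => Φ ((x :: p.1) :: c) := by
  induction w generalizing x Φ with
  | nil => simp [cuts, splits, lsum]
  | cons y w ih =>
    rw [cuts, lsum_append, lsum_map, lsum_map, lsum_splits_cons, ih y (fun c => Φ (glue x c))]
    rfl

/-- Choosing a place between two blocks of a cutting is the same as splitting the word there and
cutting both halves. -/
theorem lsum_cuts_splits (w : List α) (Φ : List (List α) → List (List α) → W) :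
    (lsum (cuts w) fun c => lsum (splits c) fun p => Φ p.1 p.2) =
      lsum (splits w) fun p => lsum (cuts p.1) fun y => lsum (cuts p.2) fun z => Φ y z := by
  induction hn : w.length using Nat.strong_induction_on generalizing w Φ with
  | _ n ih =>
    subst hn
    cases w with
    | nil => simp [cuts, lsum_splits_nil, lsum_singleton]
    | cons x w =>
      simp only [lsum_cuts_cons, lsum_splits_cons, lsum_add]
      congr 1
      · simp [cuts, lsum_singleton]
      · rw [lsum_splits_assoc w fun p q r =>
          lsum (cuts q) fun y => lsum (cuts r) fun z => Φ ((x :: p) :: y) z]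
        refine lsum_congr fun p hp => ?_
        refine ih p.2.length ?_ p.2 (fun y z => Φ ((x :: p.1) :: y) z) rfl
        have := congrArg List.length (mem_splits.1 hp)
        simp at this ⊢
        omega

/-- Exactly one block of a cutting covers the occurrence of the distinguished letter; it is
determined by how far it reaches to the left and to the right. -/
theorem lsum_cuts_append_cons (w : List α) (i : α) (w' : List α) (Φ : List (List α) → W) :
    lsum (cuts (w ++ i :: w')) Φ = lsum (splits w) fun p => lsum (splits w') fun q =>
      lsum (cuts p.1) fun y => lsum (cuts q.2) fun z => Φ (y ++ (p.2 ++ i :: q.1) :: z) := by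
  induction hn : w.length using Nat.strong_induction_on generalizing w Φ with
  | _ n ih =>
    subst hn
    cases w with
    | nil => simp [cuts, lsum_splits_nil, lsum_singleton, lsum_cuts_cons]
    | cons x w =>
      rw [List.cons_append, lsum_cuts_cons, lsum_splits_append_cons, lsum_splits_cons, add_comm]
      congr 1
      · simp [cuts, lsum_singleton]
      · have h : ∀ p ∈ splits w, (lsum (cuts (p.2 ++ i :: w')) fun c => Φ ((x :: p.1) :: c)) =
            lsum (splits p.2) fun r => lsum (splits w') fun q =>
              lsum (cuts r.1) fun y => lsum (cuts q.2) fun z =>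
                Φ ((x :: p.1) :: (y ++ (r.2 ++ i :: q.1) :: z)) := by
          intro p hp
          refine ih p.2.length ?_ p.2 (fun c => Φ ((x :: p.1) :: c)) rfl
          have := congrArg List.length (mem_splits.1 hp)
          simp at this ⊢
          omega
        rw [lsum_congr h, ← lsum_splits_assoc w fun p r s => lsum (splits w') fun q =>
              lsum (cuts r) fun y => lsum (cuts q.2) fun z =>
                Φ ((x :: p) :: (y ++ (s ++ i :: q.1) :: z))]
        refine lsum_congr fun p _ => ?_
        rw [lsum_comm]
        refine lsum_congr fun q _ => ?_
        rw [lsum_cuts_cons]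
        rfl

/-- If the summand vanishes unless the middle block contains `i`, then the sum over all ways of
writing `w ++ i :: w'` as `x ++ b ++ z` runs over the blocks around `i`. -/
theorem lsum_splits_splits_of_mem (w : List α) (i : α) (w' : List α) (hw : i ∉ w) (hw' : i ∉ w')
    (Θ : List α → List α → List α → W)
    (hΘ : ∀ x b z, x ++ b ++ z = w ++ i :: w' → i ∉ b → Θ x b z = 0) :
    (lsum (splits (w ++ i :: w')) fun s => lsum (splits s.2) fun r => Θ s.1 r.1 r.2) =
      lsum (splits w) fun p => lsum (splits w') fun q => Θ p.1 (p.2 ++ i :: q.1) q.2 := by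
  rw [lsum_splits_append_cons]
  have h2 : (lsum (splits w') fun q => lsum (splits q.2) fun r => Θ (w ++ i :: q.1) r.1 r.2) = 0 := by
    refine lsum_eq_zero fun q hq => lsum_eq_zero fun r hr => ?_
    rw [mem_splits] at hq hr
    refine hΘ _ _ _ (by simp [hr, hq]) fun h => hw' ?_
    rw [← hq, ← hr]
    simp [h]
  rw [h2, add_zero]
  refine lsum_congr fun p hp => ?_
  rw [mem_splits] at hp
  rw [lsum_splits_append_cons]
  have h1 : (lsum (splits p.2) fun r => Θ p.1 r.1 (r.2 ++ i :: w')) = 0 := by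
    refine lsum_eq_zero fun r hr => ?_
    rw [mem_splits] at hr
    refine hΘ _ _ _ (by rw [← hp, ← hr]; simp) fun h => hw ?_
    rw [← hp, ← hr]
    simp [h]
  rw [h1, zero_add]

theorem flatten_of_mem_cuts {w : List α} {c : List (List α)} (hc : c ∈ cuts w) :
    c.flatten = w := by
  induction w using cuts.induct generalizing c with
  | case1 => simp_all [cuts]
  | case2 x => simp_all [cuts]
  | case3 x y w ih =>
    simp only [cuts, List.mem_append, List.mem_map] at hc
    rcases hc with ⟨d, hd, rfl⟩ | ⟨d, hd, rfl⟩
    · simp [ih hd]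
    · have := ih hd
      cases d with
      | nil => simp at this
      | cons b d => simpa [glue] using this

theorem ne_nil_of_mem_cuts {w : List α} {c : List (List α)} (hc : c ∈ cuts w) :
    ∀ b ∈ c, b ≠ [] := by
  induction w using cuts.induct generalizing c with
  | case1 => simp_all [cuts]
  | case2 x => simp_all [cuts]
  | case3 x y w ih =>
    simp only [cuts, List.mem_append, List.mem_map] at hc
    rcases hc with ⟨d, hd, rfl⟩ | ⟨d, hd, rfl⟩
    · intro b hb
      rcases List.mem_cons.1 hb with rfl | hb
      · simp
      · exact ih hd b hb
    · cases d with
      | nil => simp [glue]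
      | cons b d =>
        intro b' hb'
        rcases List.mem_cons.1 hb' with rfl | hb'
        · simp
        · exact ih hd b' (List.mem_cons_of_mem _ hb')

theorem infix_of_mem_cuts {w : List α} {c : List (List α)} (hc : c ∈ cuts w) {b : List α}
    (hb : b ∈ c) : b <:+: w := by
  rw [← flatten_of_mem_cuts hc]
  exact List.infix_of_mem_flatten hb

theorem cuts_map (g : α → β) (w : List α) : cuts (w.map g) = (cuts w).map (List.map (List.map g)) := by
  induction w using cuts.induct with
  | case1 => simp [cuts]
  | case2 x => simp [cuts]
  | case3 x y w ih =>
    simp only [List.map_cons, cuts, List.map_append, List.map_map] at ih ⊢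
    rw [ih]
    simp only [List.map_map]
    congr 1
    refine List.map_congr_left fun c _ => ?_
    cases c <;> simp [glue]

end Combinatorics

/-! ### Additivity of the evaluations -/

section Additivity

variable {R A B M N W : Type*} [CommRing R] [AddCommGroup A] [Module R A]
  [AddCommGroup B] [Module R B] [AddCommGroup M] [Module R M] [AddCommGroup N] [Module R N]
  [AddCommGroup W]

/-- A function of words which is additive in the element of each letter. -/
def LetterAdditive (Φ : List (ℤ × A) → W) : Prop :=
  ∀ p s q, ∃ φ : A →+ W, ∀ x, Φ (p ++ (s, x) :: q) = φ x

/-- A function of `(u, m, v)` which is additive in the elements of all letters. -/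
structure BiAdditive (Φ : List (ℤ × A) → ℤ × M → List (ℤ × A) → W) : Prop where
  left : ∀ m v, LetterAdditive fun u => Φ u m v
  mid : ∀ u s v, ∃ φ : M →+ W, ∀ x, Φ u (s, x) v = φ x
  right : ∀ u m, LetterAdditive fun v => Φ u m v

theorem LetterAdditive.zero {Φ : List (ℤ × A) → W} (h : LetterAdditive Φ)
    (p : List (ℤ × A)) (s : ℤ) (q : List (ℤ × A)) : Φ (p ++ (s, 0) :: q) = 0 := by
  obtain ⟨φ, hφ⟩ := h p s q
  rw [hφ, map_zero]

theorem BiAdditive.mid_zero {Φ : List (ℤ × A) → ℤ × M → List (ℤ × A) → W} (h : BiAdditive Φ)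
    (u : List (ℤ × A)) (s : ℤ) (v : List (ℤ × A)) : Φ u (s, 0) v = 0 := by
  obtain ⟨φ, hφ⟩ := h.mid u s v
  rw [hφ, map_zero]

/-- Reading entries through `getD` removes the dependence on the type `Fin w.length` of a particular
word, so that words with equal length can be compared. -/
theorem get_snd_eq (w : List (ℤ × A)) :
    (fun i => (w.get i).2) = fun i : Fin w.length => ((w.map Prod.snd)[(i : ℕ)]?).getD 0 := by
  funext i
  simp

theorem get_snd_update (p : List (ℤ × A)) (s : ℤ) (q : List (ℤ × A)) (x : A) (n : ℕ)
    (h : p.length < n) :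
    (fun i : Fin n => (((p ++ (s, x) :: q).map Prod.snd)[(i : ℕ)]?).getD 0) =
      Function.update (fun i : Fin n => (((p ++ (s, (0 : A)) :: q).map Prod.snd)[(i : ℕ)]?).getD 0)
        ⟨p.length, h⟩ x := by
  funext i
  by_cases hi : i = ⟨p.length, h⟩
  · subst hi
    simp
  · rw [Function.update_of_ne hi]
    have hi' : (i : ℕ) ≠ p.length := fun h' => hi (Fin.ext h')
    simp only [List.map_append, List.map_cons, List.getElem?_append, List.length_map]
    split_ifs with h1
    · rfl
    · obtain ⟨j, hj⟩ : ∃ j, (i : ℕ) - p.length = j + 1 := ⟨i - p.length - 1, by omega⟩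
      rw [hj, List.getElem?_cons_succ, List.getElem?_cons_succ]

/-- The sign depends only on the degrees, so with the degree of a letter fixed, multilinearity is
additivity in its element. -/
theorem letterAdditive_opEval (φ : ∀ k, MultilinearMap R (fun _ : Fin k => A) N) :
    LetterAdditive (opEval φ) := by
  intro p s q
  have h : ∀ (w : List (ℤ × A)) (n : ℕ), w.length = n → opEval φ w =
      (shiftExp (w.map Prod.fst)).negOnePow •
        φ n fun i : Fin n => ((w.map Prod.snd)[(i : ℕ)]?).getD 0 := by
    rintro w n rfl
    rw [opEval, get_snd_eq]
  let n := p.length + (q.length + 1)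
  refine ⟨(DistribSMul.toAddMonoidHom N
      (shiftExp ((p ++ (s, (0 : A)) :: q).map Prod.fst)).negOnePow).comp
      ((φ n).toLinearMap (fun i : Fin n => (((p ++ (s, (0 : A)) :: q).map Prod.snd)[(i : ℕ)]?).getD 0)
        ⟨p.length, by simp [n]⟩).toAddMonoidHom, fun x => ?_⟩
  rw [h _ n (by simp [n]), get_snd_update p s q x n (by simp [n])]
  simp

theorem biAdditive_biEval (φ : ∀ k l, BiMultilinear R A M N k l) : BiAdditive (biEval φ) where
  left m v := by
    intro p s q
    have h : ∀ (w : List (ℤ × A)) (n : ℕ), w.length = n → biEval φ w m v =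
        (shiftExp (w.map Prod.fst ++ m.1 :: v.map Prod.fst)).negOnePow •
          φ n v.length (fun i : Fin n => ((w.map Prod.snd)[(i : ℕ)]?).getD 0) m.2
            fun i => (v.get i).2 := by
      rintro w n rfl
      rw [biEval, get_snd_eq w]
    let n := p.length + (q.length + 1)
    let b := fun i : Fin n => (((p ++ (s, (0 : A)) :: q).map Prod.snd)[(i : ℕ)]?).getD 0
    let ε := (shiftExp ((p ++ (s, (0 : A)) :: q).map Prod.fst ++ m.1 :: v.map Prod.fst)).negOnePow
    refine ⟨⟨⟨fun x => ε • φ n v.length (Function.update b ⟨p.length, by simp [n]⟩ x) m.2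
      fun i => (v.get i).2, by simp⟩, fun x y => by simp [MultilinearMap.map_update_add]⟩,
      fun x => ?_⟩
    dsimp only
    rw [h _ n (by simp [n]), get_snd_update p s q x n (by simp [n])]
    simp [b, ε]
  mid u s v := by
    refine ⟨⟨⟨fun x => biEval φ u (s, x) v, by simp [biEval]⟩, fun x y => by simp [biEval]⟩,
      fun x => rfl⟩
  right u m := by
    intro p s q
    have h : ∀ (w : List (ℤ × A)) (n : ℕ), w.length = n → biEval φ u m w =
        (shiftExp (u.map Prod.fst ++ m.1 :: w.map Prod.fst)).negOnePow •
          φ u.length n (fun i => (u.get i).2) m.2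
            fun i : Fin n => ((w.map Prod.snd)[(i : ℕ)]?).getD 0 := by
      rintro w n rfl
      rw [biEval, get_snd_eq w]
    let n := p.length + (q.length + 1)
    let b := fun i : Fin n => (((p ++ (s, (0 : A)) :: q).map Prod.snd)[(i : ℕ)]?).getD 0
    let ε := (shiftExp (u.map Prod.fst ++ m.1 :: (p ++ (s, (0 : A)) :: q).map Prod.fst)).negOnePow
    refine ⟨⟨⟨fun x => ε • φ u.length n (fun i => (u.get i).2) m.2
      (Function.update b ⟨p.length, by simp [n]⟩ x), by simp⟩,
      fun x y => by simp [MultilinearMap.map_update_add]⟩, fun x => ?_⟩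
    dsimp only
    rw [h _ n (by simp [n]), get_snd_update p s q x n (by simp [n])]
    simp [b, ε]

theorem sdeg_append (u v : List (ℤ × A)) : sdeg (u ++ v) = sdeg u + sdeg v := by
  simp [sdeg]

theorem sdeg_cons (x : ℤ × A) (v : List (ℤ × A)) : sdeg (x :: v) = x.1 + sdeg v := by
  simp [sdeg]

theorem sdeg_append_letter (p : List (ℤ × A)) (s : ℤ) (x : A) (q : List (ℤ × A)) :
    sdeg (p ++ (s, x) :: q) = sdeg p + s + sdeg q := by
  rw [sdeg_append, sdeg_cons, add_assoc]

theorem biAdditive_ipEval {𝒜 : ℤ → Submodule R A} {ℳ : ℤ → Submodule R M} {e : ℤ}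
    (I : BiFamily 𝒜 ℳ (dualGrading ℳ) e) (n : ℤ × M) :
    BiAdditive fun u m v => ipEval I u m v n := by
  let ev (ε : ℤˣ) : Module.Dual R M →+ R :=
    ⟨⟨fun φ => ε • φ n.2, by simp⟩, fun φ ψ => by simp⟩
  constructor
  · intro m v p s q
    obtain ⟨φ, hφ⟩ := (biAdditive_biEval I.map).left m v p s q
    refine ⟨(ev (sdeg p + s + sdeg q + m.1 + sdeg v + e).negOnePow).comp φ, fun x => ?_⟩
    dsimp only at hφ
    simp only [ipEval, pair, biLetter, hφ, sdeg_append_letter]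
    rfl
  · intro u s v
    obtain ⟨φ, hφ⟩ := (biAdditive_biEval I.map).mid u s v
    refine ⟨(ev (sdeg u + s + sdeg v + e).negOnePow).comp φ, fun x => ?_⟩
    simp only [ipEval, pair, biLetter, hφ]
    rfl
  · intro u m p s q
    obtain ⟨φ, hφ⟩ := (biAdditive_biEval I.map).right u m p s q
    refine ⟨(ev (sdeg u + m.1 + (sdeg p + s + sdeg q) + e).negOnePow).comp φ, fun x => ?_⟩
    dsimp only at hφ
    simp only [ipEval, pair, biLetter, hφ, sdeg_append_letter]
    rfl

theorem ipEval_snd_additive {𝒜 : ℤ → Submodule R A} {ℳ : ℤ → Submodule R M} {e : ℤ}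
    (I : BiFamily 𝒜 ℳ (dualGrading ℳ) e) (u : List (ℤ × A)) (m : ℤ × M) (v : List (ℤ × A))
    (s : ℤ) : ∃ φ : M →+ R, ∀ x, ipEval I u m v (s, x) = φ x :=
  ⟨⟨⟨fun x => ipEval I u m v (s, x), by simp [ipEval, pair]⟩,
    fun x y => by simp [ipEval, pair]⟩, fun _ => rfl⟩

end Additivity

/-! ### Words of blocks of positions -/

section Blocks

variable {R α A B M N W V : Type*} [CommRing R] [AddCommGroup A] [Module R A]
  [AddCommGroup B] [Module R B] [AddCommGroup M] [Module R M] [AddCommGroup N] [Module R N]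
  [AddCommGroup W] [AddCommGroup V]

/-- The total weight of a word of positions. -/
def wt (D : α → ℤ) (w : List α) : ℤ := (w.map D).sum

@[simp] theorem wt_nil (D : α → ℤ) : wt D [] = 0 := rfl

@[simp] theorem wt_cons (D : α → ℤ) (x : α) (w : List α) : wt D (x :: w) = D x + wt D w := by
  simp [wt]

@[simp] theorem wt_append (D : α → ℤ) (v w : List α) : wt D (v ++ w) = wt D v + wt D w := by
  simp [wt]

theorem wt_congr {D D' : α → ℤ} {w : List α} (h : ∀ x ∈ w, D x = D' x) : wt D w = wt D' w := by
  rw [wt, List.map_congr_left h, wt]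

theorem wt_splits {D : α → ℤ} {w : List α} {p : List α × List α} (hp : p ∈ splits w) :
    wt D p.1 + wt D p.2 = wt D w := by
  rw [← mem_splits.1 hp, wt_append]

/-- The letter of a block of positions, of degree the weight of the block. -/
def letter (D : α → ℤ) (a : List α → A) (b : List α) : ℤ × A := (wt D b, a b)

/-- The letter of a block `p ++ c :: q` of positions around a fixed position `c`. -/
def midLetter (D : α → ℤ) (c : α) (m : List α → List α → M) (p q : List α) : ℤ × M :=
  (wt D p + D c + wt D q, m p q)

/-- The sum of `Φ` over all ways of cutting `w` into blocks, with `L` applied to each block. -/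
def csum (L : List α → ℤ × A) (Φ : List (ℤ × A) → W) (w : List α) : W :=
  lsum (cuts w) fun c => Φ (c.map L)

theorem csum_nil (L : List α → ℤ × A) (Φ : List (ℤ × A) → W) : csum L Φ [] = Φ [] := by
  simp [csum, cuts, lsum_singleton]

theorem csum_congr {L L' : List α → ℤ × A} {w : List α} (Φ : List (ℤ × A) → W)
    (h : ∀ b, b <:+: w → b ≠ [] → L b = L' b) : csum L Φ w = csum L' Φ w := by
  refine lsum_congr fun c hc => ?_
  rw [List.map_congr_left fun b hb => h b (infix_of_mem_cuts hc hb) (ne_nil_of_mem_cuts hc b hb)]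

theorem sdeg_map_letter (D : α → ℤ) (a : List α → A) {w : List α} {c : List (List α)}
    (hc : c ∈ cuts w) : sdeg (c.map (letter D a)) = wt D w := by
  rw [← flatten_of_mem_cuts hc]
  simp only [sdeg, wt, letter, List.map_map, List.map_flatten, List.sum_flatten,
    Function.comp_def]

theorem csum_congr_right {D : α → ℤ} {a : List α → A} {w : List α} {Φ Φ' : List (ℤ × A) → W}
    (h : ∀ y, sdeg y = wt D w → Φ y = Φ' y) : csum (letter D a) Φ w = csum (letter D a) Φ' w :=
  lsum_congr fun _ hc => h _ (sdeg_map_letter D a hc)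

theorem csum_add (L : List α → ℤ × A) (Φ Φ' : List (ℤ × A) → W) (w : List α) :
    csum L (fun y => Φ y + Φ' y) w = csum L Φ w + csum L Φ' w :=
  lsum_add _ _ _

theorem csum_sub (L : List α → ℤ × A) (Φ Φ' : List (ℤ × A) → W) (w : List α) :
    csum L (fun y => Φ y - Φ' y) w = csum L Φ w - csum L Φ' w :=
  lsum_sub _ _ _

theorem csum_zero (L : List α → ℤ × A) (w : List α) :
    csum L (fun _ => (0 : W)) w = 0 :=
  lsum_zero _

theorem csum_smul (L : List α → ℤ × A) (ε : ℤˣ) (Φ : List (ℤ × A) → W) (w : List α) :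
    csum L (fun y => ε • Φ y) w = ε • csum L Φ w :=
  lsum_smul _ _ _

theorem csum_lsum (L : List α → ℤ × A) {β : Type*} (l : List β) (Φ : List (ℤ × A) → β → W)
    (w : List α) :
    csum L (fun y => lsum l fun x => Φ y x) w = lsum l fun x => csum L (fun y => Φ y x) w :=
  lsum_comm _ _ _

theorem csum_comm (L : List α → ℤ × A) (L' : List α → ℤ × B)
    (Φ : List (ℤ × A) → List (ℤ × B) → W)
    (w w' : List α) :
    csum L (fun y => csum L' (fun z => Φ y z) w') w =
      csum L' (fun z => csum L (fun y => Φ y z) w) w' :=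
  lsum_comm _ _ _

theorem map_csum (f : W →+ V) (L : List α → ℤ × A) (Φ : List (ℤ × A) → W) (w : List α) :
    f (csum L Φ w) = csum L (fun y => f (Φ y)) w :=
  map_lsum _ _ _

theorem csum_splits (L : List α → ℤ × A) (Φ : List (ℤ × A) → List (ℤ × A) → W) (w : List α) :
    csum L (fun c => lsum (splits c) fun p => Φ p.1 p.2) w =
      lsum (splits w) fun p => csum L (fun y => csum L (fun z => Φ y z) p.2) p.1 := by
  simp only [csum, lsum_splits_map]
  exact lsum_cuts_splits w fun y z => Φ (y.map L) (z.map L)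

/-- All cuttings of a block have the same total degree, hence additivity collects the sum over its
cuttings into a single letter. -/
theorem csum_letter {Φ : List (ℤ × A) → W} (hΦ : LetterAdditive Φ) {D : α → ℤ}
    {b' : List α → B} (y z : List (ℤ × A)) (e : ℤ) (g : List (ℤ × B) → A) (b : List α) :
    csum (letter D b') (fun q => Φ (y ++ (sdeg q + e, g q) :: z)) b =
      Φ (y ++ (wt D b + e, csum (letter D b') g b) :: z) := by
  obtain ⟨φ, hφ⟩ := hΦ y (wt D b + e) z
  rw [hφ, map_csum]
  refine csum_congr_right fun q hq => ?_
  rw [hq, hφ]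

/-- The sum of `Φ` over all ways of cutting `w` into blocks one of which is marked; the letter of
the marked block is the sum of `μ` over the ways of cutting it. -/
def mark (D : α → ℤ) (a : List α → A) (μ : ∀ k, MultilinearMap R (fun _ : Fin k => A) A)
    (Φ : List (ℤ × A) → W) (w : List α) : W :=
  lsum (splits w) fun s => lsum (splits s.2) fun r =>
    (wt D s.1).negOnePow • csum (letter D a) (fun y => csum (letter D a) (fun z =>
      Φ (y ++ (wt D r.1 + 1, csum (letter D a) (opEval μ) r.1) :: z)) r.2) s.1

/-- Choosing a run of letters of a cutting means splitting the word into three parts and cutting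
each of them. The cuttings of the middle part are then collected into one letter by `csum_letter`.
-/
theorem csum_precomp (D : α → ℤ) (a : List α → A)
    (μ : ∀ k, MultilinearMap R (fun _ : Fin k => A) A)
    {Φ : List (ℤ × A) → W} (hΦ : LetterAdditive Φ) (w : List α) :
    csum (letter D a) (fun w => lsum (splits w) fun p => lsum (splits p.2) fun q =>
      (sdeg p.1).negOnePow • Φ (p.1 ++ opLetter 1 μ q.1 :: q.2)) w = mark D a μ Φ w := by
  rw [csum_splits (letter D a) (fun y w => lsum (splits w) fun q =>
      (sdeg y).negOnePow • Φ (y ++ opLetter 1 μ q.1 :: q.2)), mark]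
  refine lsum_congr fun s _ => ?_
  have h : ∀ y, csum (letter D a) (fun w => lsum (splits w) fun q =>
      (sdeg y).negOnePow • Φ (y ++ opLetter 1 μ q.1 :: q.2)) s.2 = _ := fun y =>
    csum_splits (letter D a) (fun b z => (sdeg y).negOnePow • Φ (y ++ opLetter 1 μ b :: z)) s.2
  simp only [h]
  rw [csum_lsum]
  refine lsum_congr fun r _ => ?_
  rw [← csum_smul]
  refine csum_congr_right fun y hy => ?_
  rw [csum_comm, ← csum_smul]
  refine congrArg (fun F => csum (letter D a) F r.2) (funext fun z => ?_)
  rw [csum_smul, hy]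
  exact congrArg _ (csum_letter hΦ y z 1 (opEval μ) r.1)

/-- The marked letter is a Maurer-Cartan sum, hence zero. Empty marked blocks occur too, so the
hypothesis has to include the empty block, where it says that μ_0 vanishes. -/
theorem mark_eq_zero {D : α → ℤ} {a : List α → A}
    {μ : ∀ k, MultilinearMap R (fun _ : Fin k => A) A} {Φ : List (ℤ × A) → W}
    (hΦ : LetterAdditive Φ) {w : List α}
    (h : ∀ b, b <:+: w → csum (letter D a) (opEval μ) b = 0) : mark D a μ Φ w = 0 := by
  refine lsum_eq_zero fun s hs => lsum_eq_zero fun r hr => ?_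
  rw [mem_splits] at hs hr
  rw [h r.1 ⟨s.1, r.2, by rw [List.append_assoc, hr, hs]⟩]
  simp only [hΦ.zero, csum_zero, smul_zero]

/-- Applying a family to each block of a cutting after cutting the blocks. -/
theorem csum_push (D : α → ℤ) (a : List α → A)
    (f : ∀ k, MultilinearMap R (fun _ : Fin k => A) B)
    {Φ : List (ℤ × B) → W} (hΦ : LetterAdditive Φ) (w : List α) :
    csum (letter D fun b => csum (letter D a) (opEval f) b) Φ w =
      csum (letter D a) (fun y => lsum (cuts y) fun c => Φ (c.map (opLetter 0 f))) w := by
  -- The prefix p holds the letters already processed; without it the induction on the length of the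
  -- word does not close.
  suffices H : ∀ p, csum (letter D fun b => csum (letter D a) (opEval f) b) (fun c => Φ (p ++ c)) w
      = csum (letter D a) (fun y => lsum (cuts y) fun c => Φ (p ++ c.map (opLetter 0 f))) w by
    simpa using H []
  induction hn : w.length using Nat.strong_induction_on generalizing w with
  | _ n ih =>
    intro p
    subst hn
    cases w with
    | nil => simp [csum_nil, cuts, lsum_singleton]
    | cons x w =>
      simp only [csum, lsum_cuts_cons, List.map_cons, lsum_splits_map]
      have h : ∀ r ∈ splits w,
          (lsum (cuts r.2) fun c => Φ (p ++ letter D (fun b => lsum (cuts b) fun c =>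
            opEval f (c.map (letter D a))) (x :: r.1) ::
              c.map (letter D fun b => lsum (cuts b) fun c => opEval f (c.map (letter D a)))))
          = lsum (cuts (x :: r.1)) fun y => lsum (cuts r.2) fun z => lsum (cuts z) fun c =>
            Φ (p ++ opLetter 0 f (y.map (letter D a)) ::
              (c.map fun c => opLetter 0 f (c.map (letter D a)))) := by
        intro r hr
        rw [lsum_comm]
        have hlen : r.2.length < (x :: w).length := by
          have := congrArg List.length (mem_splits.1 hr)
          simp at this ⊢
          omega
        have h1 : ∀ c : List (ℤ × B), Φ (p ++ letter D (fun b => lsum (cuts b) fun c =>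
            opEval f (c.map (letter D a))) (x :: r.1) :: c) =
            lsum (cuts (x :: r.1)) fun y => Φ (p ++ opLetter 0 f (y.map (letter D a)) :: c) := by
          intro c
          have := csum_letter hΦ (D := D) (b' := a) p c 0 (opEval f) (x :: r.1)
          rw [add_zero] at this
          exact this.symm
        simp only [h1]
        rw [lsum_comm, lsum_comm (cuts r.2)]
        refine lsum_congr fun y _ => ?_
        have := ih r.2.length hlen r.2 rfl (p ++ [opLetter 0 f (y.map (letter D a))])
        simp only [csum, List.append_assoc, List.singleton_append, cuts_map, lsum_map,
          List.map_map] at this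
        exact this
      rw [lsum_congr h]
      have h2 : ∀ r : List α × List α, (lsum (cuts (x :: r.1)) fun y => lsum (cuts r.2) fun z =>
          lsum (cuts z) fun c => Φ (p ++ opLetter 0 f (y.map (letter D a)) ::
              (c.map fun c => opLetter 0 f (c.map (letter D a))))) =
          lsum (splits r.1) fun s => lsum (cuts s.2) fun y => lsum (cuts r.2) fun z =>
          lsum (cuts z) fun c => Φ (p ++ opLetter 0 f (((x :: s.1) :: y).map (letter D a)) ::
              (c.map fun c => opLetter 0 f (c.map (letter D a)))) := by
        intro r
        rw [lsum_cuts_cons]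
      simp only [h2]
      rw [lsum_splits_assoc w fun s y z => lsum (cuts y) fun y => lsum (cuts z) fun z =>
          lsum (cuts z) fun c => Φ (p ++ opLetter 0 f (((x :: s) :: y).map (letter D a)) ::
              (c.map fun c => opLetter 0 f (c.map (letter D a))))]
      refine lsum_congr fun s _ => ?_
      rw [← lsum_cuts_splits s.2 fun y z => lsum (cuts z) fun c =>
        Φ (p ++ opLetter 0 f (((x :: s.1) :: y).map (letter D a)) ::
              (c.map fun c => opLetter 0 f (c.map (letter D a))))]
      refine lsum_congr fun y _ => ?_
      simp only [cuts_map, lsum_map, List.map_cons, List.map_map, Function.comp_def]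

/-! ### Words of blocks with a module entry -/

/-- The sum of `Φ` over all ways of cutting `u ++ c :: v` into blocks, where `Lm` is applied to the
two parts of the block around `c`. -/
def bsum (L : List α → ℤ × A) (Lm : List α → List α → ℤ × M)
    (Φ : List (ℤ × A) → ℤ × M → List (ℤ × A) → W) (u v : List α) : W :=
  lsum (splits u) fun p => lsum (splits v) fun q =>
    csum L (fun y => csum L (fun z => Φ y (Lm p.2 q.1) z) q.2) p.1

theorem bsum_add (L : List α → ℤ × A) (Lm : List α → List α → ℤ × M)
    (Φ Φ' : List (ℤ × A) → ℤ × M → List (ℤ × A) → W) (u v : List α) :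
    bsum L Lm (fun y m z => Φ y m z + Φ' y m z) u v = bsum L Lm Φ u v + bsum L Lm Φ' u v := by
  simp only [bsum, csum_add, lsum_add]

theorem bsum_sub (L : List α → ℤ × A) (Lm : List α → List α → ℤ × M)
    (Φ Φ' : List (ℤ × A) → ℤ × M → List (ℤ × A) → W) (u v : List α) :
    bsum L Lm (fun y m z => Φ y m z - Φ' y m z) u v = bsum L Lm Φ u v - bsum L Lm Φ' u v := by
  simp only [bsum, csum_sub, lsum_sub]

theorem bsum_smul (L : List α → ℤ × A) (Lm : List α → List α → ℤ × M) (ε : ℤˣ)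
    (Φ : List (ℤ × A) → ℤ × M → List (ℤ × A) → W) (u v : List α) :
    bsum L Lm (fun y m z => ε • Φ y m z) u v = ε • bsum L Lm Φ u v := by
  simp only [bsum, csum_smul, lsum_smul]

theorem bsum_zero (L : List α → ℤ × A) (Lm : List α → List α → ℤ × M) (u v : List α) :
    bsum L Lm (fun _ _ _ => (0 : W)) u v = 0 := by
  simp only [bsum, csum_zero, lsum_zero]

theorem bsum_lsum (L : List α → ℤ × A) (Lm : List α → List α → ℤ × M) {β : Type*} (l : List β)
    (Φ : β → List (ℤ × A) → ℤ × M → List (ℤ × A) → W) (u v : List α) :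
    bsum L Lm (fun y m z => lsum l fun x => Φ x y m z) u v =
      lsum l fun x => bsum L Lm (Φ x) u v := by
  simp only [bsum, csum_lsum]
  exact (lsum_congr fun p _ => lsum_comm _ _ _).trans (lsum_comm _ _ _)

theorem bsum_csum (L L' : List α → ℤ × A) (Lm : List α → List α → ℤ × M) (w : List α)
    (Φ : List (ℤ × A) → List (ℤ × A) → ℤ × M → List (ℤ × A) → W) (u v : List α) :
    bsum L Lm (fun y m z => csum L' (fun x => Φ x y m z) w) u v =
      csum L' (fun x => bsum L Lm (Φ x) u v) w :=
  bsum_lsum L Lm (cuts w) (fun c => Φ (c.map L')) u v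

theorem map_bsum (f : W →+ V) (L : List α → ℤ × A) (Lm : List α → List α → ℤ × M)
    (Φ : List (ℤ × A) → ℤ × M → List (ℤ × A) → W) (u v : List α) :
    f (bsum L Lm Φ u v) = bsum L Lm (fun y m z => f (Φ y m z)) u v := by
  simp only [bsum, map_lsum, map_csum]

theorem bsum_congr {L L' : List α → ℤ × A} {Lm Lm' : List α → List α → ℤ × M} {u v : List α}
    (Φ : List (ℤ × A) → ℤ × M → List (ℤ × A) → W)
    (hu : ∀ b, b <:+: u → b ≠ [] → L b = L' b) (hv : ∀ b, b <:+: v → b ≠ [] → L b = L' b)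
    (hm : ∀ p q, p <:+ u → q <+: v → Lm p q = Lm' p q) :
    bsum L Lm Φ u v = bsum L' Lm' Φ u v := by
  refine lsum_congr fun p hp => lsum_congr fun q hq => ?_
  rw [mem_splits] at hp hq
  rw [hm p.2 q.1 ⟨_, hp⟩ ⟨_, hq⟩]
  rw [csum_congr _ fun b hb => hu b (hb.trans ⟨[], p.2, by simpa using hp⟩)]
  refine congrArg (fun F => csum L' F p.1) (funext fun y => ?_)
  exact csum_congr _ fun b hb => hv b (hb.trans ⟨q.1, [], by simpa using hq⟩)

theorem bsum_congr_right {D : α → ℤ} {c : α} {a : List α → A} {m : List α → List α → M}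
    {Φ Φ' : List (ℤ × A) → ℤ × M → List (ℤ × A) → W} {u v : List α}
    (h : ∀ y x z, sdeg y + x.1 + sdeg z = wt D u + D c + wt D v → Φ y x z = Φ' y x z) :
    bsum (letter D a) (midLetter D c m) Φ u v = bsum (letter D a) (midLetter D c m) Φ' u v := by
  refine lsum_congr fun p hp => lsum_congr fun q hq => ?_
  refine csum_congr_right fun y hy => csum_congr_right fun z hz => h _ _ _ ?_
  rw [hy, hz, midLetter, ← wt_splits hp, ← wt_splits hq]
  ring

/-- The counterpart of `csum_letter` for the module letter: the degree is the same for all cuttings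
around the position c. -/
theorem bsum_midLetter {Φ : List (ℤ × B) → ℤ × N → List (ℤ × B) → W} (hΦ : BiAdditive Φ)
    {D : α → ℤ} {c : α} {a : List α → A} {m : List α → List α → M} (y z : List (ℤ × B)) (e : ℤ)
    (g : List (ℤ × A) → ℤ × M → List (ℤ × A) → N) (u v : List α) :
    bsum (letter D a) (midLetter D c m) (fun u x v =>
        Φ y (sdeg u + x.1 + sdeg v + e, g u x v) z) u v =
      Φ y (wt D u + D c + wt D v + e, bsum (letter D a) (midLetter D c m) g u v) z := by
  obtain ⟨φ, hφ⟩ := hΦ.mid y (wt D u + D c + wt D v + e) z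
  rw [hφ, map_bsum]
  refine bsum_congr_right fun y' x z' h => ?_
  rw [h, hφ]

/-- Regrouping the outer blocks on both sides of the module entry. -/
theorem bsum_regroup (L : List α → ℤ × A) (Lm : List α → List α → ℤ × M)
    (Ψ : List (ℤ × A) → List (ℤ × A) → ℤ × M → List (ℤ × A) → List (ℤ × A) → W) (u v : List α) :
    bsum L Lm (fun y x z => lsum (splits y) fun s => lsum (splits z) fun t =>
        Ψ s.1 s.2 x t.1 t.2) u v =
      lsum (splits u) fun p => lsum (splits v) fun q => csum L (fun Y => csum L (fun Z =>
        bsum L Lm (fun y x z => Ψ Y y x z Z) p.2 q.1) q.2) p.1 := by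
  have h1 : ∀ p : List α × List α, ∀ q : List α × List α,
      (csum L (fun y => csum L (fun z => lsum (splits y) fun s => lsum (splits z) fun t =>
        Ψ s.1 s.2 (Lm p.2 q.1) t.1 t.2) q.2) p.1) =
      lsum (splits p.1) fun s => lsum (splits q.2) fun t => csum L (fun Y => csum L (fun Z =>
        csum L (fun y => csum L (fun z => Ψ Y y (Lm p.2 q.1) z Z) t.1) s.2) t.2) s.1 := by
    intro p q
    simp only [csum_lsum]
    rw [csum_splits L (fun Y y => csum L (fun z => lsum (splits z) fun t =>
      Ψ Y y (Lm p.2 q.1) t.1 t.2) q.2)]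
    refine lsum_congr fun s _ => ?_
    have h : ∀ Y y, csum L (fun z => lsum (splits z) fun t =>
        Ψ Y y (Lm p.2 q.1) t.1 t.2) q.2 = _ :=
      fun Y y => csum_splits L (fun z Z => Ψ Y y (Lm p.2 q.1) z Z) q.2
    simp only [h, csum_lsum]
    refine lsum_congr fun t _ => ?_
    refine congrArg (fun F => csum L F s.1) (funext fun Y => ?_)
    rw [csum_comm L L _ t.2 s.2]
    refine congrArg (fun F => csum L F s.2) (funext fun y => ?_)
    rw [csum_comm]
  rw [bsum]
  simp only [h1]
  -- Coassociativity on v: the part adjacent to the module entry is chosen last instead of first.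
  have h2 : ∀ p : List α × List α, (lsum (splits v) fun q => lsum (splits p.1) fun s =>
      lsum (splits q.2) fun t => csum L (fun Y => csum L (fun Z =>
        csum L (fun y => csum L (fun z => Ψ Y y (Lm p.2 q.1) z Z) t.1) s.2) t.2) s.1) =
      lsum (splits p.1) fun s => lsum (splits v) fun q => lsum (splits q.1) fun t =>
        csum L (fun Y => csum L (fun Z => csum L (fun y => csum L (fun z =>
          Ψ Y y (Lm p.2 t.1) z Z) t.2) s.2) q.2) s.1 := by
    intro p
    rw [lsum_comm]
    refine lsum_congr fun s _ => ?_
    rw [← lsum_splits_assoc v fun q1 t1 t2 => csum L (fun Y => csum L (fun Z =>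
        csum L (fun y => csum L (fun z => Ψ Y y (Lm p.2 q1) z Z) t1) s.2) t2) s.1]
  simp only [h2]
  rw [lsum_splits_assoc u fun s1 s2 p2 => lsum (splits v) fun q => lsum (splits q.1) fun t =>
        csum L (fun Y => csum L (fun Z => csum L (fun y => csum L (fun z =>
          Ψ Y y (Lm p2 t.1) z Z) t.2) s2) q.2) s1]
  refine lsum_congr fun p _ => ?_
  rw [lsum_comm]
  refine lsum_congr fun q _ => ?_
  simp only [bsum, csum_lsum]

/-- The sum of `Φ` over all ways of cutting `u ++ c :: v` into blocks one of which is marked; the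
letter of the marked block is the sum of `μ` resp. `β` over the ways of cutting it. -/
def bmark (D : α → ℤ) (c : α) (a : List α → A) (m : List α → List α → M)
    (μ : ∀ k, MultilinearMap R (fun _ : Fin k => A) A) (β : ∀ k l, BiMultilinear R A M M k l)
    (Φ : List (ℤ × A) → ℤ × M → List (ℤ × A) → W) (u v : List α) : W :=
  lsum (splits u) fun p => lsum (splits v) fun q =>
    csum (letter D a) (fun z => mark D a μ (fun y => Φ y (midLetter D c m p.2 q.1) z) p.1) q.2
    + (wt D p.1).negOnePow • csum (letter D a) (fun y => csum (letter D a) (fun z =>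
        Φ y (wt D p.2 + D c + wt D q.1 + 1,
          bsum (letter D a) (midLetter D c m) (biEval β) p.2 q.1) z) q.2) p.1
    + (wt D u + D c + wt D q.1).negOnePow • csum (letter D a) (fun y =>
        mark D a μ (fun z => Φ y (midLetter D c m p.2 q.1) z) q.2) p.1

/-- The three sums correspond to the marked block lying to the left of the module block, containing
it, or lying to its right. The outer two reduce to `csum_precomp`; the middle one regroups the
blocks around the module entry. -/
theorem bsum_precomp (D : α → ℤ) (c : α) (a : List α → A) (m : List α → List α → M)
    (μ : ∀ k, MultilinearMap R (fun _ : Fin k => A) A) (β : ∀ k l, BiMultilinear R A M M k l)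
    {Φ : List (ℤ × A) → ℤ × M → List (ℤ × A) → W} (hΦ : BiAdditive Φ) (u v : List α) :
    bsum (letter D a) (midLetter D c m) (fun u m v =>
        (lsum (splits u) fun p => lsum (splits p.2) fun q =>
          (sdeg p.1).negOnePow • Φ (p.1 ++ opLetter 1 μ q.1 :: q.2) m v)
        + (lsum (splits u) fun p => lsum (splits v) fun q =>
          (sdeg p.1).negOnePow • Φ p.1 (biLetter 1 β p.2 m q.1) q.2)
        + (lsum (splits v) fun p => lsum (splits p.2) fun q =>
          (sdeg u + m.1 + sdeg p.1).negOnePow • Φ u m (p.1 ++ opLetter 1 μ q.1 :: q.2))) u v =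
      bmark D c a m μ β Φ u v := by
  rw [bmark, bsum_add, bsum_add]
  simp only [lsum_add]
  congr 1
  · congr 1
    · refine lsum_congr fun p _ => lsum_congr fun q _ => ?_
      rw [csum_comm]
      refine congrArg (fun F => csum (letter D a) F q.2) (funext fun z => ?_)
      exact csum_precomp D a μ (hΦ.left _ _) p.1
    · rw [bsum_regroup (letter D a) (midLetter D c m)
        fun Y y x z Z => (sdeg Y).negOnePow • Φ Y (biLetter 1 β y x z) Z]
      refine lsum_congr fun p _ => lsum_congr fun q _ => ?_
      rw [← csum_smul]
      refine csum_congr_right fun Y hY => ?_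
      rw [← csum_smul]
      refine congrArg (fun F => csum (letter D a) F q.2) (funext fun Z => ?_)
      rw [bsum_smul, hY]
      exact congrArg _ (bsum_midLetter hΦ Y Z 1 (biEval β) p.2 q.1)
  · refine lsum_congr fun p hp => lsum_congr fun q _ => ?_
    rw [← csum_smul]
    refine csum_congr_right fun y hy => ?_
    rw [← csum_precomp D a μ (hΦ.right _ _) q.2, ← csum_smul]
    refine congrArg (fun F => csum (letter D a) F q.2) (funext fun z => ?_)
    rw [← lsum_smul]
    refine lsum_congr fun s _ => ?_
    rw [← lsum_smul]
    refine lsum_congr fun t _ => ?_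
    rw [smul_smul, ← Int.negOnePow_add, hy, midLetter, ← wt_splits hp]
    congr 2
    ring

/-- In all three positions the marked letter is a Maurer-Cartan sum of the system, so additivity
kills the term. -/
theorem bmark_eq_zero {D : α → ℤ} {c : α} {a : List α → A} {m : List α → List α → M}
    {μ : ∀ k, MultilinearMap R (fun _ : Fin k => A) A} {β : ∀ k l, BiMultilinear R A M M k l}
    {Φ : List (ℤ × A) → ℤ × M → List (ℤ × A) → W} (hΦ : BiAdditive Φ) {u v : List α}
    (hu : ∀ b, b <:+: u → csum (letter D a) (opEval μ) b = 0)
    (hv : ∀ b, b <:+: v → csum (letter D a) (opEval μ) b = 0)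
    (hm : ∀ p q, p <:+ u → q <+: v →
      bsum (letter D a) (midLetter D c m) (biEval β) p q = 0) : bmark D c a m μ β Φ u v = 0 := by
  refine lsum_eq_zero fun p hp => lsum_eq_zero fun q hq => ?_
  rw [mem_splits] at hp hq
  rw [hm p.2 q.1 ⟨_, hp⟩ ⟨_, hq⟩]
  have h1 : ∀ z, mark D a μ (fun y => Φ y (midLetter D c m p.2 q.1) z) p.1 = 0 := fun z =>
    mark_eq_zero (hΦ.left _ _) fun b hb => hu b (hb.trans ⟨[], p.2, by simpa using hp⟩)
  have h2 : ∀ y, mark D a μ (fun z => Φ y (midLetter D c m p.2 q.1) z) q.2 = 0 := fun y =>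
    mark_eq_zero (hΦ.right _ _) fun b hb => hv b (hb.trans ⟨q.1, [], by simpa using hq⟩)
  simp only [h1, h2, hΦ.mid_zero, csum_zero, smul_zero, add_zero]

/-- Applying families to each block of a cutting after cutting the blocks. -/
theorem bsum_push (D : α → ℤ) (c : α) (a : List α → A) (m : List α → List α → M)
    (f : ∀ k, MultilinearMap R (fun _ : Fin k => A) B) (e : ℤ)
    (F : ∀ k l, BiMultilinear R A M N k l)
    {Φ : List (ℤ × B) → ℤ × N → List (ℤ × B) → W} (hΦ : BiAdditive Φ) (u v : List α) :
    bsum (letter D fun b => csum (letter D a) (opEval f) b)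
        (fun p q => (wt D p + D c + wt D q + e,
          (e * wt D p).negOnePow • bsum (letter D a) (midLetter D c m) (biEval F) p q)) Φ u v =
      (e * wt D u).negOnePow • bsum (letter D a) (midLetter D c m) (fun y x z =>
        lsum (splits y) fun p => lsum (splits z) fun q =>
          lsum (cuts p.1) fun c' => lsum (cuts q.2) fun d => (e * sdeg p.1).negOnePow •
            Φ (c'.map (opLetter 0 f)) (biLetter e F p.2 x q.1) (d.map (opLetter 0 f))) u v := by
  rw [bsum_regroup (letter D a) (midLetter D c m) fun Y y x z Z =>
    lsum (cuts Y) fun c' => lsum (cuts Z) fun d => (e * sdeg Y).negOnePow •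
      Φ (c'.map (opLetter 0 f)) (biLetter e F y x z) (d.map (opLetter 0 f)), bsum, ← lsum_smul]
  refine lsum_congr fun p hp => ?_
  rw [← lsum_smul]
  refine lsum_congr fun q _ => ?_
  have h1 : ∀ y, csum (letter D fun b => csum (letter D a) (opEval f) b) (fun z =>
      Φ y (wt D p.2 + D c + wt D q.1 + e, (e * wt D p.2).negOnePow •
        bsum (letter D a) (midLetter D c m) (biEval F) p.2 q.1) z) q.2 = _ := fun y =>
    csum_push D a f (hΦ.right _ _) q.2
  simp only [h1]
  rw [csum_comm (letter D fun b => csum (letter D a) (opEval f) b) (letter D a)]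
  have h2 : ∀ z, csum (letter D fun b => csum (letter D a) (opEval f) b) (fun y =>
      lsum (cuts z) fun d => Φ y (wt D p.2 + D c + wt D q.1 + e, (e * wt D p.2).negOnePow •
        bsum (letter D a) (midLetter D c m) (biEval F) p.2 q.1) (d.map (opLetter 0 f))) p.1 =
      lsum (cuts z) fun d => csum (letter D a) (fun y => lsum (cuts y) fun c' =>
        Φ (c'.map (opLetter 0 f)) (wt D p.2 + D c + wt D q.1 + e, (e * wt D p.2).negOnePow •
        bsum (letter D a) (midLetter D c m) (biEval F) p.2 q.1) (d.map (opLetter 0 f))) p.1 := by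
    intro z
    rw [csum_lsum]
    exact lsum_congr fun d _ => csum_push D a f (hΦ.left _ _) p.1
  simp only [h2, ← csum_lsum]
  rw [csum_comm, ← csum_smul]
  refine csum_congr_right fun Y hY => ?_
  rw [← csum_smul]
  refine congrArg (fun F => csum (letter D a) F q.2) (funext fun Z => ?_)
  rw [lsum_comm]
  simp only [bsum_lsum]
  rw [← lsum_smul]
  refine lsum_congr fun c' _ => ?_
  rw [← lsum_smul]
  refine lsum_congr fun d' _ => ?_
  rw [bsum_smul, hY, smul_smul, ← Int.negOnePow_add]
  have h3 := bsum_midLetter hΦ (D := D) (c := c) (a := a) (m := m) (c'.map (opLetter 0 f))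
    (d'.map (opLetter 0 f)) e (biEval F) p.2 q.1
  obtain ⟨φ, hφ⟩ := hΦ.mid (c'.map (opLetter 0 f)) (wt D p.2 + D c + wt D q.1 + e)
    (d'.map (opLetter 0 f))
  unfold biLetter
  rw [h3, hφ, hφ, Units.smul_def, Units.smul_def, map_zsmul]
  congr 2
  -- The outer letters on the left cost e · wt p.1 and the module letter carries e · wt p.2. Their
  -- sum e · wt u does not depend on the splitting, which is why the sign can stand in front.
  rw [Int.negOnePow_eq_iff, ← wt_splits hp]
  exact ⟨-(e * wt D p.1), by ring⟩

/-! ### Cyclic words of blocks -/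

/-- The sum of `Φ` over all ways of cutting the cyclic word `u ++ c :: v ++ [o]` into blocks such
that `c` and `o` lie in different blocks, with the Koszul sign of moving the initial part of the
word which belongs to the block of `o` to the end. -/
def ipsum (D : α → ℤ) (c o : α) (a : List α → A) (m n : List α → List α → M)
    (Φ : List (ℤ × A) → ℤ × M → List (ℤ × A) → ℤ × M → W) (u v : List α) : W :=
  lsum (splits u) fun s => lsum (splits v) fun r =>
    (wt D s.1 * (wt D s.2 + D c + wt D v + D o)).negOnePow •
      bsum (letter D a) (midLetter D c m) (fun y x z => Φ y x z (midLetter D o n r.2 s.1)) s.2 r.1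

/-- Blocks at the two ends of the cyclic word are moved next to the entry at o. Both sides then run
over the same decompositions, with a smaller block around o cut out of the larger one. This is the
rotation behind the dual module structure and behind F^*. -/
theorem ipsum_regroup (D : α → ℤ) (c o : α) (a : List α → A) (m n : List α → List α → M)
    (Φ : List (ℤ × A) → List (ℤ × A) → ℤ × M → List (ℤ × A) → List (ℤ × A) → ℤ × M → W)
    (u v : List α) :
    ipsum D c o a m n (fun y x z t => lsum (splits y) fun S => lsum (splits z) fun T =>
        (sdeg S.1 * (sdeg S.2 + x.1 + (sdeg T.1 + sdeg T.2) + t.1)).negOnePow •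
          Φ S.1 S.2 x T.1 T.2 t) u v =
      lsum (splits u) fun s => lsum (splits v) fun r =>
        (wt D s.1 * (wt D s.2 + D c + wt D v + D o)).negOnePow •
          bsum (letter D a) (midLetter D c m) (fun y x z =>
            bsum (letter D a) (midLetter D o n) (fun Z t Y => Φ Y y x z Z t) r.2 s.1) s.2 r.1 := by
  have h1 : ∀ s r : List α × List α,
      bsum (letter D a) (midLetter D c m) (fun y x z => lsum (splits y) fun S =>
        lsum (splits z) fun T =>
        (sdeg S.1 * (sdeg S.2 + x.1 + (sdeg T.1 + sdeg T.2) +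
          (midLetter D o n r.2 s.1).1)).negOnePow •
          Φ S.1 S.2 x T.1 T.2 (midLetter D o n r.2 s.1)) s.2 r.1 = _ := fun s r =>
    bsum_regroup (letter D a) (midLetter D c m) (fun Y y x z Z =>
      (sdeg Y * (sdeg y + x.1 + (sdeg z + sdeg Z) + (midLetter D o n r.2 s.1).1)).negOnePow •
        Φ Y y x z Z (midLetter D o n r.2 s.1)) s.2 r.1
  simp only [ipsum, h1, ← lsum_smul]
  have h2 : ∀ s : List α × List α, (lsum (splits v) fun r => lsum (splits s.2) fun p =>
      lsum (splits r.1) fun q =>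
        (wt D s.1 * (wt D s.2 + D c + wt D v + D o)).negOnePow •
        csum (letter D a) (fun Y => csum (letter D a) (fun Z =>
          bsum (letter D a) (midLetter D c m) (fun y x z =>
            (sdeg Y * (sdeg y + x.1 + (sdeg z + sdeg Z) +
              (midLetter D o n r.2 s.1).1)).negOnePow •
            Φ Y y x z Z (midLetter D o n r.2 s.1)) p.2 q.1) q.2) p.1) =
      lsum (splits s.2) fun p => lsum (splits v) fun r => lsum (splits r.2) fun q =>
        (wt D s.1 * (wt D p.1 + wt D p.2 + D c + wt D v + D o)).negOnePow •
        csum (letter D a) (fun Y => csum (letter D a) (fun Z =>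
          bsum (letter D a) (midLetter D c m) (fun y x z =>
            (sdeg Y * (sdeg y + x.1 + (sdeg z + sdeg Z) +
              (midLetter D o n q.2 s.1).1)).negOnePow •
            Φ Y y x z Z (midLetter D o n q.2 s.1)) p.2 r.1) q.1) p.1 := by
    intro s
    rw [lsum_comm]
    refine lsum_congr fun p hp => ?_
    rw [lsum_splits_assoc v fun r1 q1 q2 =>
        (wt D s.1 * (wt D s.2 + D c + wt D v + D o)).negOnePow •
        csum (letter D a) (fun Y => csum (letter D a) (fun Z =>
          bsum (letter D a) (midLetter D c m) (fun y x z =>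
            (sdeg Y * (sdeg y + x.1 + (sdeg z + sdeg Z) +
              (midLetter D o n q2 s.1).1)).negOnePow •
            Φ Y y x z Z (midLetter D o n q2 s.1)) p.2 r1) q1) p.1]
    rw [wt_splits hp]
  simp only [h2]
  rw [← lsum_splits_assoc u fun s1 p1 p2 => lsum (splits v) fun r => lsum (splits r.2) fun q =>
        (wt D s1 * (wt D p1 + wt D p2 + D c + wt D v + D o)).negOnePow •
        csum (letter D a) (fun Y => csum (letter D a) (fun Z =>
          bsum (letter D a) (midLetter D c m) (fun y x z =>
            (sdeg Y * (sdeg y + x.1 + (sdeg z + sdeg Z) +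
              (midLetter D o n q.2 s1).1)).negOnePow •
            Φ Y y x z Z (midLetter D o n q.2 s1)) p2 r.1) q.1) p1]
  refine lsum_congr fun s _ => ?_
  rw [lsum_comm]
  refine lsum_congr fun r hr => ?_
  have h3 : bsum (letter D a) (midLetter D c m) (fun y x z =>
      bsum (letter D a) (midLetter D o n) (fun Z t Y => Φ Y y x z Z t) r.2 s.1) s.2 r.1 =
      lsum (splits r.2) fun q => lsum (splits s.1) fun p =>
        csum (letter D a) (fun Z => csum (letter D a) (fun Y =>
          bsum (letter D a) (midLetter D c m) (fun y x z =>
            Φ Y y x z Z (midLetter D o n q.2 p.1)) s.2 r.1) p.2) q.1 := by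
    change bsum (letter D a) (midLetter D c m) (fun y x z => lsum (splits r.2) fun q =>
      lsum (splits s.1) fun p => csum (letter D a) (fun Z => csum (letter D a) (fun Y =>
        Φ Y y x z Z (midLetter D o n q.2 p.1)) p.2) q.1) s.2 r.1 = _
    simp only [bsum_lsum, bsum_csum]
  rw [h3, lsum_comm, ← lsum_smul]
  refine lsum_congr fun q hq => ?_
  rw [← lsum_smul]
  refine lsum_congr fun p hp => ?_
  rw [csum_comm, ← csum_smul, ← csum_smul]
  refine csum_congr_right fun Z hZ => ?_
  rw [← csum_smul, ← csum_smul]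
  refine csum_congr_right fun Y hY => ?_
  rw [← bsum_smul, ← bsum_smul]
  refine bsum_congr_right fun y x z h => ?_
  rw [smul_smul, ← Int.negOnePow_add]
  congr 1
  rw [Int.negOnePow_eq_iff, hY, midLetter, hZ, ← wt_splits hr, ← wt_splits hp, ← wt_splits hq]
  have hz : sdeg y + x.1 = wt D s.2 + D c + wt D r.1 - sdeg z := by linarith
  rw [hz]
  -- Moving p.1 to the end and then p.2, the two parts pass each other twice, so their mutual
  -- contribution to the sign is even.
  exact ⟨wt D p.1 * wt D p.2, by ring⟩

end Blocks

/-! ### Homogeneity -/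

section Homogeneous

variable {R α A B M N W : Type*} [CommRing R] [AddCommGroup A] [Module R A]
  [AddCommGroup B] [Module R B] [AddCommGroup M] [Module R M] [AddCommGroup N] [Module R N]
  [AddCommGroup W]
  {𝒜 : ℤ → Submodule R A} {ℬ : ℤ → Submodule R B} {ℳ : ℤ → Submodule R M}
  {𝒩 : ℤ → Submodule R N}

theorem units_smul_mem (S : Submodule R A) (ε : ℤˣ) {x : A} (hx : x ∈ S) : ε • x ∈ S := by
  rcases Int.units_eq_one_or ε with rfl | rfl
  · rwa [one_smul]
  · rw [Units.smul_def]
    simpa using hx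

theorem lsum_mem {β : Type*} (S : Submodule R A) {l : List β} {φ : β → A}
    (h : ∀ x ∈ l, φ x ∈ S) : lsum l φ ∈ S := by
  refine list_sum_mem fun y hy => ?_
  obtain ⟨x, hx, rfl⟩ := List.mem_map.1 hy
  exact h x hx

/-- Unshifting adds one for each letter; this converts the degrees 2 - k and 1 - k of the operations
into the shifted degrees 1 and 0. -/
theorem sum_get_fst (w : List (ℤ × A)) :
    ∑ i, ((w.get i).1 + 1) = sdeg w + w.length := by
  induction w with
  | nil => simp [sdeg]
  | cons x w ih =>
    simp only [List.length_cons, Fin.sum_univ_succ, List.get_eq_getElem, Fin.val_zero,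
      List.getElem_cons_zero, Fin.val_succ, List.getElem_cons_succ, sdeg_cons] at ih ⊢
    rw [ih]
    push_cast
    ring

theorem isHomog_get {w : List (ℤ × A)} (hw : ∀ x ∈ w, IsHomog 𝒜 x) (i : Fin w.length) :
    (w.get i).2 ∈ 𝒜 ((w.get i).1 + 1) :=
  hw _ (List.get_mem _ _)

theorem Alg.isHomog_opLetter (X : Alg 𝒜) {w : List (ℤ × A)} (hw : ∀ x ∈ w, IsHomog 𝒜 x) :
    IsHomog 𝒜 (opLetter 1 X.mu w) := by
  refine units_smul_mem _ _ ?_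
  have h := X.mu_mem w.length _ _ (isHomog_get hw)
  rw [sum_get_fst] at h
  convert h using 1
  simp only [opLetter]
  congr 1
  ring

theorem AlgHom.isHomog_opLetter {X : Alg 𝒜} {Y : Alg ℬ} (f : AlgHom X Y) {w : List (ℤ × A)}
    (hw : ∀ x ∈ w, IsHomog 𝒜 x) : IsHomog ℬ (opLetter 0 f.map w) := by
  refine units_smul_mem _ _ ?_
  have h := f.map_mem w.length _ _ (isHomog_get hw)
  rw [sum_get_fst] at h
  convert h using 1
  simp only [opLetter]
  congr 1
  ring

theorem BiFamily.isHomog_biLetter {e : ℤ} (F : BiFamily 𝒜 ℳ 𝒩 e) {u v : List (ℤ × A)}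
    {m : ℤ × M} (hu : ∀ x ∈ u, IsHomog 𝒜 x) (hm : IsHomog ℳ m) (hv : ∀ x ∈ v, IsHomog 𝒜 x) :
    IsHomog 𝒩 (biLetter e F.map u m v) := by
  refine units_smul_mem _ _ ?_
  have h := F.map_mem u.length v.length _ _ _ _ _ _ (isHomog_get hu) hm (isHomog_get hv)
  rw [sum_get_fst, sum_get_fst] at h
  convert h using 1
  simp only [biLetter]
  congr 1
  ring

theorem isHomog_map_letter {D : α → ℤ} {a : List α → A} {w : List α}
    (hL : ∀ b, b <:+: w → b ≠ [] → IsHomog 𝒜 (letter D a b)) {c : List (List α)}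
    (hc : c ∈ cuts w) : ∀ x ∈ c.map (letter D a), IsHomog 𝒜 x := by
  intro x hx
  obtain ⟨b, hb, rfl⟩ := List.mem_map.1 hx
  exact hL b (infix_of_mem_cuts hc hb) (ne_nil_of_mem_cuts hc b hb)

/-- The structure relations are available only for homogeneous letters, so they enter the sums over
cuttings through this congruence and `bsum_congr_homog`. -/
theorem csum_congr_homog {D : α → ℤ} {a : List α → A} {w : List α} {Φ Φ' : List (ℤ × A) → W}
    (hL : ∀ b, b <:+: w → b ≠ [] → IsHomog 𝒜 (letter D a b))
    (h : ∀ y, (∀ x ∈ y, IsHomog 𝒜 x) → Φ y = Φ' y) :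
    csum (letter D a) Φ w = csum (letter D a) Φ' w :=
  lsum_congr fun _ hc => h _ (isHomog_map_letter hL hc)

theorem bsum_congr_homog {D : α → ℤ} {c : α} {a : List α → A} {m : List α → List α → M}
    {u v : List α} {Φ Φ' : List (ℤ × A) → ℤ × M → List (ℤ × A) → W}
    (hu : ∀ b, b <:+: u → b ≠ [] → IsHomog 𝒜 (letter D a b))
    (hv : ∀ b, b <:+: v → b ≠ [] → IsHomog 𝒜 (letter D a b))
    (hm : ∀ p q, p <:+ u → q <+: v → IsHomog ℳ (midLetter D c m p q))
    (h : ∀ y x z, (∀ t ∈ y, IsHomog 𝒜 t) → IsHomog ℳ x → (∀ t ∈ z, IsHomog 𝒜 t) →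
      Φ y x z = Φ' y x z) :
    bsum (letter D a) (midLetter D c m) Φ u v = bsum (letter D a) (midLetter D c m) Φ' u v := by
  refine lsum_congr fun p hp => lsum_congr fun q hq => ?_
  rw [mem_splits] at hp hq
  refine csum_congr_homog (fun b hb => hu b (hb.trans ⟨[], p.2, by simpa using hp⟩))
    fun y hy => ?_
  exact csum_congr_homog (fun b hb => hv b (hb.trans ⟨q.1, [], by simpa using hq⟩))
    fun z hz => h _ _ _ hy (hm _ _ ⟨_, hp⟩ ⟨_, hq⟩) hz

theorem isHomog_csum {D : α → ℤ} {a : List α → A} {w : List α}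
    (hL : ∀ b, b <:+: w → b ≠ [] → IsHomog 𝒜 (letter D a b)) {e : ℤ}
    {φ : ∀ k, MultilinearMap R (fun _ : Fin k => A) B}
    (hφ : ∀ y, (∀ x ∈ y, IsHomog 𝒜 x) → IsHomog ℬ (opLetter e φ y)) :
    csum (letter D a) (opEval φ) w ∈ ℬ (wt D w + e + 1) := by
  refine lsum_mem _ fun c hc => ?_
  have h := hφ _ (isHomog_map_letter hL hc)
  rwa [IsHomog, opLetter, sdeg_map_letter D a hc] at h

theorem isHomog_bsum {D : α → ℤ} {c : α} {a : List α → A} {m : List α → List α → M}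
    {u v : List α} (hu : ∀ b, b <:+: u → b ≠ [] → IsHomog 𝒜 (letter D a b))
    (hv : ∀ b, b <:+: v → b ≠ [] → IsHomog 𝒜 (letter D a b))
    (hm : ∀ p q, p <:+ u → q <+: v → IsHomog ℳ (midLetter D c m p q)) {e : ℤ}
    (F : BiFamily 𝒜 ℳ 𝒩 e) :
    bsum (letter D a) (midLetter D c m) (biEval F.map) u v
      ∈ 𝒩 (wt D u + D c + wt D v + e + 1) := by
  refine lsum_mem _ fun p hp => lsum_mem _ fun q hq => lsum_mem _ fun y hy => lsum_mem _
    fun z hz => ?_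
  have hp' := mem_splits.1 hp
  have hq' := mem_splits.1 hq
  have h := F.isHomog_biLetter
    (isHomog_map_letter (fun b hb => hu b (hb.trans ⟨[], p.2, by simpa using hp'⟩)) hy)
    (hm _ _ ⟨_, hp'⟩ ⟨_, hq'⟩)
    (isHomog_map_letter (fun b hb => hv b (hb.trans ⟨q.1, [], by simpa using hq'⟩)) hz)
  rw [IsHomog, biLetter, sdeg_map_letter D a hy, sdeg_map_letter D a hz] at h
  convert h using 2
  rw [midLetter, ← wt_splits hp, ← wt_splits hq]
  ring

end Homogeneous

/-! ### Systems of elements indexed by the blocks of a cyclic word -/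

section Systems

variable {R α A B M N : Type*} [CommRing R] [AddCommGroup A] [Module R A]
  [AddCommGroup B] [Module R B] [AddCommGroup M] [Module R M] [AddCommGroup N] [Module R N]
  {𝒜 : ℤ → Submodule R A} {ℬ : ℤ → Submodule R B} {ℳ : ℤ → Submodule R M}
  {𝒩 : ℤ → Submodule R N} {X : Alg 𝒜} {Y : Alg ℬ}

/-- Homogeneous elements for the blocks of the cyclic word `u ++ c :: v ++ [o]` which do not contain
both `c` and `o`: `a b` for `b` inside `u` or `v`, `m p q` for the block `p ++ c :: q` and `n q p`
for the block `q ++ o :: p`. -/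
structure IsGradedSystem (𝒜 : ℤ → Submodule R A) (ℳ : ℤ → Submodule R M) (D : α → ℤ) (c o : α)
    (u v : List α) (a : List α → A) (m n : List α → List α → M) : Prop where
  left : ∀ b, b <:+: u → b ≠ [] → IsHomog 𝒜 (letter D a b)
  right : ∀ b, b <:+: v → b ≠ [] → IsHomog 𝒜 (letter D a b)
  mid : ∀ p q, p <:+ u → q <+: v → IsHomog ℳ (midLetter D c m p q)
  out : ∀ q p, q <:+ v → p <+: u → IsHomog ℳ (midLetter D o n q p)

/-- A system of elements for the blocks of a cyclic word satisfying the Maurer-Cartan equations. -/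
structure IsSystem (P : Bimod X ℳ) (D : α → ℤ) (c o : α) (u v : List α) (a : List α → A)
    (m n : List α → List α → M) : Prop extends IsGradedSystem 𝒜 ℳ D c o u v a m n where
  left_eq : ∀ b, b <:+: u → csum (letter D a) (opEval X.mu) b = 0
  right_eq : ∀ b, b <:+: v → csum (letter D a) (opEval X.mu) b = 0
  mid_eq : ∀ p q, p <:+ u → q <+: v →
    bsum (letter D a) (midLetter D c m) (biEval P.map) p q = 0
  out_eq : ∀ q p, q <:+ v → p <+: u →
    bsum (letter D a) (midLetter D o n) (biEval P.map) q p = 0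

/-- The image of the algebra part of a system. -/
def pushA (f : ∀ k, MultilinearMap R (fun _ : Fin k => A) B) (D : α → ℤ) (a : List α → A)
    (b : List α) : B :=
  csum (letter D a) (opEval f) b

/-- The image of the module part of a system under a family of degree `e`. -/
def pushM (F : ∀ k l, BiMultilinear R A M N k l) (e : ℤ) (D : α → ℤ) (c : α) (a : List α → A)
    (m : List α → List α → M) (p q : List α) : N :=
  (e * wt D p).negOnePow • bsum (letter D a) (midLetter D c m) (biEval F) p q

theorem letter_congr {D D' : α → ℤ} {w : List α} (h : ∀ x ∈ w, D' x = D x) (a : List α → A)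
    {b : List α} (hb : b <:+: w) : letter D' a b = letter D a b := by
  rw [letter, letter, wt_congr fun x hx => h x (hb.subset hx)]

/-- By `csum_push` the sum is the right side of the morphism relation, summed over cuttings. The
left side precomposes with μ, so it consists of terms with a marked Maurer-Cartan sum and vanishes.
-/
theorem csum_pushA {f : AlgHom X Y} {D D' : α → ℤ} {a : List α → A} {w : List α}
    (hD : ∀ x ∈ w, D' x = D x) (hL : ∀ b, b <:+: w → b ≠ [] → IsHomog 𝒜 (letter D a b))
    (h : ∀ b, b <:+: w → csum (letter D a) (opEval X.mu) b = 0) :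
    csum (letter D' (pushA f.map D a)) (opEval Y.mu) w = 0 := by
  rw [csum_congr _ fun b hb _ => letter_congr hD (pushA f.map D a) hb]
  refine (csum_push D a f.map (letterAdditive_opEval _) w).trans ?_
  rw [csum_congr_homog (Φ' := opPrecomp X.mu f.map) hL fun y hy => (f.rel y hy).symm]
  exact (csum_precomp D a X.mu (letterAdditive_opEval _) w).trans
    (mark_eq_zero (letterAdditive_opEval _) h)

/-- This is `bsum_push` with the degrees of the image tuple: D' agrees with D at algebra positions
and is larger by e at the module position. -/
theorem bsum_pushM_eq {f : AlgHom X Y} {W : Type*} [AddCommGroup W]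
    {e : ℤ} (F : BiFamily 𝒜 ℳ 𝒩 e)
    {Φ : List (ℤ × B) → ℤ × N → List (ℤ × B) → W} (hΦ : BiAdditive Φ)
    {D D' : α → ℤ} {c : α} {u v : List α} (a : List α → A) (m : List α → List α → M)
    (hu : ∀ x ∈ u, D' x = D x) (hv : ∀ x ∈ v, D' x = D x) (hc : D' c = D c + e) :
    bsum (letter D' (pushA f.map D a)) (midLetter D' c (pushM F.map e D c a m)) Φ u v =
      (e * wt D u).negOnePow • bsum (letter D a) (midLetter D c m) (fun y x z =>
        lsum (splits y) fun p => lsum (splits z) fun q =>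
          lsum (cuts p.1) fun c' => lsum (cuts q.2) fun d => (e * sdeg p.1).negOnePow •
            Φ (c'.map (opLetter 0 f.map)) (biLetter e F.map p.2 x q.1)
              (d.map (opLetter 0 f.map))) u v := by
  rw [← bsum_push D c a m f.map e F.map hΦ u v]
  refine bsum_congr Φ (fun b hb _ => letter_congr hu _ hb) (fun b hb _ => letter_congr hv _ hb)
    fun p q hp hq => ?_
  rw [midLetter, hc, wt_congr fun x hx => hu x (hp.subset hx),
    wt_congr fun x hx => hv x (hq.subset hx)]
  refine Prod.ext ?_ rfl
  dsimp only
  ring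

/-- As in `csum_pushA`, with the relation of the module morphism in place of that of f; the global
signs are units and do not affect vanishing. -/
theorem bsum_pushM {f : AlgHom X Y} {P : Bimod X ℳ} {Q : Bimod Y 𝒩} {e : ℤ} (F : ModHom f P Q e)
    {D D' : α → ℤ} {c : α} {u v : List α} {a : List α → A} {m : List α → List α → M}
    (hDu : ∀ x ∈ u, D' x = D x) (hDv : ∀ x ∈ v, D' x = D x) (hDc : D' c = D c + e)
    (hu : ∀ b, b <:+: u → b ≠ [] → IsHomog 𝒜 (letter D a b))
    (hv : ∀ b, b <:+: v → b ≠ [] → IsHomog 𝒜 (letter D a b))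
    (hm : ∀ p q, p <:+ u → q <+: v → IsHomog ℳ (midLetter D c m p q))
    (hu' : ∀ b, b <:+: u → csum (letter D a) (opEval X.mu) b = 0)
    (hv' : ∀ b, b <:+: v → csum (letter D a) (opEval X.mu) b = 0)
    (hm' : ∀ p q, p <:+ u → q <+: v →
      bsum (letter D a) (midLetter D c m) (biEval P.map) p q = 0) :
    bsum (letter D' (pushA f.map D a)) (midLetter D' c (pushM F.map e D c a m))
      (biEval Q.map) u v = 0 := by
  rw [bsum_pushM_eq F.toBiFamily (biAdditive_biEval _) a m hDu hDv hDc]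
  have h : ∀ ε : ℤˣ, ∀ x : N, ε • x = 0 → x = 0 := fun ε x hx => by
    rw [← inv_smul_smul ε x, hx, smul_zero]
  have h1 : bsum (letter D a) (midLetter D c m) (biPrecomp X.mu P.map F.map) u v = 0 :=
    (bsum_precomp D c a m X.mu P.map (biAdditive_biEval F.map) u v).trans
      (bmark_eq_zero (biAdditive_biEval _) hu' hv' hm')
  rw [bsum_congr_homog hu hv hm fun y x z hy hx hz => F.rel y x z hy hx hz, bsum_smul] at h1
  rw [h _ _ h1, smul_zero]

/-- The image of a system under a morphism. -/
theorem IsSystem.push {P : Bimod X ℳ} {Q : Bimod Y 𝒩} {f : AlgHom X Y} {e : ℤ}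
    (F : ModHom f P Q e) {D D' : α → ℤ} {c o : α} {u v : List α} {a : List α → A}
    {m n : List α → List α → M} (h : IsSystem P D c o u v a m n)
    (hu : ∀ x ∈ u, D' x = D x) (hv : ∀ x ∈ v, D' x = D x) (hc : D' c = D c + e)
    (ho : D' o = D o + e) :
    IsSystem Q D' c o u v (pushA f.map D a) (pushM F.map e D c a m) (pushM F.map e D o a n) where
  left b hb _ := by
    rw [letter_congr hu _ hb]
    have := isHomog_csum (fun b' hb' => h.left b' (hb'.trans hb)) fun y hy => f.isHomog_opLetter hy
    rwa [add_zero] at this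
  right b hb _ := by
    rw [letter_congr hv _ hb]
    have := isHomog_csum (fun b' hb' => h.right b' (hb'.trans hb)) fun y hy => f.isHomog_opLetter hy
    rwa [add_zero] at this
  mid p q hp hq := by
    have := isHomog_bsum (fun b hb => h.left b (hb.trans hp.isInfix))
      (fun b hb => h.right b (hb.trans hq.isInfix))
      (fun p' q' hp' hq' => h.mid p' q' (hp'.trans hp) (hq'.trans hq)) F.toBiFamily
    rw [IsHomog, midLetter, hc, wt_congr fun x hx => hu x (hp.subset hx),
      wt_congr fun x hx => hv x (hq.subset hx)]
    refine units_smul_mem _ _ ?_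
    convert this using 2
    ring
  out q p hq hp := by
    have := isHomog_bsum (fun b hb => h.right b (hb.trans hq.isInfix))
      (fun b hb => h.left b (hb.trans hp.isInfix))
      (fun q' p' hq' hp' => h.out q' p' (hq'.trans hq) (hp'.trans hp)) F.toBiFamily
    rw [IsHomog, midLetter, ho, wt_congr fun x hx => hu x (hp.subset hx),
      wt_congr fun x hx => hv x (hq.subset hx)]
    refine units_smul_mem _ _ ?_
    convert this using 2
    ring
  left_eq b hb := csum_pushA (fun x hx => hu x (hb.subset hx))
    (fun b' hb' => h.left b' (hb'.trans hb)) fun b' hb' => h.left_eq b' (hb'.trans hb)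
  right_eq b hb := csum_pushA (fun x hx => hv x (hb.subset hx))
    (fun b' hb' => h.right b' (hb'.trans hb)) fun b' hb' => h.right_eq b' (hb'.trans hb)
  mid_eq p q hp hq := bsum_pushM F (fun x hx => hu x (hp.subset hx))
    (fun x hx => hv x (hq.subset hx)) hc (fun b hb => h.left b (hb.trans hp.isInfix))
    (fun b hb => h.right b (hb.trans hq.isInfix))
    (fun p' q' hp' hq' => h.mid p' q' (hp'.trans hp) (hq'.trans hq))
    (fun b hb => h.left_eq b (hb.trans hp.isInfix))
    (fun b hb => h.right_eq b (hb.trans hq.isInfix))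
    fun p' q' hp' hq' => h.mid_eq p' q' (hp'.trans hp) (hq'.trans hq)
  out_eq q p hq hp := bsum_pushM F (fun x hx => hv x (hq.subset hx))
    (fun x hx => hu x (hp.subset hx)) ho (fun b hb => h.right b (hb.trans hq.isInfix))
    (fun b hb => h.left b (hb.trans hp.isInfix))
    (fun q' p' hq' hp' => h.out q' p' (hq'.trans hq) (hp'.trans hp))
    (fun b hb => h.right_eq b (hb.trans hq.isInfix))
    (fun b hb => h.left_eq b (hb.trans hp.isInfix))
    fun q' p' hq' hp' => h.out_eq q' p' (hq'.trans hq) (hp'.trans hp)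

/-- The staircase inner product of the image of a system. -/
theorem ipsum_push {P : Bimod X ℳ} {Q : Bimod Y 𝒩} {f : AlgHom X Y} {e j : ℤ}
    (F : ModHom f P Q e) (J : BiFamily ℬ 𝒩 (dualGrading 𝒩) j) {D D' : α → ℤ} {c o : α}
    {u v : List α} (a : List α → A) (m n : List α → List α → M)
    (hu : ∀ x ∈ u, D' x = D x) (hv : ∀ x ∈ v, D' x = D x) (hc : D' c = D c + e)
    (ho : D' o = D o + e) :
    ipsum D' c o (pushA f.map D a) (pushM F.map e D c a m) (pushM F.map e D o a n)
        (ipEval J) u v =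
      (e * (wt D v + D c + j + e)).negOnePow •
        ipsum D c o a m n (pullbackEval F J) u v := by
  -- The Koszul sign of the pullback is separated into the rotation sign, in the shape needed for
  -- `ipsum_regroup`, and the signs due to the two copies of F.
  have hpull : ipsum D c o a m n (pullbackEval F J) u v =
      ipsum D c o a m n (fun y x z t => lsum (splits y) fun S => lsum (splits z) fun T =>
        (sdeg S.1 * (sdeg S.2 + x.1 + (sdeg T.1 + sdeg T.2) + t.1)).negOnePow •
        (e * (j + e + sdeg S.2 + x.1 + sdeg T.1)).negOnePow •
        lsum (splits S.2) fun p => lsum (splits T.1) fun q =>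
          lsum (cuts p.1) fun c' => lsum (cuts q.2) fun d => (e * sdeg p.1).negOnePow •
            ipEval J (c'.map (opLetter 0 f.map)) (biLetter e F.map p.2 x q.1)
              (d.map (opLetter 0 f.map)) (biLetter e F.map T.2 t S.1)) u v := by
    refine lsum_congr fun s _ => lsum_congr fun r _ => ?_
    congr 2
    funext y x z
    refine lsum_congr fun S _ => lsum_congr fun T hT => ?_
    simp only [← lsum_smul]
    refine lsum_congr fun p _ => lsum_congr fun q _ => lsum_congr fun c' _ =>
      lsum_congr fun d _ => ?_
    rw [smul_smul, smul_smul, ← Int.negOnePow_add, ← Int.negOnePow_add,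
      ← sdeg_append, mem_splits.1 hT]
    congr 2
    ring
  rw [hpull, ipsum_regroup D c o a m n (fun Y y x z Z t =>
    (e * (j + e + sdeg y + x.1 + sdeg z)).negOnePow •
        lsum (splits y) fun p => lsum (splits z) fun q =>
          lsum (cuts p.1) fun c' => lsum (cuts q.2) fun d => (e * sdeg p.1).negOnePow •
            ipEval J (c'.map (opLetter 0 f.map)) (biLetter e F.map p.2 x q.1)
              (d.map (opLetter 0 f.map)) (biLetter e F.map Z t Y)) u v, ← lsum_smul, ipsum]
  refine lsum_congr fun s hs => ?_
  rw [← lsum_smul]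
  refine lsum_congr fun r hr => ?_
  have hs' := mem_splits.1 hs
  have hr' := mem_splits.1 hr
  have hs1 : ∀ x ∈ s.1, D' x = D x := fun x hx => hu x (by simp [← hs', hx])
  have hs2 : ∀ x ∈ s.2, D' x = D x := fun x hx => hu x (by simp [← hs', hx])
  have hr1 : ∀ x ∈ r.1, D' x = D x := fun x hx => hv x (by simp [← hr', hx])
  have hr2 : ∀ x ∈ r.2, D' x = D x := fun x hx => hv x (by simp [← hr', hx])
  rw [bsum_pushM_eq F.toBiFamily (biAdditive_ipEval J _) a m hs2 hr1 hc, smul_smul, smul_smul,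
    ← Int.negOnePow_add, ← Int.negOnePow_add]
  -- The value at o is additive, so the sum over the cuttings around o can be pulled out of the
  -- pushed module letter. Each term then contains the second application of F, as in the pullback.
  have key : bsum (letter D a) (midLetter D c m) (fun y x z =>
        lsum (splits y) fun p => lsum (splits z) fun q =>
          lsum (cuts p.1) fun c' => lsum (cuts q.2) fun d => (e * sdeg p.1).negOnePow •
            ipEval J (c'.map (opLetter 0 f.map)) (biLetter e F.map p.2 x q.1)
              (d.map (opLetter 0 f.map))
              (midLetter D' o (pushM F.map e D o a n) r.2 s.1)) s.2 r.1 =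
      (e * wt D r.2 + e * (j + e + wt D s.2 + D c + wt D r.1)).negOnePow •
        bsum (letter D a) (midLetter D c m) (fun y x z =>
          bsum (letter D a) (midLetter D o n) (fun Z t Y =>
            (e * (j + e + sdeg y + x.1 + sdeg z)).negOnePow •
              lsum (splits y) fun p => lsum (splits z) fun q =>
                lsum (cuts p.1) fun c' => lsum (cuts q.2) fun d => (e * sdeg p.1).negOnePow •
                  ipEval J (c'.map (opLetter 0 f.map)) (biLetter e F.map p.2 x q.1)
                    (d.map (opLetter 0 f.map)) (biLetter e F.map Z t Y)) r.2 s.1) s.2 r.1 := by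
    rw [← bsum_smul]
    refine bsum_congr_right fun y x z h => ?_
    have h' : j + e + sdeg y + x.1 + sdeg z = j + e + wt D s.2 + D c + wt D r.1 := by linarith
    rw [bsum_smul, h', smul_smul, ← Int.negOnePow_add]
    simp only [bsum_lsum, ← lsum_smul]
    refine lsum_congr fun p _ => lsum_congr fun q _ => lsum_congr fun c' _ =>
      lsum_congr fun d _ => ?_
    rw [bsum_smul, smul_comm]
    refine congrArg _ ?_
    obtain ⟨φ, hφ⟩ := ipEval_snd_additive J (c'.map (opLetter 0 f.map))
      (biLetter e F.map p.2 x q.1) (d.map (opLetter 0 f.map)) (wt D r.2 + D o + wt D s.1 + e)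
    have h1 : midLetter D' o (pushM F.map e D o a n) r.2 s.1 = (wt D r.2 + D o + wt D s.1 + e,
        (e * wt D r.2).negOnePow •
          bsum (letter D a) (midLetter D o n) (biEval F.map) r.2 s.1) := by
      rw [midLetter, wt_congr hr2, wt_congr hs1, ho]
      refine Prod.ext ?_ rfl
      dsimp only
      ring
    have h2 : bsum (letter D a) (midLetter D o n) (fun Z t Y =>
        ipEval J (c'.map (opLetter 0 f.map)) (biLetter e F.map p.2 x q.1)
          (d.map (opLetter 0 f.map)) (biLetter e F.map Z t Y)) r.2 s.1 =
        φ (bsum (letter D a) (midLetter D o n) (biEval F.map) r.2 s.1) := by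
      rw [map_bsum]
      refine bsum_congr_right fun Z t Y hZ => ?_
      have h3 : biLetter e F.map Z t Y = (wt D r.2 + D o + wt D s.1 + e, biEval F.map Z t Y) := by
        rw [biLetter, hZ]
      rw [h3, hφ]
    rw [h1, h2, hφ, Units.smul_def, map_zsmul, Units.smul_def]
    congr 2
    rw [Int.negOnePow_eq_iff]
    exact ⟨-(e * (j + e + wt D s.2 + D c + wt D r.1)), by ring⟩
  rw [key, smul_smul, ← Int.negOnePow_add, wt_congr hs1, wt_congr hs2, wt_congr hv, hc, ho]
  congr 1
  -- The two raised module degrees contribute 2e · wt s.1, and e · wt s.2 occurs twice. Modulo 2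
  -- there remains e · (wt v + D c + j + e), independent of the splittings s and r.
  rw [Int.negOnePow_eq_iff, ← wt_splits hr]
  exact ⟨wt D s.1 * e + e * wt D s.2, by ring⟩

end Systems

/-! ### The staircase inner product of an exact family -/

section Stokes

variable {R α A B M N : Type*} [CommRing R] [AddCommGroup A] [Module R A]
  [AddCommGroup B] [Module R B] [AddCommGroup M] [Module R M] [AddCommGroup N] [Module R N]
  {𝒜 : ℤ → Submodule R A} {ℬ : ℤ → Submodule R B} {ℳ : ℤ → Submodule R M}
  {𝒩 : ℤ → Submodule R N} {X : Alg 𝒜} {Y : Alg ℬ}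

theorem ipsum_add {W : Type*} [AddCommGroup W] (D : α → ℤ) (c o : α) (a : List α → A)
    (m n : List α → List α → M)
    (Φ Φ' : List (ℤ × A) → ℤ × M → List (ℤ × A) → ℤ × M → W) (u v : List α) :
    ipsum D c o a m n (fun y x z t => Φ y x z t + Φ' y x z t) u v =
      ipsum D c o a m n Φ u v + ipsum D c o a m n Φ' u v := by
  simp only [ipsum, bsum_add, smul_add, lsum_add]

theorem ipsum_sub {W : Type*} [AddCommGroup W] (D : α → ℤ) (c o : α) (a : List α → A)
    (m n : List α → List α → M)
    (Φ Φ' : List (ℤ × A) → ℤ × M → List (ℤ × A) → ℤ × M → W) (u v : List α) :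
    ipsum D c o a m n (fun y x z t => Φ y x z t - Φ' y x z t) u v =
      ipsum D c o a m n Φ u v - ipsum D c o a m n Φ' u v := by
  simp only [ipsum, bsum_sub, smul_sub, lsum_sub]

theorem IsGradedSystem.ipsum_congr {W : Type*} [AddCommGroup W] {D : α → ℤ} {c o : α}
    {u v : List α} {a : List α → A} {m n : List α → List α → M}
    (h : IsGradedSystem 𝒜 ℳ D c o u v a m n)
    {Φ Φ' : List (ℤ × A) → ℤ × M → List (ℤ × A) → ℤ × M → W}
    (hΦ : ∀ y x z t, (∀ w ∈ y, IsHomog 𝒜 w) → IsHomog ℳ x → (∀ w ∈ z, IsHomog 𝒜 w) →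
      IsHomog ℳ t → Φ y x z t = Φ' y x z t) :
    ipsum D c o a m n Φ u v = ipsum D c o a m n Φ' u v := by
  refine lsum_congr fun s hs => lsum_congr fun r hr => congrArg _ ?_
  rw [mem_splits] at hs hr
  have hs2 : s.2 <:+ u := ⟨_, hs⟩
  have hr1 : r.1 <+: v := ⟨_, hr⟩
  exact bsum_congr_homog (fun b hb => h.left b (hb.trans hs2.isInfix))
    (fun b hb => h.right b (hb.trans hr1.isInfix))
    (fun p q hp hq => h.mid p q (hp.trans hs2) (hq.trans hr1))
    fun y x z hy hx hz => hΦ _ _ _ _ hy hx hz (h.out _ _ ⟨_, hr⟩ ⟨_, hs⟩)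

/-- Every term of the precomposition has the same total degree, so the sign of the pairing is common
to all of them and the pairing distributes over the sum. -/
theorem pair_biPrecomp (μ : ∀ k, MultilinearMap R (fun _ : Fin k => A) A)
    (β : ∀ k l, BiMultilinear R A M M k l) {e : ℤ} (G : BiFamily 𝒜 ℳ (dualGrading ℳ) e)
    (u : List (ℤ × A)) (m : ℤ × M) (v : List (ℤ × A)) (n : ℤ × M) :
    pair (sdeg u + m.1 + sdeg v + e + 1, biPrecomp μ β G.map u m v) n =
      (lsum (splits u) fun p => lsum (splits p.2) fun q =>
        (sdeg p.1).negOnePow • ipEval G (p.1 ++ opLetter 1 μ q.1 :: q.2) m v n)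
      + (lsum (splits u) fun p => lsum (splits v) fun q =>
        (sdeg p.1).negOnePow • ipEval G p.1 (biLetter 1 β p.2 m q.1) q.2 n)
      + (lsum (splits v) fun p => lsum (splits p.2) fun q =>
        (sdeg u + m.1 + sdeg p.1).negOnePow •
          ipEval G u m (p.1 ++ opLetter 1 μ q.1 :: q.2) n) := by
  let ev : Module.Dual R M →+ R :=
    ⟨⟨fun φ => (sdeg u + m.1 + sdeg v + e + 1).negOnePow • φ n.2, by simp⟩, fun φ ψ => by simp⟩
  have hev : ∀ φ, pair (sdeg u + m.1 + sdeg v + e + 1, φ) n = ev φ := fun _ => rfl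
  have hsm : ∀ (ε : ℤˣ) φ, ev (ε • φ) = ε • ev φ := fun ε φ => by
    rw [Units.smul_def, map_zsmul, Units.smul_def]
  rw [hev, biPrecomp, map_add, map_add]
  simp only [map_lsum, hsm]
  congr 1
  · congr 1
    · refine lsum_congr fun p hp => lsum_congr fun q hq => congrArg _ ?_
      rw [ipEval, biLetter, ← hev]
      congr 2
      rw [sdeg_append, sdeg_cons, opLetter, ← mem_splits.1 hp, ← mem_splits.1 hq, sdeg_append,
        sdeg_append]
      ring
    · refine lsum_congr fun p hp => lsum_congr fun q hq => congrArg _ ?_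
      rw [ipEval, biLetter, ← hev]
      congr 2
      change _ = sdeg p.1 + (sdeg p.2 + m.1 + sdeg q.1 + 1) + sdeg q.2 + e
      rw [← mem_splits.1 hp, ← mem_splits.1 hq, sdeg_append, sdeg_append]
      ring
  · refine lsum_congr fun p hp => lsum_congr fun q hq => congrArg _ ?_
    rw [ipEval, biLetter, ← hev]
    congr 2
    rw [sdeg_append, sdeg_cons, opLetter, ← mem_splits.1 hp, ← mem_splits.1 hq, sdeg_append,
      sdeg_append]
    ring

theorem neg_eq_negOnePow_smul {W : Type*} [AddCommGroup W] (x : W) :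
    -x = (1 : ℤ).negOnePow • x := by
  simp [Units.smul_def]

/-- The dual structure β' evaluates the functional on β with the outer letters rotated around n.
Spelled out, the second half of δ becomes a rotated sum to which `ipsum_regroup` applies. -/
theorem deltaEval_eq (P : Bimod X ℳ) {e : ℤ} (G : BiFamily 𝒜 ℳ (dualGrading ℳ) e)
    (y : List (ℤ × A)) (x : ℤ × M) (z : List (ℤ × A)) (t : ℤ × M) :
    deltaEval P G y x z t =
      pair (sdeg y + x.1 + sdeg z + e + 1, biPrecomp X.mu P.map G.map y x z) t
      + lsum (splits y) fun S => lsum (splits z) fun T =>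
        (sdeg S.1 * (sdeg S.2 + x.1 + (sdeg T.1 + sdeg T.2) + t.1)).negOnePow •
          (sdeg S.2 + x.1 + sdeg T.1).negOnePow •
            ipEval G S.2 x T.1 (biLetter 1 P.map T.2 t S.1) := by
  rw [deltaEval, sub_eq_add_neg, ← lsum_smul]
  congr 1
  rw [neg_eq_negOnePow_smul, ← lsum_smul]
  refine lsum_congr fun S _ => ?_
  rw [← lsum_smul, ← lsum_smul]
  refine lsum_congr fun T _ => ?_
  rw [dualEval, neg_eq_negOnePow_smul, ipEval]
  simp only [smul_smul]
  congr 1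
  rw [biLetter]
  simp only [← Int.negOnePow_add]
  rw [Int.negOnePow_eq_iff]
  exact ⟨1 + e + e * sdeg S.1, by ring⟩

/-- The sum of `I` over all ways of cutting the cyclic word into blocks one of which is marked; the
letter of the marked block is the sum of `μ` resp. `β` over the ways of cutting it. -/
def ipmark (P : Bimod X ℳ) (D : α → ℤ) (c o : α) (a : List α → A) (m n : List α → List α → M)
    {e : ℤ} (I : BiFamily 𝒜 ℳ (dualGrading ℳ) e) (u v : List α) : R :=
  lsum (splits u) fun s => lsum (splits v) fun r =>
    (wt D s.1 * (wt D s.2 + D c + wt D v + D o)).negOnePow •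
      (bmark D c a m X.mu P.map (fun y x z => ipEval I y x z (midLetter D o n r.2 s.1)) s.2 r.1
      + (wt D s.2 + D c + wt D r.1).negOnePow • bsum (letter D a) (midLetter D c m) (fun y x z =>
          ipEval I y x z (wt D r.2 + D o + wt D s.1 + 1,
            bsum (letter D a) (midLetter D o n) (biEval P.map) r.2 s.1)) s.2 r.1)

/-- Precomposition marks the blocks on the side of c by `bsum_precomp`; the term from β' marks the
block around o after regrouping. Thus every block of the cyclic word is marked in turn, as in a
boundary formula. -/
theorem ipsum_deltaEval (P : Bimod X ℳ) (D : α → ℤ) (c o : α) (a : List α → A)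
    (m n : List α → List α → M) {e : ℤ} (I : BiFamily 𝒜 ℳ (dualGrading ℳ) e) (u v : List α) :
    ipsum D c o a m n (deltaEval P I) u v = ipmark P D c o a m n I u v := by
  change ipsum D c o a m n (fun y x z t => deltaEval P I y x z t) u v = _
  simp only [deltaEval_eq]
  rw [ipsum_add, ipsum_regroup D c o a m n (fun Y y x z Z t =>
    (sdeg y + x.1 + sdeg z).negOnePow • ipEval I y x z (biLetter 1 P.map Z t Y)), ipsum,
    ← lsum_add]
  refine lsum_congr fun s _ => ?_
  rw [← lsum_add]
  refine lsum_congr fun r _ => ?_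
  rw [← smul_add]
  refine congrArg _ ?_
  congr 1
  · simp only [pair_biPrecomp]
    exact bsum_precomp D c a m X.mu P.map (biAdditive_ipEval I _) s.2 r.1
  · rw [← bsum_smul]
    refine bsum_congr_right fun y x z h => ?_
    rw [bsum_smul, h]
    refine congrArg _ ?_
    obtain ⟨φ, hφ⟩ := ipEval_snd_additive I y x z (wt D r.2 + D o + wt D s.1 + 1)
    rw [hφ, map_bsum]
    refine bsum_congr_right fun Z t Y hZ => ?_
    have h3 : biLetter 1 P.map Z t Y = (wt D r.2 + D o + wt D s.1 + 1, biEval P.map Z t Y) := by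
      rw [biLetter, hZ]
    rw [h3, hφ]

/-- Each marked block carries a Maurer-Cartan sum of the system. This makes the staircase sum
insensitive to the exact error allowed in `IPHom`. -/
theorem IsSystem.ipsum_deltaEval_eq_zero {P : Bimod X ℳ} {D : α → ℤ} {c o : α} {u v : List α}
    {a : List α → A} {m n : List α → List α → M} (h : IsSystem P D c o u v a m n) {e : ℤ}
    (G : BiFamily 𝒜 ℳ (dualGrading ℳ) e) : ipsum D c o a m n (deltaEval P G) u v = 0 := by
  rw [ipsum_deltaEval]
  refine lsum_eq_zero fun s hs => lsum_eq_zero fun r hr => ?_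
  rw [mem_splits] at hs hr
  have hs2 : s.2 <:+ u := ⟨_, hs⟩
  have hr1 : r.1 <+: v := ⟨_, hr⟩
  rw [bmark_eq_zero (biAdditive_ipEval G _) (fun b hb => h.left_eq b (hb.trans hs2.isInfix))
    (fun b hb => h.right_eq b (hb.trans hr1.isInfix))
    (fun p q hp hq => h.mid_eq p q (hp.trans hs2) (hq.trans hr1)),
    h.out_eq r.2 s.1 ⟨_, hr⟩ ⟨_, hs⟩]
  have h1 : ∀ y x z, ipEval G y x z (wt D r.2 + D o + wt D s.1 + 1, 0) = 0 := by
    intro y x z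
    simp [ipEval, pair]
  simp only [h1, bsum_zero, smul_zero, add_zero]

/-- Pushing the system forward evaluates F^♯(J) on the original one, and the difference F^♯(J) - I =
δ(G) sums to zero there. -/
theorem IsSystem.ipsum_eq_push {P : Bimod X ℳ} {Q : Bimod Y 𝒩} {i j : ℤ} {I : InnerProd P i}
    {J : InnerProd Q j} (Φ : IPHom I J) {D D' : α → ℤ} {c o : α} {u v : List α}
    {a : List α → A} {m n : List α → List α → M} (h : IsSystem P D c o u v a m n)
    (hu : ∀ x ∈ u, D' x = D x) (hv : ∀ x ∈ v, D' x = D x) (hc : D' c = D c + Φ.degree)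
    (ho : D' o = D o + Φ.degree) :
    ipsum D' c o (pushA Φ.algHom.map D a) (pushM Φ.modHom.map Φ.degree D c a m)
        (pushM Φ.modHom.map Φ.degree D o a n) (ipEval J.toBiFamily) u v =
      (Φ.degree * (wt D v + D c + j + Φ.degree)).negOnePow •
        ipsum D c o a m n (ipEval I.toBiFamily) u v := by
  rw [ipsum_push Φ.modHom J.toBiFamily a m n hu hv hc ho]
  refine congrArg _ ?_
  obtain ⟨g, G, hG⟩ := Φ.exact
  rw [← sub_eq_zero, ← ipsum_sub, ← h.ipsum_deltaEval_eq_zero G]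
  exact h.toIsGradedSystem.ipsum_congr fun y x z t hy hx hz ht => hG y x z t hy hx hz ht

end Stokes

/-! ### Changing one entry of a system by a coboundary -/

section Gauge

variable {R α A M W : Type*} [DecidableEq α] [CommRing R] [AddCommGroup A] [Module R A]
  [AddCommGroup M] [Module R M] [AddCommGroup W]
  {𝒜 : ℤ → Submodule R A} {ℳ : ℤ → Submodule R M} {X : Alg 𝒜}

/-- The weight of the part of a word before the first occurrence of `i`. -/
def before (D : α → ℤ) (i : α) (w : List α) : ℤ := wt D (w.takeWhile (· ≠ i))

theorem before_append_of_notMem {D : α → ℤ} {i : α} {p : List α} (h : i ∉ p) (q : List α) :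
    before D i (p ++ q) = wt D p + before D i q := by
  induction p with
  | nil => simp
  | cons x p ih =>
    rw [List.mem_cons, not_or] at h
    have hx : x ≠ i := fun hx => h.1 hx.symm
    have := ih h.2
    simp only [before] at this
    simp only [before, List.cons_append, List.takeWhile_cons, decide_not, hx, decide_false,
      Bool.not_false, if_true, wt_cons]
    simp only [decide_not] at this
    rw [this, add_assoc]

theorem before_append_of_mem {D : α → ℤ} {i : α} {p : List α} (h : i ∈ p) (q : List α) :
    before D i (p ++ q) = before D i p := by
  induction p with
  | nil => simp at h
  | cons x p ih =>
    by_cases hx : x = i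
    · simp [before, hx]
    · have hp : i ∈ p := by
        rcases List.mem_cons.1 h with h | h
        · exact absurd h.symm hx
        · exact h
      have := ih hp
      simp only [before] at this
      simp only [before, List.cons_append, List.takeWhile_cons, decide_not, hx, decide_false,
        Bool.not_false, if_true, wt_cons]
      simp only [decide_not] at this
      rw [this]

theorem before_cons_self (D : α → ℤ) (i : α) (w : List α) : before D i (i :: w) = 0 := by
  simp [before]

/-- The degrees of the entries, with the degree at position `i` lowered by one. -/
def lower (D : α → ℤ) (i : α) : α → ℤ := Function.update D i (D i - 1)

theorem lower_self (D : α → ℤ) (i : α) : lower D i i = D i - 1 := by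
  simp [lower]

theorem lower_of_ne {D : α → ℤ} {i x : α} (h : x ≠ i) : lower D i x = D x := by
  simp [lower, h]

theorem wt_lower_of_notMem {D : α → ℤ} {i : α} {w : List α} (h : i ∉ w) :
    wt (lower D i) w = wt D w :=
  wt_congr fun _ hx => lower_of_ne fun hxi => h (hxi ▸ hx)

theorem wt_lower_of_mem {D : α → ℤ} {i : α} {w : List α} (h : i ∈ w) (hw : w.Nodup) :
    wt (lower D i) w = wt D w - 1 := by
  obtain ⟨p, q, rfl⟩ := List.append_of_mem h
  have h1 : i ∉ p := fun hp => (List.nodup_append.1 hw).2.2 i hp i (by simp) rfl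
  have h2 : i ∉ q := (List.nodup_cons.1 (List.nodup_append.1 hw).2.1).1
  simp only [wt_append, wt_cons, wt_lower_of_notMem h1, wt_lower_of_notMem h2, lower_self]
  ring

/-- The algebra part of a system, changed by the coboundary of `a₁` around the position `i`. -/
def gaugeA (μ : ∀ k, MultilinearMap R (fun _ : Fin k => A) A) (D : α → ℤ) (i : α)
    (a a₁ : List α → A) (b : List α) : A :=
  if i ∈ b then
    a b + (before D i b).negOnePow • csum (letter (lower D i) a₁) (opEval μ) b
  else a b

/-- The module part of a system, changed by the coboundary of `a₁`, `m₁` around the position `i`. -/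
def gaugeM (β : ∀ k l, BiMultilinear R A M M k l) (D : α → ℤ) (i c : α)
    (a₁ : List α → A) (m m₁ : List α → List α → M) (p q : List α) : M :=
  if i ∈ p ++ c :: q then
    m p q + (before D i (p ++ c :: q)).negOnePow •
      bsum (letter (lower D i) a₁) (midLetter (lower D i) c m₁) (biEval β) p q
  else m p q

theorem csum_append_cons (L : List α → ℤ × A) (Φ : List (ℤ × A) → W) (w : List α) (i : α)
    (w' : List α) :
    csum L Φ (w ++ i :: w') = lsum (splits w) fun p => lsum (splits w') fun q =>
      csum L (fun y => csum L (fun z => Φ (y ++ L (p.2 ++ i :: q.1) :: z)) q.2) p.1 := by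
  rw [csum, lsum_cuts_append_cons]
  simp only [csum, List.map_append, List.map_cons]

variable {μ : ∀ k, MultilinearMap R (fun _ : Fin k => A) A} {β : ∀ k l, BiMultilinear R A M M k l}
  {D : α → ℤ} {i c o : α} {a a₁ : List α → A} {m m₁ n n₁ : List α → List α → M}

theorem csum_gaugeA_of_notMem (Φ : List (ℤ × A) → W) {w : List α} (hi : i ∉ w) :
    csum (letter D (gaugeA μ D i a a₁)) Φ w = csum (letter D a) Φ w :=
  csum_congr Φ fun b hb _ => by rw [letter, letter, gaugeA, if_neg fun h => hi (hb.subset h)]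

theorem csum_lower_of_notMem (ha : ∀ b, i ∉ b → a₁ b = a b) (Φ : List (ℤ × A) → W) {w : List α}
    (hi : i ∉ w) : csum (letter (lower D i) a₁) Φ w = csum (letter D a) Φ w :=
  csum_congr Φ fun b hb _ => by
    have h : i ∉ b := fun h => hi (hb.subset h)
    rw [letter, letter, ha b h, wt_lower_of_notMem h]

theorem mark_lower_of_notMem (ha : ∀ b, i ∉ b → a₁ b = a b) {Φ : List (ℤ × A) → W}
    (hΦ : LetterAdditive Φ) {w : List α} (hi : i ∉ w)
    (h : ∀ b, b <:+: w → csum (letter D a) (opEval μ) b = 0) :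
    mark (lower D i) a₁ μ Φ w = 0 :=
  mark_eq_zero hΦ fun b hb => by
    rw [csum_lower_of_notMem ha _ fun h' => hi (hb.subset h'), h b hb]

/-- The position i occurs at most once, so at most one block of each cutting is altered and the
change is exactly linear. The altered block carries the sum of μ over the cuttings of `a₁`, which is
what `mark` records. -/
theorem csum_gaugeA (ha : ∀ b, i ∉ b → a₁ b = a b) {Φ : List (ℤ × A) → W}
    (hΦ : LetterAdditive Φ) {w : List α} (hw : w.Nodup)
    (h : ∀ b, b <:+: w → csum (letter D a) (opEval μ) b = 0) :
    csum (letter D (gaugeA μ D i a a₁)) Φ w = csum (letter D a) Φ w +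
      (before D i w).negOnePow • mark (lower D i) a₁ μ Φ w := by
  by_cases hi : i ∈ w
  swap
  · rw [csum_gaugeA_of_notMem Φ hi, mark_lower_of_notMem ha hΦ hi h, smul_zero, add_zero]
  obtain ⟨w₁, w₂, rfl⟩ := List.append_of_mem hi
  have h1 : i ∉ w₁ := fun hp => (List.nodup_append.1 hw).2.2 i hp i (by simp) rfl
  have h2 : i ∉ w₂ := (List.nodup_cons.1 (List.nodup_append.1 hw).2.1).1
  -- Only marked blocks containing i survive: elsewhere `a₁` agrees with `a`, whose Maurer-Cartan
  -- sums vanish. The remaining terms match the cuttings according to their block around i.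
  rw [csum_append_cons, csum_append_cons, mark, lsum_splits_splits_of_mem w₁ i w₂ h1 h2
    (fun x b z => (wt (lower D i) x).negOnePow • csum (letter (lower D i) a₁) (fun y =>
      csum (letter (lower D i) a₁) (fun z => Φ (y ++ (wt (lower D i) b + 1,
        csum (letter (lower D i) a₁) (opEval μ) b) :: z)) z) x), ← lsum_smul, ← lsum_add]
  · refine lsum_congr fun p hp => ?_
    rw [← lsum_smul, ← lsum_add]
    refine lsum_congr fun q hq => ?_
    have hp' := mem_splits.1 hp
    have hq' := mem_splits.1 hq
    have hp1 : i ∉ p.1 := fun h' => h1 (by simp [← hp', h'])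
    have hp2 : i ∉ p.2 := fun h' => h1 (by simp [← hp', h'])
    have hq2 : i ∉ q.2 := fun h' => h2 (by simp [← hq', h'])
    have hb : i ∈ p.2 ++ i :: q.1 := by simp
    have hbn : (p.2 ++ i :: q.1).Nodup := by
      refine hw.sublist ?_
      rw [← hp', ← hq', List.append_assoc]
      refine List.Sublist.trans ?_ (List.sublist_append_right _ _)
      exact List.Sublist.append_left ((List.sublist_append_left _ _).cons_cons _) _
    rw [csum_gaugeA_of_notMem _ hp1, csum_lower_of_notMem ha _ hp1, smul_smul, ← Int.negOnePow_add,
      ← csum_smul, ← csum_add]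
    refine congrArg (fun F => csum (letter D a) F p.1) (funext fun y => ?_)
    rw [csum_gaugeA_of_notMem _ hq2, csum_lower_of_notMem ha _ hq2, ← csum_smul, ← csum_add]
    refine congrArg (fun F => csum (letter D a) F q.2) (funext fun z => ?_)
    obtain ⟨φ, hφ⟩ := hΦ y (wt D (p.2 ++ i :: q.1)) z
    rw [letter, letter, wt_lower_of_mem hb hbn, sub_add_cancel, hφ, hφ, hφ, gaugeA, if_pos hb,
      map_add, Units.smul_def, map_zsmul, Units.smul_def]
    congr 3
    rw [Int.negOnePow_eq_iff, wt_lower_of_notMem hp1, before_append_of_notMem hp2,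
      before_append_of_notMem h1, before_cons_self, before_cons_self, ← wt_splits hp]
    exact ⟨-wt D p.1, by ring⟩
  · intro x b z hxbz hib
    have hb : b <:+: w₁ ++ i :: w₂ := ⟨x, z, hxbz⟩
    rw [csum_lower_of_notMem ha (opEval μ) hib, h b hb]
    simp only [hΦ.zero, csum_zero, smul_zero]

theorem midLetter_lower_of_notMem (hm : ∀ p q, i ∉ p ++ c :: q → m₁ p q = m p q) {p q : List α}
    (hi : i ∉ p ++ c :: q) : midLetter (lower D i) c m₁ p q = midLetter D c m p q := by
  have hc : c ≠ i := fun h => hi (by simp [h])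
  rw [midLetter, midLetter, hm p q hi, lower_of_ne hc,
    wt_lower_of_notMem fun h => hi (by simp [h]), wt_lower_of_notMem fun h => hi (by simp [h])]

theorem notMem_of_suffix_prefix {u v p q : List α} (hp : p <:+ u) (hq : q <+: v)
    (hi : i ∉ u ++ c :: v) : i ∉ p ++ c :: q := by
  intro h
  rw [List.mem_append, List.mem_cons] at h hi
  rcases h with h | h | h
  · exact hi (Or.inl (hp.subset h))
  · exact hi (Or.inr (Or.inl h))
  · exact hi (Or.inr (Or.inr (hq.subset h)))

theorem bsum_lower_of_notMem (ha : ∀ b, i ∉ b → a₁ b = a b)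
    (hm : ∀ p q, i ∉ p ++ c :: q → m₁ p q = m p q)
    (Φ : List (ℤ × A) → ℤ × M → List (ℤ × A) → W) {u v : List α} (hi : i ∉ u ++ c :: v) :
    bsum (letter (lower D i) a₁) (midLetter (lower D i) c m₁) Φ u v =
      bsum (letter D a) (midLetter D c m) Φ u v := by
  have hL : ∀ b, i ∉ b → letter (lower D i) a₁ b = letter D a b := fun b hb => by
    rw [letter, letter, ha b hb, wt_lower_of_notMem hb]
  refine bsum_congr Φ (fun b hb _ => hL b fun h => hi ?_) (fun b hb _ => hL b fun h => hi ?_)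
    fun p q hp hq => midLetter_lower_of_notMem hm (notMem_of_suffix_prefix hp hq hi)
  · simp [hb.subset h]
  · simp [hb.subset h]

/-- The linearity argument of `csum_gaugeA` with a module entry: the one altered block may be the
module block or lie on either side of it. -/
theorem bsum_gauge (ha : ∀ b, i ∉ b → a₁ b = a b)
    (hm : ∀ p q, i ∉ p ++ c :: q → m₁ p q = m p q)
    {Φ : List (ℤ × A) → ℤ × M → List (ℤ × A) → W} (hΦ : BiAdditive Φ) {u v : List α}
    (hw : (u ++ c :: v).Nodup)
    (hu' : ∀ b, b <:+: u → csum (letter D a) (opEval μ) b = 0)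
    (hv' : ∀ b, b <:+: v → csum (letter D a) (opEval μ) b = 0)
    (hm' : ∀ p q, p <:+ u → q <+: v →
      bsum (letter D a) (midLetter D c m) (biEval β) p q = 0) :
    bsum (letter D (gaugeA μ D i a a₁)) (midLetter D c (gaugeM β D i c a₁ m m₁)) Φ u v =
      bsum (letter D a) (midLetter D c m) Φ u v +
        (before D i (u ++ c :: v)).negOnePow • bmark (lower D i) c a₁ m₁ μ β Φ u v := by
  rw [bmark, bsum, bsum, ← lsum_smul, ← lsum_add]
  refine lsum_congr fun p hp => ?_
  rw [← lsum_smul, ← lsum_add]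
  refine lsum_congr fun q hq => ?_
  have hp' := mem_splits.1 hp
  have hq' := mem_splits.1 hq
  have hpu : ∀ b, b <:+: p.1 → csum (letter D a) (opEval μ) b = 0 := fun b hb =>
    hu' b (hb.trans ⟨[], p.2, by simpa using hp'⟩)
  have hqv : ∀ b, b <:+: q.2 → csum (letter D a) (opEval μ) b = 0 := fun b hb =>
    hv' b (hb.trans ⟨q.1, [], by simpa using hq'⟩)
  have hww : u ++ c :: v = p.1 ++ ((p.2 ++ c :: q.1) ++ q.2) := by
    rw [← hp', ← hq']
    simp
  have hw' := hw
  rw [hww] at hw'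
  obtain ⟨hn1, hn2, hn3⟩ := List.nodup_append.1 hw'
  obtain ⟨hn4, hn5, hn6⟩ := List.nodup_append.1 hn2
  by_cases h2 : i ∈ p.2 ++ c :: q.1
  · have h1 : i ∉ p.1 := fun h => hn3 i h i (List.mem_append_left _ h2) rfl
    have h3 : i ∉ q.2 := fun h => hn6 i h2 i h rfl
    have e1 : ∀ z, mark (lower D i) a₁ μ (fun y =>
        Φ y (midLetter (lower D i) c m₁ p.2 q.1) z) p.1 = 0 := fun z =>
      mark_lower_of_notMem ha (hΦ.left _ _) h1 hpu
    have e3 : ∀ y, mark (lower D i) a₁ μ (fun z =>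
        Φ y (midLetter (lower D i) c m₁ p.2 q.1) z) q.2 = 0 := fun y =>
      mark_lower_of_notMem ha (hΦ.right _ _) h3 hqv
    simp only [e1, e3, csum_zero, smul_zero, add_zero, zero_add]
    rw [csum_gaugeA_of_notMem _ h1, csum_lower_of_notMem ha _ h1, smul_smul, ← Int.negOnePow_add,
      ← csum_smul, ← csum_add]
    refine congrArg (fun F => csum (letter D a) F p.1) (funext fun y => ?_)
    rw [csum_gaugeA_of_notMem _ h3, csum_lower_of_notMem ha _ h3, ← csum_smul, ← csum_add]
    refine congrArg (fun F => csum (letter D a) F q.2) (funext fun z => ?_)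
    obtain ⟨φ, hφ⟩ := hΦ.mid y (wt D p.2 + D c + wt D q.1) z
    have hd : wt (lower D i) p.2 + lower D i c + wt (lower D i) q.1 + 1 =
        wt D p.2 + D c + wt D q.1 := by
      have := wt_lower_of_mem (D := D) h2 hn4
      simp only [wt_append, wt_cons] at this
      linarith
    rw [midLetter, midLetter, hd, hφ, hφ, hφ, gaugeM, if_pos h2, map_add, Units.smul_def,
      map_zsmul, Units.smul_def]
    congr 3
    rw [Int.negOnePow_eq_iff, wt_lower_of_notMem h1, hww, before_append_of_notMem h1,
      before_append_of_mem h2]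
    exact ⟨-wt D p.1, by ring⟩
  · have e2 : bsum (letter (lower D i) a₁) (midLetter (lower D i) c m₁) (biEval β) p.2 q.1 = 0 := by
      rw [bsum_lower_of_notMem ha hm _ h2, hm' _ _ ⟨_, hp'⟩ ⟨_, hq'⟩]
    have hmid : midLetter D c (gaugeM β D i c a₁ m m₁) p.2 q.1 = midLetter D c m p.2 q.1 := by
      rw [midLetter, midLetter, gaugeM, if_neg h2]
    rw [e2, hmid, midLetter_lower_of_notMem hm h2]
    simp only [hΦ.mid_zero, csum_zero, smul_zero, add_zero]
    by_cases h1 : i ∈ p.1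
    · have h3 : i ∉ q.2 := fun h => hn3 i h1 i (List.mem_append_right _ h) rfl
      have e3 : ∀ y, mark (lower D i) a₁ μ (fun z =>
          Φ y (midLetter D c m p.2 q.1) z) q.2 = 0 := fun y =>
        mark_lower_of_notMem ha (hΦ.right _ _) h3 hqv
      simp only [e3, csum_zero, smul_zero, add_zero]
      rw [csum_comm, csum_comm (letter D a), csum_gaugeA_of_notMem _ h3,
        csum_lower_of_notMem ha _ h3, ← csum_smul, ← csum_add]
      refine congrArg (fun F => csum (letter D a) F q.2) (funext fun z => ?_)
      rw [csum_gaugeA ha (hΦ.left _ _) hn1 hpu, hww, before_append_of_mem h1]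
    · have e1 : ∀ z, mark (lower D i) a₁ μ (fun y =>
          Φ y (midLetter D c m p.2 q.1) z) p.1 = 0 := fun z =>
        mark_lower_of_notMem ha (hΦ.left _ _) h1 hpu
      simp only [e1, csum_zero, zero_add]
      rw [csum_gaugeA_of_notMem _ h1, csum_lower_of_notMem ha _ h1, smul_smul,
        ← Int.negOnePow_add, ← csum_smul, ← csum_add]
      refine congrArg (fun F => csum (letter D a) F p.1) (funext fun y => ?_)
      -- No case distinction on i ∈ q.2 is required: `csum_gaugeA` also covers words without i.
      rw [csum_gaugeA ha (hΦ.right _ _) hn5 hqv]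
      congr 2
      rw [Int.negOnePow_eq_iff, hww, before_append_of_notMem h1, before_append_of_notMem h2,
        ← wt_splits hp, wt_append, wt_cons,
        wt_lower_of_notMem h1, wt_lower_of_notMem fun h => h2 (List.mem_append_left _ h),
        lower_of_ne fun h => h2 (by simp [h]),
        wt_lower_of_notMem fun h => h2 (by simp [h])]
      exact ⟨-(wt D p.1 + wt D p.2 + D c + wt D q.1), by ring⟩

/-- Again exactly one block of a cutting of the cyclic word contains i, now possibly the block
around o. The first order change is the marked sum `ipmark`, formed with the degree at i lowered by
one. -/
theorem ipsum_gauge {P : Bimod X ℳ} {u v : List α} (h : IsSystem P D c o u v a m n)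
    (ha : ∀ b, i ∉ b → a₁ b = a b) (hm : ∀ p q, i ∉ p ++ c :: q → m₁ p q = m p q)
    (hn : ∀ q p, i ∉ q ++ o :: p → n₁ q p = n q p)
    (hw : (u ++ c :: (v ++ [o])).Nodup) (hi : i ∈ u ++ c :: (v ++ [o]))
    {e : ℤ} (I : BiFamily 𝒜 ℳ (dualGrading ℳ) e) :
    ipsum D c o (gaugeA X.mu D i a a₁) (gaugeM P.map D i c a₁ m m₁) (gaugeM P.map D i o a₁ n n₁)
        (ipEval I) u v =
      ipsum D c o a m n (ipEval I) u v + (before D i (u ++ c :: (v ++ [o]))).negOnePow •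
        ipmark P (lower D i) c o a₁ m₁ n₁ I u v := by
  rw [ipmark, ipsum, ipsum, ← lsum_smul, ← lsum_add]
  refine lsum_congr fun s hs => ?_
  rw [← lsum_smul, ← lsum_add]
  refine lsum_congr fun r hr => ?_
  have hs' := mem_splits.1 hs
  have hr' := mem_splits.1 hr
  have hs2 : s.2 <:+ u := ⟨_, hs'⟩
  have hr1 : r.1 <+: v := ⟨_, hr'⟩
  have hww : u ++ c :: (v ++ [o]) = s.1 ++ ((s.2 ++ c :: r.1) ++ (r.2 ++ [o])) := by
    rw [← hs', ← hr']
    simp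
  have hw' := hw
  rw [hww] at hw' hi
  obtain ⟨hn1, hn2, hn3⟩ := List.nodup_append.1 hw'
  obtain ⟨hn4, hn5, hn6⟩ := List.nodup_append.1 hn2
  rw [bsum_gauge ha hm (biAdditive_ipEval I _) hn4
    (fun b hb => h.left_eq b (hb.trans hs2.isInfix))
    (fun b hb => h.right_eq b (hb.trans hr1.isInfix))
    (fun p q hp hq => h.mid_eq p q (hp.trans hs2) (hq.trans hr1))]
  -- If i lies in the block around o, every mark on the side of c vanishes; otherwise the mark
  -- around o does.
  by_cases h3 : i ∈ r.2 ++ o :: s.1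
  · have h2 : i ∉ s.2 ++ c :: r.1 := by
      intro h2
      rcases List.mem_append.1 h3 with h | h
      · exact hn6 i h2 i (by simp [h]) rfl
      · rcases List.mem_cons.1 h with h | h
        · exact hn6 i h2 i (by simp [h]) rfl
        · exact hn3 i h i (List.mem_append_left _ h2) rfl
    have e2 : ∀ t, bmark (lower D i) c a₁ m₁ X.mu P.map (fun y x z => ipEval I y x z t)
        s.2 r.1 = 0 := by
      intro t
      refine bmark_eq_zero (biAdditive_ipEval I t) (fun b hb => ?_) (fun b hb => ?_)
        fun p q hp hq => ?_
      · rw [csum_lower_of_notMem ha _ fun h' => h2 (by simp [hb.subset h']),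
          h.left_eq b (hb.trans hs2.isInfix)]
      · rw [csum_lower_of_notMem ha _ fun h' => h2 (by simp [hb.subset h']),
          h.right_eq b (hb.trans hr1.isInfix)]
      · rw [bsum_lower_of_notMem ha hm _ (notMem_of_suffix_prefix hp hq h2),
          h.mid_eq p q (hp.trans hs2) (hq.trans hr1)]
    have hnd : (r.2 ++ o :: s.1).Nodup := by
      have h5 : ((s.1 ++ (s.2 ++ c :: r.1)) ++ (r.2 ++ [o])).Nodup := by simpa using hw'
      -- Rotating the cyclic word makes the block around o contiguous, from which it inherits
      -- distinct positions.
      have h6 : ((r.2 ++ [o]) ++ (s.1 ++ (s.2 ++ c :: r.1))).Nodup := List.nodup_append_comm.1 h5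
      refine h6.sublist ?_
      rw [List.append_assoc]
      exact List.Sublist.append_left ((List.sublist_append_left _ _).cons_cons _) _
    have hd : wt (lower D i) r.2 + lower D i o + wt (lower D i) s.1 + 1 =
        wt D r.2 + D o + wt D s.1 := by
      have := wt_lower_of_mem (D := D) h3 hnd
      simp only [wt_append, wt_cons] at this
      linarith
    rw [e2, e2, smul_zero, add_zero, zero_add, bsum_lower_of_notMem ha hm _ h2, hd, smul_smul,
      smul_smul, ← Int.negOnePow_add, ← Int.negOnePow_add]
    have e3 : ∀ y x z, ipEval I y x z (midLetter D o (gaugeM P.map D i o a₁ n n₁) r.2 s.1) =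
        ipEval I y x z (midLetter D o n r.2 s.1) +
          (before D i (r.2 ++ o :: s.1)).negOnePow • ipEval I y x z (wt D r.2 + D o + wt D s.1,
            bsum (letter (lower D i) a₁) (midLetter (lower D i) o n₁) (biEval P.map) r.2 s.1) := by
      intro y x z
      obtain ⟨φ, hφ⟩ := ipEval_snd_additive I y x z (wt D r.2 + D o + wt D s.1)
      rw [midLetter, midLetter, hφ, hφ, hφ, gaugeM, if_pos h3, map_add, Units.smul_def,
        map_zsmul, Units.smul_def]
    simp only [e3]
    rw [bsum_add, bsum_smul, smul_add, smul_smul, ← Int.negOnePow_add]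
    congr 2
    rw [Int.negOnePow_eq_iff, hww, wt_lower_of_notMem fun h' => h2 (List.mem_append_left _ h'),
      lower_of_ne (x := c) fun h' => h2 (by simp [h']),
      wt_lower_of_notMem (w := r.1) fun h' => h2 (by simp [h']), ← wt_splits hr, ← wt_splits hr,
      wt_lower_of_notMem (w := r.1) fun h' => h2 (by simp [h'])]
    -- If i lies in the part moved to the end, lowering its degree changes the weight of the moved
    -- part; otherwise it changes the weight of what is passed. The two sign checks differ
    -- accordingly.
    by_cases h1 : i ∈ s.1
    · have h4 : i ∉ r.2 ++ [o] := fun h' => hn3 i h1 i (List.mem_append_right _ h') rfl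
      rw [show r.2 ++ o :: s.1 = (r.2 ++ [o]) ++ s.1 by simp, before_append_of_notMem h4,
        before_append_of_mem h1, wt_lower_of_mem h1 hn1,
        wt_lower_of_notMem fun h' => h4 (by simp [h']), lower_of_ne fun h' => h4 (by simp [h']),
        wt_append, wt_cons, wt_nil]
      exact ⟨wt D r.2 + D o, by ring⟩
    · have h4 : i ∈ r.2 ++ [o] := by
        simp only [List.mem_append, List.mem_cons, List.not_mem_nil, or_false] at h3 ⊢
        tauto
      rw [show r.2 ++ o :: s.1 = (r.2 ++ [o]) ++ s.1 by simp, before_append_of_mem h4,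
        before_append_of_notMem h1, before_append_of_notMem h2]
      have hd2 : lower D i o = wt D r.2 + D o - 1 - wt (lower D i) r.2 := by
        have := wt_lower_of_mem (D := D) h4 hn5
        simp only [wt_append, wt_cons, wt_nil] at this
        linarith
      rw [wt_lower_of_notMem h1, hd2, wt_append, wt_cons]
      exact ⟨-(wt D s.2 + D c + wt D r.1), by ring⟩
  · have h2 : i ∈ s.2 ++ c :: r.1 := by
      simp only [List.mem_append, List.mem_cons, List.not_mem_nil, or_false] at h3 hi ⊢
      tauto
    have h1 : i ∉ s.1 := fun h' => hn3 i h' i (List.mem_append_left _ h2) rfl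
    have e1 : midLetter D o (gaugeM P.map D i o a₁ n n₁) r.2 s.1 = midLetter D o n r.2 s.1 := by
      rw [midLetter, midLetter, gaugeM, if_neg h3]
    have e2 : bsum (letter (lower D i) a₁) (midLetter (lower D i) o n₁) (biEval P.map)
        r.2 s.1 = 0 := by
      rw [bsum_lower_of_notMem ha hn _ h3, h.out_eq _ _ ⟨_, hr'⟩ ⟨_, hs'⟩]
    have e3 : ∀ y x z, ipEval I y x z
        (wt (lower D i) r.2 + lower D i o + wt (lower D i) s.1 + 1, 0) = 0 := by
      intro y x z
      simp [ipEval, pair]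
    rw [e1, e2, midLetter_lower_of_notMem hn h3]
    simp only [e3, bsum_zero, smul_zero, add_zero]
    rw [smul_add, smul_smul, smul_smul, ← Int.negOnePow_add, ← Int.negOnePow_add]
    congr 2
    have h4 : i ∉ r.2 ++ [o] := fun h' => hn6 i h2 i h' rfl
    have hd : lower D i c = wt D s.2 + D c + wt D r.1 - 1 - wt (lower D i) s.2 -
        wt (lower D i) r.1 := by
      have := wt_lower_of_mem (D := D) h2 hn4
      simp only [wt_append, wt_cons] at this
      linarith
    rw [Int.negOnePow_eq_iff, hww, before_append_of_notMem h1, before_append_of_mem h2,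
      wt_lower_of_notMem h1, ← wt_splits hr, ← wt_splits hr, hd,
      wt_lower_of_notMem (w := r.2) fun h' => h4 (by simp [h']),
      lower_of_ne (x := o) fun h' => h4 (by simp [h'])]
    exact ⟨0, by ring⟩

/-- Changing the entry at the position `i` by a coboundary, the other diagonal entries and the
staircase inner product remaining the same. -/
theorem IsSystem.gauge {P : Bimod X ℳ} {u v : List α} (h : IsSystem P D c o u v a m n)
    (hw : (u ++ c :: (v ++ [o])).Nodup) (hi : i ∈ u ++ c :: (v ++ [o])) {x : A}
    (hx : x ∈ 𝒜 (D i)) {y : M} (hy : y ∈ ℳ (D i)) :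
    ∃ a' m' n', IsSystem P D c o u v a' m' n' ∧
      (∀ k, a' [k] = a [k] + if k = i then X.d x else 0) ∧
      (m' [] [] = m [] [] + if c = i then P.d y else 0) ∧
      (n' [] [] = n [] [] + if o = i then P.d y else 0) ∧
      ∀ {e : ℤ} (I : InnerProd P e), ipsum D c o a' m' n' (ipEval I.toBiFamily) u v =
        ipsum D c o a m n (ipEval I.toBiFamily) u v := by
  -- The auxiliary system has the primitive at position i, zero on longer blocks through i, and the
  -- old entries elsewhere. It only needs to be graded; no Maurer-Cartan equation is asked of it.
  let a₁ : List α → A := fun b => if i ∈ b then (if b = [i] then x else 0) else a b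
  let m₁ : List α → List α → M := fun p q =>
    if i ∈ p ++ c :: q then (if p = [] ∧ q = [] then y else 0) else m p q
  let n₁ : List α → List α → M := fun p q =>
    if i ∈ p ++ o :: q then (if p = [] ∧ q = [] then y else 0) else n p q
  have ha : ∀ b, i ∉ b → a₁ b = a b := fun b hb => if_neg hb
  have hm : ∀ p q, i ∉ p ++ c :: q → m₁ p q = m p q := fun p q hb => if_neg hb
  have hn : ∀ q p, i ∉ q ++ o :: p → n₁ q p = n q p := fun p q hb => if_neg hb
  have hwuc : (u ++ c :: v).Nodup := by
    refine hw.sublist (List.Sublist.append_left (List.Sublist.cons_cons _ ?_) _)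
    exact List.sublist_append_left _ _
  have hwvo : (v ++ o :: u).Nodup := by
    have h5 : ((u ++ [c]) ++ (v ++ [o])).Nodup := by simpa using hw
    have h6 : ((v ++ [o]) ++ (u ++ [c])).Nodup := List.nodup_append_comm.1 h5
    refine h6.sublist ?_
    rw [List.append_assoc]
    exact List.Sublist.append_left ((List.sublist_append_left _ _).cons_cons _) _
  have hwu : u.Nodup := (List.nodup_append.1 hwuc).1
  have hwv : v.Nodup := (List.nodup_append.1 hwvo).1
  have hL : ∀ b, (b ≠ [] → IsHomog 𝒜 (letter D a b)) → b ≠ [] →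
      IsHomog 𝒜 (letter (lower D i) a₁ b) := by
    intro b hb hb0
    by_cases hib : i ∈ b
    · simp only [IsHomog, letter, a₁, if_pos hib]
      split_ifs with hb1
      · rw [hb1, wt_cons, wt_nil, lower_self]
        convert hx using 2
        ring
      · exact zero_mem _
    · rw [letter, ha b hib, wt_lower_of_notMem hib]
      exact hb hb0
  have hM : ∀ c m p q, IsHomog ℳ (midLetter D c m p q) →
      IsHomog ℳ (midLetter (lower D i) c (fun p q => if i ∈ p ++ c :: q then
        (if p = [] ∧ q = [] then y else 0) else m p q) p q) := by
    intro c m p q hpq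
    by_cases hib : i ∈ p ++ c :: q
    · simp only [IsHomog, midLetter, if_pos hib]
      split_ifs with hb1
      · obtain ⟨rfl, rfl⟩ := hb1
        have hc : c = i := by simpa [eq_comm] using hib
        rw [wt_nil, hc, lower_self]
        convert hy using 2
        ring
      · exact zero_mem _
    · rw [midLetter_lower_of_notMem (fun p q hb => if_neg hb) hib]
      exact hpq
  have h₁ : IsGradedSystem 𝒜 ℳ (lower D i) c o u v a₁ m₁ n₁ :=
    ⟨fun b hb => hL b (h.left b hb), fun b hb => hL b (h.right b hb),
      fun p q hp hq => hM c m p q (h.mid p q hp hq),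
      fun q p hq hp => hM o n q p (h.out q p hq hp)⟩
  have hA : ∀ w : List α, w.Nodup → (∀ b, b <:+: w → b ≠ [] → IsHomog 𝒜 (letter D a b)) →
      (∀ b, b <:+: w → b ≠ [] → IsHomog 𝒜 (letter (lower D i) a₁ b)) → w ≠ [] →
      IsHomog 𝒜 (letter D (gaugeA X.mu D i a a₁) w) := by
    intro w hwn hw1 hw2 hw0
    by_cases hiw : i ∈ w
    · rw [IsHomog, letter, gaugeA, if_pos hiw]
      refine add_mem (hw1 w List.infix_rfl hw0) (units_smul_mem _ _ ?_)
      have := isHomog_csum hw2 fun y hy => X.isHomog_opLetter hy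
      rwa [wt_lower_of_mem hiw hwn, sub_add_cancel] at this
    · rw [letter, gaugeA, if_neg hiw]
      exact hw1 w List.infix_rfl hw0
  have hB : ∀ (c : α) (m m₁ : List α → List α → M) (p q : List α), (p ++ c :: q).Nodup →
      IsHomog ℳ (midLetter D c m p q) →
      (∀ b, b <:+: p → b ≠ [] → IsHomog 𝒜 (letter (lower D i) a₁ b)) →
      (∀ b, b <:+: q → b ≠ [] → IsHomog 𝒜 (letter (lower D i) a₁ b)) →
      (∀ p' q', p' <:+ p → q' <+: q → IsHomog ℳ (midLetter (lower D i) c m₁ p' q')) →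
      IsHomog ℳ (midLetter D c (gaugeM P.map D i c a₁ m m₁) p q) := by
    intro c m m₁ p q hpq h1 h2 h3 h4
    by_cases hiw : i ∈ p ++ c :: q
    · rw [IsHomog, midLetter, gaugeM, if_pos hiw]
      refine add_mem h1 (units_smul_mem _ _ ?_)
      have := isHomog_bsum h2 h3 h4 P.toBiFamily
      convert this using 2
      have hd := wt_lower_of_mem (D := D) hiw hpq
      simp only [wt_append, wt_cons] at hd
      linarith
    · rw [midLetter, gaugeM, if_neg hiw]
      exact h1
  have hC : ∀ w : List α, w.Nodup → (∀ b, b <:+: w → csum (letter D a) (opEval X.mu) b = 0) →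
      (∀ b, b <:+: w → b ≠ [] → IsHomog 𝒜 (letter (lower D i) a₁ b)) →
      csum (letter D (gaugeA X.mu D i a a₁)) (opEval X.mu) w = 0 := by
    intro w hwn hw1 hw2
    -- Read backwards, `csum_precomp` identifies the change of the Maurer-Cartan sum with the sum of
    -- μ² over cuttings of `a₁`, which is zero term by term.
    have h2 : mark (lower D i) a₁ X.mu (opEval X.mu) w = 0 := by
      refine (csum_precomp _ a₁ X.mu (letterAdditive_opEval _) w).symm.trans ?_
      exact (csum_congr_homog hw2 fun y hy => X.rel y hy).trans (csum_zero _ _)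
    rw [csum_gaugeA ha (letterAdditive_opEval _) hwn hw1, hw1 w List.infix_rfl, h2, smul_zero,
      add_zero]
  have hE : ∀ (c : α) (m m₁ : List α → List α → M) (p q : List α), (p ++ c :: q).Nodup →
      (∀ p q, i ∉ p ++ c :: q → m₁ p q = m p q) →
      (∀ b, b <:+: p → csum (letter D a) (opEval X.mu) b = 0) →
      (∀ b, b <:+: q → csum (letter D a) (opEval X.mu) b = 0) →
      (∀ p' q', p' <:+ p → q' <+: q →
        bsum (letter D a) (midLetter D c m) (biEval P.map) p' q' = 0) →
      (∀ b, b <:+: p → b ≠ [] → IsHomog 𝒜 (letter (lower D i) a₁ b)) →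
      (∀ b, b <:+: q → b ≠ [] → IsHomog 𝒜 (letter (lower D i) a₁ b)) →
      (∀ p' q', p' <:+ p → q' <+: q → IsHomog ℳ (midLetter (lower D i) c m₁ p' q')) →
      bsum (letter D (gaugeA X.mu D i a a₁)) (midLetter D c (gaugeM P.map D i c a₁ m m₁))
        (biEval P.map) p q = 0 := by
    intro c m m₁ p q hpq hmm hp hq hpq' hp1 hq1 hpq1
    -- The same for the module entries, using β² = 0.
    have h2 : bmark (lower D i) c a₁ m₁ X.mu P.map (biEval P.map) p q = 0 := by
      refine (bsum_precomp _ c a₁ m₁ X.mu P.map (biAdditive_biEval _) p q).symm.trans ?_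
      exact (bsum_congr_homog hp1 hq1 hpq1 fun y x z hy hx hz => P.rel y x z hy hx hz).trans
        (bsum_zero _ _ _ _)
    rw [bsum_gauge ha hmm (biAdditive_biEval _) hpq hp hq hpq',
      hpq' p q List.suffix_rfl List.prefix_rfl, h2, smul_zero, add_zero]
  have hsub : ∀ {u v p q : List α} {c : α}, (u ++ c :: v).Nodup → p <:+ u → q <+: v →
      (p ++ c :: q).Nodup := fun hw hp hq =>
    hw.sublist (hp.sublist.append (hq.sublist.cons_cons _))
  refine ⟨gaugeA X.mu D i a a₁, gaugeM P.map D i c a₁ m m₁, gaugeM P.map D i o a₁ n n₁,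
    ⟨⟨fun b hb => hA b (hwu.sublist hb.sublist) (fun b' hb' => h.left b' (hb'.trans hb))
        fun b' hb' => h₁.left b' (hb'.trans hb),
      fun b hb => hA b (hwv.sublist hb.sublist) (fun b' hb' => h.right b' (hb'.trans hb))
        fun b' hb' => h₁.right b' (hb'.trans hb),
      fun p q hp hq => hB c m m₁ p q (hsub hwuc hp hq) (h.mid p q hp hq)
        (fun b hb => h₁.left b (hb.trans hp.isInfix)) (fun b hb => h₁.right b (hb.trans hq.isInfix))
        fun p' q' hp' hq' => h₁.mid p' q' (hp'.trans hp) (hq'.trans hq),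
      fun q p hq hp => hB o n n₁ q p (hsub hwvo hq hp) (h.out q p hq hp)
        (fun b hb => h₁.right b (hb.trans hq.isInfix)) (fun b hb => h₁.left b (hb.trans hp.isInfix))
        fun q' p' hq' hp' => h₁.out q' p' (hq'.trans hq) (hp'.trans hp)⟩,
      fun b hb => hC b (hwu.sublist hb.sublist) (fun b' hb' => h.left_eq b' (hb'.trans hb))
        fun b' hb' => h₁.left b' (hb'.trans hb),
      fun b hb => hC b (hwv.sublist hb.sublist) (fun b' hb' => h.right_eq b' (hb'.trans hb))
        fun b' hb' => h₁.right b' (hb'.trans hb),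
      fun p q hp hq => hE c m m₁ p q (hsub hwuc hp hq) hm
        (fun b hb => h.left_eq b (hb.trans hp.isInfix))
        (fun b hb => h.right_eq b (hb.trans hq.isInfix))
        (fun p' q' hp' hq' => h.mid_eq p' q' (hp'.trans hp) (hq'.trans hq))
        (fun b hb => h₁.left b (hb.trans hp.isInfix)) (fun b hb => h₁.right b (hb.trans hq.isInfix))
        fun p' q' hp' hq' => h₁.mid p' q' (hp'.trans hp) (hq'.trans hq),
      fun q p hq hp => hE o n n₁ q p (hsub hwvo hq hp) hn
        (fun b hb => h.right_eq b (hb.trans hq.isInfix))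
        (fun b hb => h.left_eq b (hb.trans hp.isInfix))
        (fun q' p' hq' hp' => h.out_eq q' p' (hq'.trans hq) (hp'.trans hp))
        (fun b hb => h₁.right b (hb.trans hq.isInfix)) (fun b hb => h₁.left b (hb.trans hp.isInfix))
        fun q' p' hq' hp' => h₁.out q' p' (hq'.trans hq) (hp'.trans hp)⟩, ?_, ?_, ?_, ?_⟩
  · intro k
    by_cases hk : k = i
    · subst hk
      rw [gaugeA, if_pos (by simp), if_pos rfl, before_cons_self, Int.negOnePow_zero, one_smul]
      refine congrArg _ ?_
      simp only [csum, cuts, lsum_singleton, List.map_cons, List.map_nil, opEval_single]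
      simp [letter, a₁, Alg.d]
    · rw [gaugeA, if_neg (by simpa [eq_comm] using hk), if_neg hk, add_zero]
  · by_cases hk : c = i
    · subst hk
      rw [gaugeM, if_pos (by simp), if_pos rfl, List.nil_append, before_cons_self,
        Int.negOnePow_zero, one_smul]
      refine congrArg _ ?_
      simp only [bsum, splits, lsum_singleton, csum_nil, biEval_nil]
      simp [midLetter, m₁, Bimod.d]
    · rw [gaugeM, if_neg (by simpa [eq_comm] using hk), if_neg hk, add_zero]
  · by_cases hk : o = i
    · subst hk
      rw [gaugeM, if_pos (by simp), if_pos rfl, List.nil_append, before_cons_self,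
        Int.negOnePow_zero, one_smul]
      refine congrArg _ ?_
      simp only [bsum, splits, lsum_singleton, csum_nil, biEval_nil]
      simp [midLetter, n₁, Bimod.d]
    · rw [gaugeM, if_neg (by simpa [eq_comm] using hk), if_neg hk, add_zero]
  · intro e I
    -- The change of the value is the staircase sum of δ(I) over the auxiliary system. It vanishes
    -- because δ(I) = 0 on all homogeneous arguments.
    rw [ipsum_gauge h ha hm hn hw hi I.toBiFamily, ← ipsum_deltaEval,
      h₁.ipsum_congr (Φ' := fun _ _ _ _ => 0) fun y x z t hy hx hz ht =>
        I.rel y x z t hy hx hz ht]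
    simp only [ipsum, bsum_zero, smul_zero, lsum_zero, add_zero]

end Gauge

/-! ### Cyclic defining systems as systems on a cyclic word -/

section Bridge

variable {R A M N W : Type*} [CommRing R] [AddCommGroup A] [Module R A]
  [AddCommGroup M] [Module R M] [AddCommGroup N] [Module R N] [AddCommGroup W]
  {𝒜 : ℤ → Submodule R A} {ℳ : ℤ → Submodule R M} {X : Alg 𝒜}

theorem lsum_filter {β : Type*} (l : List β) (p : β → Bool) (φ : β → W) :
    lsum (l.filter p) φ = lsum l fun x => if p x then φ x else 0 := by
  induction l with
  | nil => rfl
  | cons x l ih =>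
    rw [List.filter_cons, lsum_cons, ← ih]
    split_ifs <;> simp [lsum_cons]

theorem csum_map {α β : Type*} (L : List β → ℤ × A) (Φ : List (ℤ × A) → W) (g : α → β)
    (w : List α) : csum L Φ (w.map g) = csum (fun b => L (b.map g)) Φ w := by
  simp only [csum, cuts_map, lsum_map, List.map_map, Function.comp_def]

theorem bsum_map_right {α : Type*} {L L' : List α → ℤ × A} {Lm Lm' : List α → List α → ℤ × M}
    {u v : List α} (g : α → α) (Φ : List (ℤ × A) → ℤ × M → List (ℤ × A) → W)
    (hu : ∀ b, b <:+: u → b ≠ [] → L b = L' b)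
    (hv : ∀ b, b <:+: v → b ≠ [] → L (b.map g) = L' b)
    (hm : ∀ p q, p <:+ u → q <+: v → Lm p (q.map g) = Lm' p q) :
    bsum L Lm Φ u (v.map g) = bsum L' Lm' Φ u v := by
  refine lsum_congr fun p hp => ?_
  rw [lsum_splits_map]
  refine lsum_congr fun q hq => ?_
  rw [mem_splits] at hp hq
  rw [hm p.2 q.1 ⟨_, hp⟩ ⟨_, hq⟩, csum_congr _ fun b hb =>
    hu b (hb.trans ⟨[], p.2, by simpa using hp⟩)]
  refine congrArg (fun F => csum L' F p.1) (funext fun y => ?_)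
  rw [csum_map]
  exact csum_congr _ fun b hb => hv b (hb.trans ⟨q.1, [], by simpa using hq⟩)

theorem csum_cons_of_nil {α : Type*} (L : List α → ℤ × A) (x : α) (w : List α) (g : W) :
    csum L (fun y => if y = [] then g else 0) (x :: w) = 0 := by
  refine lsum_eq_zero fun c hc => if_neg fun h => ?_
  have := flatten_of_mem_cuts hc
  rw [List.map_eq_nil_iff.1 h] at this
  simp at this

/-- A non-empty word has no cutting into zero blocks, so only the splitting with empty first part
contributes. -/
theorem lsum_splits_csum_fst {α : Type*} (L : List α → ℤ × A) (g : List α → W) (u : List α) :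
    (lsum (splits u) fun p => csum L (fun y => if y = [] then g p.2 else 0) p.1) = g u := by
  cases u with
  | nil => simp [lsum_splits_nil, csum_nil]
  | cons x u =>
    simp only [lsum_splits_cons, csum_cons_of_nil, lsum_zero, csum_nil, add_zero, if_true]

theorem lsum_splits_csum_snd {α : Type*} (L : List α → ℤ × A) (g : List α → W) (u : List α) :
    (lsum (splits u) fun p => csum L (fun y => if y = [] then g p.1 else 0) p.2) = g u := by
  induction u generalizing g with
  | nil => simp [lsum_splits_nil, csum_nil]
  | cons x u ih =>
    rw [lsum_splits_cons, csum_cons_of_nil, zero_add]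
    exact ih fun b => g (x :: b)

/-- Isolates the trivial cutting, which produces the differential when the operation is μ; the
filtered cuttings are those of the staircase product. -/
theorem csum_eq_add_filter {α : Type*} (L : List α → ℤ × A) (Φ : List (ℤ × A) → W) {w : List α}
    (hw : w ≠ []) : csum L Φ w =
      Φ [L w] + lsum ((cuts w).filter fun c => 2 ≤ c.length) fun c => Φ (c.map L) := by
  obtain ⟨x, w, rfl⟩ := List.exists_cons_of_ne_nil hw
  rw [lsum_filter, csum, lsum_cuts_cons, lsum_cuts_cons,
    ← lsum_splits_csum_snd L (fun b => Φ [L (x :: b)]) w, ← lsum_add]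
  refine lsum_congr fun p _ => ?_
  rw [csum, ← lsum_add]
  refine lsum_congr fun c _ => ?_
  cases c <;> simp

theorem bsum_eq_add_ite {α : Type*} (L : List α → ℤ × A) (Lm : List α → List α → ℤ × M)
    (Φ : List (ℤ × A) → ℤ × M → List (ℤ × A) → W) (u v : List α) :
    bsum L Lm Φ u v = Φ [] (Lm u v) [] +
      bsum L Lm (fun y x z => if 1 ≤ y.length + z.length then Φ y x z else 0) u v := by
  have h1 : ∀ y x z, Φ y x z = (if y = [] then (if z = [] then Φ [] x [] else 0) else 0) +
      if 1 ≤ y.length + z.length then Φ y x z else 0 := by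
    intro y x z
    cases y <;> cases z <;> simp
  have h2 : bsum L Lm (fun y x z => if y = [] then (if z = [] then Φ [] x [] else 0) else 0) u v =
      Φ [] (Lm u v) [] := by
    rw [← lsum_splits_csum_fst L (fun b => Φ [] (Lm b v) []) u]
    refine lsum_congr fun p _ => ?_
    rw [← csum_lsum]
    refine congrArg (fun F => csum L F p.1) (funext fun y => ?_)
    by_cases hy : y = []
    · simp only [hy, if_true]
      exact lsum_splits_csum_snd L (fun b => Φ [] (Lm p.2 b) []) v
    · simp only [hy, if_false, csum_zero, lsum_zero]
  conv_lhs => rw [show Φ = fun y x z => _ from funext fun y => funext fun x => funext (h1 y x)]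
  rw [bsum_add, h2]

theorem exists_of_infix_range' {b : List ℕ} {s n : ℕ} (h : b <:+: List.range' s n) (hb : b ≠ []) :
    ∃ i r, b = List.range' i (r + 1) ∧ s ≤ i ∧ i + r < s + n := by
  obtain ⟨x, z, h⟩ := h
  obtain ⟨k, hk, h1, -⟩ := List.range'_eq_append_iff.1 h.symm
  obtain ⟨j, hj, -, h2⟩ := List.range'_eq_append_iff.1 h1.symm
  rw [mul_one] at h2
  obtain ⟨r, hr⟩ : ∃ r, k - j = r + 1 := Nat.exists_eq_succ_of_ne_zero fun h0 => hb (by simp [h2, h0])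
  exact ⟨s + j, r, by rw [h2, hr], by omega, by omega⟩

theorem range'_append_range' (s a b : ℕ) :
    List.range' s a ++ List.range' (s + a) b = List.range' s (a + b) := by
  simp

theorem infix_range'_of_le {s n i r : ℕ} (h : s ≤ i) (h' : i + r ≤ s + n) :
    List.range' i r <:+: List.range' s n := by
  obtain ⟨j, rfl⟩ := Nat.exists_eq_add_of_le h
  obtain ⟨m, rfl⟩ : ∃ m, n = j + r + m := ⟨n - (j + r), by omega⟩
  exact ⟨List.range' s j, List.range' (s + (j + r)) m, by
    rw [range'_append_range', range'_append_range']⟩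

theorem exists_of_suffix_range' {p : List ℕ} {s n : ℕ} (h : p <:+ List.range' s n) :
    ∃ r ≤ n, p = List.range' (s + n - r) r := by
  obtain ⟨x, h⟩ := h
  obtain ⟨k, hk, -, h1⟩ := List.range'_eq_append_iff.1 h.symm
  exact ⟨n - k, by omega, by rw [h1, mul_one]; congr 1; omega⟩

theorem exists_of_prefix_range' {p : List ℕ} {s n : ℕ} (h : p <+: List.range' s n) :
    ∃ r ≤ n, p = List.range' s r := by
  obtain ⟨x, h⟩ := h
  obtain ⟨k, hk, h1, -⟩ := List.range'_eq_append_iff.1 h.symm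
  exact ⟨k, hk, h1⟩

theorem suffix_range'_of_le {s n r : ℕ} (h : r ≤ n) :
    List.range' (s + n - r) r <:+ List.range' s n := by
  obtain ⟨m, rfl⟩ := Nat.exists_eq_add_of_le' h
  exact ⟨List.range' s m, by
    rw [show s + (m + r) - r = s + m by omega, range'_append_range']⟩

theorem prefix_range'_of_le {s n r : ℕ} (h : r ≤ n) :
    List.range' s r <+: List.range' s n := by
  obtain ⟨m, rfl⟩ := Nat.exists_eq_add_of_le h
  exact ⟨_, range'_append_range' s r m⟩

theorem headI_range' (i r : ℕ) : (List.range' i (r + 1)).headI = i := rfl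

theorem getLastI_range' (i r : ℕ) : (List.range' i (r + 1)).getLastI = i + r := by
  rw [List.getLastI_eq_getLast?_getD, List.getLast?_range']
  simp

theorem wt_range' (D : ℕ → ℤ) (i r : ℕ) :
    wt D (List.range' i (r + 1)) = ∑ t ∈ Finset.Icc i (i + r), D t := by
  induction r with
  | zero => simp
  | succ r ih =>
    rw [← add_assoc, Finset.sum_Icc_succ_top (by omega), ← ih, List.range'_concat, wt_append]
    simp [add_assoc]

theorem range'_append_cons (c r s : ℕ) (h : r ≤ c) :
    List.range' (c - r) r ++ c :: List.range' (c + 1) s = List.range' (c - r) (r + s + 1) := by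
  rw [add_assoc, ← range'_append_range', Nat.sub_add_cancel h, List.range'_succ]

/-- The letter of the block `p ++ c :: q` of a triangular system. -/
def TriSystem.midLetter (D : ℕ → ℤ) (c : ℕ) (x : TriSystem A M) (p q : List ℕ) : ℤ × M :=
  x.mLetter D (p ++ c :: q)

/-- This turns d(x) = -S into the vanishing of a single sum over all cuttings; `stairM_eq` does the
same around the module position. -/
theorem stairA_eq (X : Alg 𝒜) (D : ℕ → ℤ) (x : TriSystem A M) (i r : ℕ) :
    csum (x.aLetter D) (opEval X.mu) (List.range' i (r + 1)) =
      X.d (x.a i (i + r)) + stairA X D x i (i + r) := by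
  rw [csum_eq_add_filter _ _ (by simp), opEval_single, stairA,
    show i + r + 1 - i = r + 1 by omega]
  congr 1
  rw [TriSystem.aLetter, headI_range', getLastI_range']
  rfl

theorem stairM_eq (P : Bimod X ℳ) (D : ℕ → ℤ) (x : TriSystem A M) (c r s : ℕ) (h : r ≤ c) :
    bsum (x.aLetter D) (x.midLetter D c) (biEval P.map) (List.range' (c - r) r)
        (List.range' (c + 1) s) =
      P.d (x.m (c - r) (c + s)) + stairM P D c x (c - r) (c + s) := by
  rw [bsum_eq_add_ite, biEval_nil, stairM, show c - (c - r) = r by omega,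
    show c + s - c = s by omega]
  congr 1
  · rw [TriSystem.midLetter, TriSystem.mLetter, range'_append_cons c r s h, headI_range',
      getLastI_range', show c - r + (r + s) = c + s by omega]
    rfl
  · simp only [bsum, csum, List.length_map]
    rfl

theorem isHomog_aLetter_range' (D : ℕ → ℤ) (x : TriSystem A M) (i r : ℕ) :
    IsHomog 𝒜 (x.aLetter D (List.range' i (r + 1))) ↔
      x.a i (i + r) ∈ 𝒜 (∑ t ∈ Finset.Icc i (i + r), D t + 1) := by
  rw [TriSystem.aLetter, headI_range', getLastI_range', ← wt_range']
  rfl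

theorem isHomog_midLetter_range' (D : ℕ → ℤ) (x : TriSystem A M) (c r s : ℕ) (h : r ≤ c) :
    IsHomog ℳ (x.midLetter D c (List.range' (c - r) r) (List.range' (c + 1) s)) ↔
      x.m (c - r) (c + s) ∈ ℳ (∑ t ∈ Finset.Icc (c - r) (c + s), D t + 1) := by
  rw [TriSystem.midLetter, TriSystem.mLetter, range'_append_cons c r s h, headI_range',
    getLastI_range', show c + s = c - r + (r + s) by omega, ← wt_range', add_assoc r s 1]
  rfl

/-- The letters `L` and `Lm` are homogeneous and satisfy the Maurer-Cartan equations on all blocks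
of the word `u ++ c :: v`. -/
def IsTriangle {α : Type*} (P : Bimod X ℳ) (L : List α → ℤ × A) (Lm : List α → List α → ℤ × M)
    (u v : List α) : Prop :=
  ((∀ b, b <:+: u → b ≠ [] → IsHomog 𝒜 (L b)) ∧ (∀ b, b <:+: v → b ≠ [] → IsHomog 𝒜 (L b)) ∧
    (∀ p q, p <:+ u → q <+: v → IsHomog ℳ (Lm p q))) ∧
  (∀ b, b <:+: u → csum L (opEval X.mu) b = 0) ∧ (∀ b, b <:+: v → csum L (opEval X.mu) b = 0) ∧
    (∀ p q, p <:+ u → q <+: v → bsum L Lm (biEval P.map) p q = 0)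

/-- Needed because the upper triangle of a cyclic defining system labels the positions 1, …, k by
their translates by k + l + 2. -/
theorem isTriangle_map_iff {α : Type*} (P : Bimod X ℳ) {L L' : List α → ℤ × A}
    {Lm Lm' : List α → List α → ℤ × M} {u v : List α} (g : α → α)
    (hu : ∀ b, b <:+: u → b ≠ [] → L b = L' b)
    (hv : ∀ b, b <:+: v → b ≠ [] → L (b.map g) = L' b)
    (hm : ∀ p q, p <:+ u → q <+: v → Lm p (q.map g) = Lm' p q) :
    IsTriangle P L Lm u (v.map g) ↔ IsTriangle P L' Lm' u v := by
  have hi : ∀ F : List α → Prop, (∀ b, b <:+: v.map g → F b) ↔ ∀ b, b <:+: v → F (b.map g) :=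
    fun F => ⟨fun h b hb => h _ (hb.map g), fun h b hb => by
      obtain ⟨b', hb', rfl⟩ := List.infix_map_iff.1 hb
      exact h b' hb'⟩
  have hp : ∀ F : List α → Prop, (∀ b, b <+: v.map g → F b) ↔ ∀ b, b <+: v → F (b.map g) :=
    fun F => ⟨fun h b hb => h _ (hb.map g), fun h b hb => by
      obtain ⟨b', hb', rfl⟩ := List.prefix_map_iff.1 hb
      exact h b' hb'⟩
  have hs : ∀ F : List α → List α → Prop, (∀ p q, p <:+ u → q <+: v.map g → F p q) ↔
      ∀ p q, p <:+ u → q <+: v → F p (q.map g) := fun F =>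
    ⟨fun h p q hpu => (hp (F p)).1 (fun q => h p q hpu) q,
      fun h p q hpu => (hp (F p)).2 (fun q => h p q hpu) q⟩
  simp only [IsTriangle, hi, hs, ne_eq, List.map_eq_nil_iff]
  refine and_congr (and_congr ?_ (and_congr ?_ ?_)) (and_congr ?_ (and_congr ?_ ?_))
  · exact forall₃_congr fun b hb hb0 => by rw [hu b hb hb0]
  · exact forall₃_congr fun b hb hb0 => by rw [hv b hb hb0]
  · exact forall₄_congr fun p q hp hq => by rw [hm p q hp hq]
  · exact forall₂_congr fun b hb => by rw [csum_congr _ fun b' hb' => hu b' (hb'.trans hb)]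
  · refine forall₂_congr fun b hb => ?_
    rw [csum_map, csum_congr _ fun b' hb' => hv b' (hb'.trans hb)]
  · refine forall₄_congr fun p q hp hq => ?_
    rw [bsum_map_right g _ (fun b hb => hu b (hb.trans hp.isInfix))
      (fun b hb => hv b (hb.trans hq.isInfix)) fun p' q' hp' hq' =>
        hm p' q' (hp'.trans hp) (hq'.trans hq)]

/-- A cyclic system consists of two triangles, around c and around o, which share their algebra
entries. -/
theorem isSystem_iff_isTriangle {α : Type*} (P : Bimod X ℳ) (D : α → ℤ) (c o : α) (u v : List α)
    (a : List α → A) (m n : List α → List α → M) :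
    IsSystem P D c o u v a m n ↔ IsTriangle P (letter D a) (midLetter D c m) u v ∧
      IsTriangle P (letter D a) (midLetter D o n) v u :=
  ⟨fun h => ⟨⟨⟨h.left, h.right, h.mid⟩, h.left_eq, h.right_eq, h.mid_eq⟩,
    ⟨h.right, h.left, h.out⟩, h.right_eq, h.left_eq, h.out_eq⟩,
  fun ⟨⟨⟨h1, h2, h3⟩, h4, h5, h6⟩, ⟨_, _, h7⟩, _, _, h8⟩ =>
    { left := h1, right := h2, mid := h3, out := h7, left_eq := h4, right_eq := h5, mid_eq := h6,
      out_eq := h8 }⟩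

/-- Intervals avoiding c are the non-empty infixes of the two sides; those containing c are a suffix
of the left side, c, and a prefix of the right side. -/
theorem isDefiningSystem_iff (P : Bimod X ℳ) (D : ℕ → ℤ) (c r s : ℕ) (hr : r ≤ c)
    (x : TriSystem A M) :
    IsDefiningSystem P D (c - r) c (c + s) x ↔
      IsTriangle P (x.aLetter D) (x.midLetter D c) (List.range' (c - r) r)
        (List.range' (c + 1) s) := by
  constructor
  · intro h
    have hin : ∀ b, b <:+: List.range' (c - r) r ∨ b <:+: List.range' (c + 1) s → b ≠ [] →
        ∃ i r', b = List.range' i (r' + 1) ∧ c - r ≤ i ∧ i + r' ≤ c + s ∧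
          (i + r' < c ∨ c < i) := by
      rintro b (hb | hb) hb0
      · obtain ⟨i, r', rfl, h1, h2⟩ := exists_of_infix_range' hb hb0
        exact ⟨i, r', rfl, h1, by omega, by omega⟩
      · obtain ⟨i, r', rfl, h1, h2⟩ := exists_of_infix_range' hb hb0
        exact ⟨i, r', rfl, by omega, by omega, by omega⟩
    have hA : ∀ b, b <:+: List.range' (c - r) r ∨ b <:+: List.range' (c + 1) s → b ≠ [] →
        IsHomog 𝒜 (x.aLetter D b) := by
      intro b hb hb0
      obtain ⟨i, r', rfl, h1, h2, h3⟩ := hin b hb hb0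
      rw [isHomog_aLetter_range']
      exact h.a_mem i (i + r') h1 (by omega) h2 h3
    have hB : ∀ b, b <:+: List.range' (c - r) r ∨ b <:+: List.range' (c + 1) s →
        csum (x.aLetter D) (opEval X.mu) b = 0 := by
      intro b hb
      -- The empty block corresponds to no entry of the triangle; its equation is μ_0 = 0.
      by_cases hb0 : b = []
      · rw [hb0, csum_nil, opEval_nil _ X.mu_zero]
      obtain ⟨i, r', rfl, h1, h2, h3⟩ := hin b hb hb0
      rw [stairA_eq, h.a_eq i (i + r') h1 (by omega) h2 h3, neg_add_cancel]
    refine ⟨⟨fun b hb => hA b (Or.inl hb), fun b hb => hA b (Or.inr hb), fun p q hp hq => ?_⟩,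
      fun b hb => hB b (Or.inl hb), fun b hb => hB b (Or.inr hb), fun p q hp hq => ?_⟩
    · obtain ⟨r', hr', rfl⟩ := exists_of_suffix_range' hp
      obtain ⟨s', hs', rfl⟩ := exists_of_prefix_range' hq
      rw [show c - r + r - r' = c - r' by omega, isHomog_midLetter_range' D x c r' s' (by omega)]
      exact h.m_mem _ _ (by omega) (by omega) (by omega) (by omega)
    · obtain ⟨r', hr', rfl⟩ := exists_of_suffix_range' hp
      obtain ⟨s', hs', rfl⟩ := exists_of_prefix_range' hq
      rw [show c - r + r - r' = c - r' by omega, stairM_eq P D x c r' s' (by omega),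
        h.m_eq _ _ (by omega) (by omega) (by omega) (by omega), neg_add_cancel]
  · rintro ⟨⟨h1, h2, h3⟩, h4, h5, h6⟩
    have hA : ∀ i j, c - r ≤ i → i ≤ j → j ≤ c + s → (j < c ∨ c < i) →
        ∃ r', j = i + r' ∧ (List.range' i (r' + 1) <:+: List.range' (c - r) r ∨
          List.range' i (r' + 1) <:+: List.range' (c + 1) s) := by
      rintro i j hi hij hj (hc | hc)
      · exact ⟨j - i, by omega, Or.inl (infix_range'_of_le (by omega) (by omega))⟩
      · exact ⟨j - i, by omega, Or.inr (infix_range'_of_le (by omega) (by omega))⟩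
    have hB : ∀ i j, c - r ≤ i → i ≤ c → c ≤ j → j ≤ c + s → ∃ r' s', i = c - r' ∧ j = c + s' ∧
        r' ≤ c ∧ List.range' (c - r') r' <:+ List.range' (c - r) r ∧
          List.range' (c + 1) s' <+: List.range' (c + 1) s := by
      intro i j hi hic hcj hj
      refine ⟨c - i, j - c, by omega, by omega, by omega, ?_, prefix_range'_of_le (by omega)⟩
      have := suffix_range'_of_le (s := c - r) (n := r) (r := c - i) (by omega)
      rwa [show c - r + r - (c - i) = c - (c - i) by omega] at this
    constructor
    · intro i j hi hij hj hc
      obtain ⟨r', rfl, h⟩ := hA i j hi hij hj hc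
      rw [← isHomog_aLetter_range']
      exact h.elim (fun h => h1 _ h (by simp)) fun h => h2 _ h (by simp)
    · intro i j hi hic hcj hj
      obtain ⟨r', s', rfl, rfl, hr', hp, hq⟩ := hB i j hi hic hcj hj
      rw [← isHomog_midLetter_range' D x c r' s' hr']
      exact h3 _ _ hp hq
    · intro i j hi hij hj hc
      obtain ⟨r', rfl, h⟩ := hA i j hi hij hj hc
      rw [eq_neg_iff_add_eq_zero, ← stairA_eq]
      exact h.elim (h4 _) (h5 _)
    · intro i j hi hic hcj hj
      obtain ⟨r', s', rfl, rfl, hr', hp, hq⟩ := hB i j hi hic hcj hj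
      rw [eq_neg_iff_add_eq_zero, ← stairM_eq P D x c r' s' hr']
      exact h6 _ _ hp hq

end Bridge

/-! ### The two triangles glued along their overlap -/

section CyclicBridge

variable {R A M : Type*} [CommRing R] [AddCommGroup A] [Module R A]
  [AddCommGroup M] [Module R M]
  {𝒜 : ℤ → Submodule R A} {ℳ : ℤ → Submodule R M} {X : Alg 𝒜}

/-- Positions start at 1; at p = 0 the truncated subtraction in `sdegAt` would break periodicity. -/
theorem CyclicTuple.sdegAt_add {k l : ℕ} (t : CyclicTuple A M k l) {p : ℕ} (hp : 1 ≤ p) :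
    t.sdegAt (p + (k + l + 2)) = t.sdegAt p := by
  have h : (p + (k + l + 2) - 1) % (k + l + 2) = (p - 1) % (k + l + 2) := by
    rw [show p + (k + l + 2) - 1 = p - 1 + (k + l + 2) by omega, Nat.add_mod_right]
  simp only [CyclicTuple.sdegAt, h]

/-- The entries of two triangular systems are the values of functions on blocks of positions. -/
structure IsBlockForm (k l : ℕ) (x x' : TriSystem A M) (a : List ℕ → A)
    (m n : List ℕ → List ℕ → M) : Prop where
  left : ∀ b, b <:+: List.range' 1 k → b ≠ [] → x.a b.headI b.getLastI = a b
  right : ∀ b, b <:+: List.range' (k + 2) l → b ≠ [] → x.a b.headI b.getLastI = a b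
  mid : ∀ p q, p <:+ List.range' 1 k → q <+: List.range' (k + 2) l →
    x.m (p ++ (k + 1) :: q).headI (p ++ (k + 1) :: q).getLastI = m p q
  left' : ∀ b, b <:+: List.range' 1 k → b ≠ [] →
    x'.a (b.map (· + (k + l + 2))).headI (b.map (· + (k + l + 2))).getLastI = a b
  right' : ∀ b, b <:+: List.range' (k + 2) l → b ≠ [] → x'.a b.headI b.getLastI = a b
  out : ∀ q p, q <:+ List.range' (k + 2) l → p <+: List.range' 1 k →
    x'.m (q ++ (k + l + 2) :: p.map (· + (k + l + 2))).headI
      (q ++ (k + l + 2) :: p.map (· + (k + l + 2))).getLastI = n q p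

namespace IsBlockForm

variable {k l : ℕ} {x x' : TriSystem A M} {a : List ℕ → A} {m n : List ℕ → List ℕ → M}

theorem aLetter_left (h : IsBlockForm k l x x' a m n) (D : ℕ → ℤ) (b : List ℕ)
    (hb : b <:+: List.range' 1 k) (hb0 : b ≠ []) : x.aLetter D b = letter D a b :=
  Prod.ext rfl (h.left b hb hb0)

theorem aLetter_right (h : IsBlockForm k l x x' a m n) (D : ℕ → ℤ) (b : List ℕ)
    (hb : b <:+: List.range' (k + 2) l) (hb0 : b ≠ []) : x.aLetter D b = letter D a b :=
  Prod.ext rfl (h.right b hb hb0)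

theorem midLetter_mid (h : IsBlockForm k l x x' a m n) (D : ℕ → ℤ) (p q : List ℕ)
    (hp : p <:+ List.range' 1 k) (hq : q <+: List.range' (k + 2) l) :
    x.midLetter D (k + 1) p q = midLetter D (k + 1) m p q :=
  Prod.ext (by simp [TriSystem.midLetter, TriSystem.mLetter, midLetter, wt, add_assoc])
    (h.mid p q hp hq)

theorem wt_map_add (t : CyclicTuple A M k l) {p : List ℕ} (hp : p ⊆ List.range' 1 k) :
    wt t.sdegAt (p.map (· + (k + l + 2))) = wt t.sdegAt p := by
  rw [wt, List.map_map, wt, List.map_congr_left fun y hy => ?_]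
  have := List.mem_range'_1.1 (hp hy)
  exact t.sdegAt_add this.1

theorem aLetter_left' (h : IsBlockForm k l x x' a m n) (t : CyclicTuple A M k l) (b : List ℕ)
    (hb : b <:+: List.range' 1 k) (hb0 : b ≠ []) :
    x'.aLetter t.sdegAt (b.map (· + (k + l + 2))) = letter t.sdegAt a b :=
  Prod.ext (wt_map_add t hb.subset) (h.left' b hb hb0)

theorem aLetter_right' (h : IsBlockForm k l x x' a m n) (D : ℕ → ℤ) (b : List ℕ)
    (hb : b <:+: List.range' (k + 2) l) (hb0 : b ≠ []) : x'.aLetter D b = letter D a b :=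
  Prod.ext rfl (h.right' b hb hb0)

theorem midLetter_out (h : IsBlockForm k l x x' a m n) (t : CyclicTuple A M k l) (q p : List ℕ)
    (hq : q <:+ List.range' (k + 2) l) (hp : p <+: List.range' 1 k) :
    x'.midLetter t.sdegAt (k + l + 2) q (p.map (· + (k + l + 2))) =
      midLetter t.sdegAt (k + l + 2) n q p := by
  refine Prod.ext ?_ (h.out q p hq hp)
  change wt t.sdegAt (q ++ (k + l + 2) :: p.map (· + (k + l + 2))) = _
  rw [wt_append, wt_cons, wt_map_add t hp.subset]
  exact (add_assoc _ _ _).symm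

/-- The lower triangle corresponds to c = k + 1 without renaming; the upper one corresponds to o = k
+ l + 2 after translating the positions 1, …, k. -/
theorem isSystem_iff (h : IsBlockForm k l x x' a m n) (P : Bimod X ℳ) (t : CyclicTuple A M k l) :
    IsSystem P t.sdegAt (k + 1) (k + l + 2) (List.range' 1 k) (List.range' (k + 2) l) a m n ↔
      IsDefiningSystem P t.sdegAt 1 (k + 1) (k + l + 1) x ∧
        IsDefiningSystem P t.sdegAt (k + 2) (k + l + 2) (2 * k + l + 2) x' := by
  rw [isSystem_iff_isTriangle]
  refine and_congr ?_ ?_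
  · have := isDefiningSystem_iff P t.sdegAt (k + 1) k l (by omega) x
    rw [show k + 1 - k = 1 by omega, show k + 1 + l = k + l + 1 by omega,
      show k + 1 + 1 = k + 2 from rfl] at this
    rw [this, ← isTriangle_map_iff P id (h.aLetter_left t.sdegAt)
      (by simpa using h.aLetter_right t.sdegAt) (by simpa using h.midLetter_mid t.sdegAt),
      List.map_id]
  · have := isDefiningSystem_iff P t.sdegAt (k + l + 2) l k (by omega) x'
    rw [show k + l + 2 - l = k + 2 by omega, show k + l + 2 + k = 2 * k + l + 2 by omega,
      show List.range' (k + l + 2 + 1) k = (List.range' 1 k).map (· + (k + l + 2)) by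
        simp only [add_comm _ (k + l + 2), List.map_add_range']] at this
    rw [this, isTriangle_map_iff P (· + (k + l + 2)) (h.aLetter_right' t.sdegAt)
      (h.aLetter_left' t) (h.midLetter_out t)]

theorem stairIP_eq (h : IsBlockForm k l x x' a m n) {e : ℤ}
    (I : BiFamily 𝒜 ℳ (dualGrading ℳ) e) (t : CyclicTuple A M k l) :
    stairIP I t x x' = ipsum t.sdegAt (k + 1) (k + l + 2) a m n (ipEval I) (List.range' 1 k)
      (List.range' (k + 2) l) := by
  refine lsum_congr fun s hs => lsum_congr fun r hr => ?_
  rw [mem_splits] at hs hr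
  have h1 := h.midLetter_out t r.2 s.1 ⟨_, hr⟩ ⟨_, hs⟩
  rw [TriSystem.midLetter] at h1
  rw [h1, ← bsum_congr _
    (fun b hb => h.aLetter_left t.sdegAt b (hb.trans ⟨s.1, [], by simpa using hs⟩))
    (fun b hb => h.aLetter_right t.sdegAt b (hb.trans ⟨[], r.2, by simpa using hr⟩))
    fun p q hp hq => h.midLetter_mid t.sdegAt p q (hp.trans ⟨_, hs⟩) (hq.trans ⟨_, hr⟩)]
  simp only [lsum_smul]
  rfl

end IsBlockForm

/-- The overlap conditions are exactly what lets the algebra entries of both triangles be values of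
one function on blocks. -/
theorem isBlockForm_of_isCyclicDefiningSystem {P : Bimod X ℳ} {k l : ℕ} {t : CyclicTuple A M k l}
    {x x' : TriSystem A M} (h : IsCyclicDefiningSystem P t x x') :
    IsBlockForm k l x x' (fun b => x.a b.headI b.getLastI)
      (fun p q => x.m (p ++ (k + 1) :: q).headI (p ++ (k + 1) :: q).getLastI)
      (fun q p => x'.m (q ++ (k + l + 2) :: p.map (· + (k + l + 2))).headI
        (q ++ (k + l + 2) :: p.map (· + (k + l + 2))).getLastI) where
  left _ _ _ := rfl
  right _ _ _ := rfl
  mid _ _ _ _ := rfl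
  left' b hb hb0 := by
    obtain ⟨i, r, rfl, h1, h2⟩ := exists_of_infix_range' hb hb0
    simp only [add_comm _ (k + l + 2), List.map_add_range', headI_range', getLastI_range']
    have := h.overlap_a i (i + r) h1 (by omega) (by omega)
    rwa [add_comm i, add_comm (i + r), ← add_assoc] at this
  right' b hb hb0 := by
    obtain ⟨i, r, rfl, h1, h2⟩ := exists_of_infix_range' hb hb0
    simp only [headI_range', getLastI_range']
    exact h.overlap_b i (i + r) h1 (by omega) (by omega)
  out _ _ _ _ := rfl

/-- The converse construction. In the upper triangle, the test on j separates blocks among the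
positions k + 2, …, k + l + 1 from translated blocks of 1, …, k. -/
theorem isBlockForm_tri (k l : ℕ) (a : List ℕ → A) (m n : List ℕ → List ℕ → M) :
    IsBlockForm k l ⟨fun i j => a (List.range' i (j + 1 - i)),
        fun i j => m (List.range' i (k + 1 - i)) (List.range' (k + 2) (j - (k + 1)))⟩
      ⟨fun i j => if j ≤ k + l + 1 then a (List.range' i (j + 1 - i)) else
          a (List.range' (i - (k + l + 2)) (j + 1 - i)),
        fun i j => n (List.range' i (k + l + 2 - i)) (List.range' 1 (j - (k + l + 2)))⟩ a m n where
  left b hb hb0 := by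
    obtain ⟨i, r, rfl, h1, h2⟩ := exists_of_infix_range' hb hb0
    simp only [headI_range', getLastI_range']
    rw [show i + r + 1 - i = r + 1 by omega]
  right b hb hb0 := by
    obtain ⟨i, r, rfl, h1, h2⟩ := exists_of_infix_range' hb hb0
    simp only [headI_range', getLastI_range']
    rw [show i + r + 1 - i = r + 1 by omega]
  mid p q hp hq := by
    obtain ⟨r, hr, rfl⟩ := exists_of_suffix_range' hp
    obtain ⟨s, hs, rfl⟩ := exists_of_prefix_range' hq
    have := range'_append_cons (k + 1) r s (by omega)
    rw [show k + 1 + 1 = k + 2 from rfl] at this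
    rw [show 1 + k - r = k + 1 - r by omega, this, headI_range', getLastI_range']
    dsimp only
    congr 2 <;> omega
  left' b hb hb0 := by
    obtain ⟨i, r, rfl, h1, h2⟩ := exists_of_infix_range' hb hb0
    simp only [add_comm _ (k + l + 2), List.map_add_range', headI_range', getLastI_range']
    rw [if_neg (by omega)]
    congr 2 <;> omega
  right' b hb hb0 := by
    obtain ⟨i, r, rfl, h1, h2⟩ := exists_of_infix_range' hb hb0
    simp only [headI_range', getLastI_range']
    rw [if_pos (by omega), show i + r + 1 - i = r + 1 by omega]
  out q p hq hp := by
    obtain ⟨r, hr, rfl⟩ := exists_of_suffix_range' hq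
    obtain ⟨s, hs, rfl⟩ := exists_of_prefix_range' hp
    have := range'_append_cons (k + l + 2) r s (by omega)
    simp only [add_comm _ (k + l + 2), List.map_add_range']
    rw [show k + 2 + l - r = k + l + 2 - r by omega, this, headI_range', getLastI_range']
    congr 2 <;> omega

/-- The system `a, m, n` on the positions of a tuple has the entries of the tuple on its
diagonal. -/
structure HasDiagonal {k l : ℕ} (t : CyclicTuple A M k l) (a : List ℕ → A)
    (m n : List ℕ → List ℕ → M) : Prop where
  left : ∀ i : Fin k, a [i + 1] = t.a i
  mid : m [] [] = t.m
  right : ∀ i : Fin l, a [k + 2 + i] = t.b i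
  out : n [] [] = t.n

/-- From here on Massey inner products are handled through block functions alone, and triangular
systems are no longer needed. -/
theorem mem_masseyIP_iff {P : Bimod X ℳ} {e : ℤ} (I : InnerProd P e) {k l : ℕ}
    (t : CyclicTuple A M k l) (ρ : R) :
    ρ ∈ masseyIP I t ↔ ∃ a m n,
      IsSystem P t.sdegAt (k + 1) (k + l + 2) (List.range' 1 k) (List.range' (k + 2) l) a m n ∧
      HasDiagonal t a m n ∧
      ρ = ipsum t.sdegAt (k + 1) (k + l + 2) a m n (ipEval I.toBiFamily) (List.range' 1 k)
        (List.range' (k + 2) l) := by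
  constructor
  · rintro ⟨x, x', h, rfl⟩
    have hb := isBlockForm_of_isCyclicDefiningSystem h
    exact ⟨_, _, _, (hb.isSystem_iff P t).2 ⟨h.lower, h.upper⟩,
      ⟨h.diag_a, h.diag_m, h.diag_b, h.diag_n⟩, hb.stairIP_eq _ t⟩
  · rintro ⟨a, m, n, h, hd, rfl⟩
    have hb := isBlockForm_tri k l a m n
    obtain ⟨h1, h2⟩ := (hb.isSystem_iff P t).1 h
    refine ⟨_, _, ⟨h1, h2, fun i => ?_, ?_, fun i => ?_, ?_, fun i j h1 h2 h3 => ?_,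
      fun i j h1 h2 h3 => ?_⟩, (hb.stairIP_eq _ t).symm⟩
    · simpa using hd.left i
    · simpa using hd.mid
    · simpa using hd.right i
    · simpa using hd.out
    · dsimp only
      rw [if_neg (by omega)]
      congr 2 <;> omega
    · exact if_pos h3

end CyclicBridge

/-! ### Degrees of staircase inner products -/

section Degrees

variable {R α A M : Type*} [CommRing R] [AddCommGroup A] [Module R A]
  [AddCommGroup M] [Module R M]
  {𝒜 : ℤ → Submodule R A} {ℳ : ℤ → Submodule R M} {X : Alg 𝒜}

/-- A homogeneous functional of degree d vanishes on elements of degree other than -d; the summand 2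
undoes the shifts of the two module arguments. -/
theorem ipEval_eq_zero {e : ℤ} (I : BiFamily 𝒜 ℳ (dualGrading ℳ) e) {y z : List (ℤ × A)}
    {x t : ℤ × M} (hy : ∀ w ∈ y, IsHomog 𝒜 w) (hx : IsHomog ℳ x) (hz : ∀ w ∈ z, IsHomog 𝒜 w)
    (ht : IsHomog ℳ t) (h : sdeg y + x.1 + sdeg z + t.1 + e + 2 ≠ 0) : ipEval I y x z t = 0 := by
  have h1 : (biLetter e I.map y x z).2 t.2 = 0 := by
    refine I.isHomog_biLetter hy hx hz (t.1 + 1) (fun h2 => h ?_) t.2 ht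
    rw [biLetter] at h2
    dsimp only at h2
    linarith
  rw [ipEval, pair, h1, smul_zero]

/-- A staircase inner product vanishes unless the degrees of all entries add up to the right
number. -/
theorem IsGradedSystem.ipsum_eq_zero {D : α → ℤ} {c o : α} {u v : List α} {a : List α → A}
    {m n : List α → List α → M} (h : IsGradedSystem 𝒜 ℳ D c o u v a m n) {e : ℤ}
    (I : BiFamily 𝒜 ℳ (dualGrading ℳ) e) (hd : wt D u + D c + wt D v + D o + e + 2 ≠ 0) :
    ipsum D c o a m n (ipEval I) u v = 0 := by
  refine lsum_eq_zero fun s hs => lsum_eq_zero fun r hr => ?_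
  have hs' := mem_splits.1 hs
  have hr' := mem_splits.1 hr
  have hn := h.out r.2 s.1 ⟨_, hr'⟩ ⟨_, hs'⟩
  -- The inserted condition holds for every term and keeps the degree information available when
  -- homogeneity is used next.
  have h1 : bsum (letter D a) (midLetter D c m) (fun y x z =>
      ipEval I y x z (midLetter D o n r.2 s.1)) s.2 r.1 =
      bsum (letter D a) (midLetter D c m) (fun y x z =>
        if sdeg y + x.1 + sdeg z = wt D s.2 + D c + wt D r.1 then
          ipEval I y x z (midLetter D o n r.2 s.1) else 0) s.2 r.1 :=
    bsum_congr_right fun y x z hyz => (if_pos hyz).symm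
  rw [h1, bsum_congr_homog (fun b hb => h.left b (hb.trans ⟨s.1, [], by simpa using hs'⟩))
    (fun b hb => h.right b (hb.trans ⟨[], r.2, by simpa using hr'⟩))
    (fun p q hp hq => h.mid p q (hp.trans ⟨_, hs'⟩) (hq.trans ⟨_, hr'⟩))
    (Φ' := fun _ _ _ => 0) fun y x z hy hx hz => ?_, bsum_zero, smul_zero]
  refine ite_eq_right_iff.2 fun hyz => ipEval_eq_zero I hy hx hz hn fun h0 => hd ?_
  rw [hyz, midLetter] at h0
  rw [← wt_splits hs, ← wt_splits hr]
  dsimp only at h0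
  linarith

end Degrees

/-! ### Homogeneous primitives of coboundaries -/

section Primitives

variable {R A B M N : Type*} [CommRing R] [AddCommGroup A] [Module R A]
  [AddCommGroup B] [Module R B] [AddCommGroup M] [Module R M] [AddCommGroup N] [Module R N]
  {𝒜 : ℤ → Submodule R A} {ℬ : ℤ → Submodule R B} {ℳ : ℤ → Submodule R M}
  {𝒩 : ℤ → Submodule R N} {X : Alg 𝒜} {Y : Alg ℬ}

theorem Alg.d_mem (X : Alg 𝒜) {n : ℤ} {x : A} (hx : x ∈ 𝒜 n) : X.d x ∈ 𝒜 (n + 1) := by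
  have := X.mu_mem 1 (fun _ => n) (fun _ => x) fun _ => hx
  convert this using 1
  · congr 1
    simp
    ring
  · rfl

theorem AlgHom.one_mem (f : AlgHom X Y) {n : ℤ} {x : A} (hx : x ∈ 𝒜 n) : f.one x ∈ ℬ n := by
  have := f.map_mem 1 (fun _ => n) (fun _ => x) fun _ => hx
  convert this using 1
  · congr 1
    simp
  · rfl

theorem biZero_mem {e : ℤ} (F : BiFamily 𝒜 ℳ 𝒩 e) {n : ℤ} {x : M} (hx : x ∈ ℳ n) :
    biZero F.map x ∈ 𝒩 (n + e) := by
  have := F.map_mem 0 0 Fin.elim0 n Fin.elim0 Fin.elim0 x Fin.elim0 (fun i => i.elim0) hx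
    fun i => i.elim0
  convert this using 1
  · congr 1
    simp
  · rfl

/-- Since d raises degrees by exactly one, the degree n part of dx is d of the degree n - 1 part of
x. Arbitrary primitives can thus be replaced by homogeneous ones. -/
theorem exists_homogeneous_primitive [DirectSum.Decomposition ℳ] {d : M →ₗ[R] M}
    (hd : ∀ n, ∀ x ∈ ℳ n, d x ∈ ℳ (n + 1)) (n : ℤ) {z : M} (hz : z ∈ LinearMap.range d) :
    ∃ x ∈ ℳ (n - 1), (DirectSum.decompose ℳ z n : M) = d x := by
  obtain ⟨x, rfl⟩ := hz
  refine ⟨DirectSum.decompose ℳ x (n - 1), SetLike.coe_mem _, ?_⟩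
  induction x using DirectSum.Decomposition.inductionOn ℳ with
  | zero => simp
  | add x y hx hy =>
    simp only [map_add, DirectSum.decompose_add, DirectSum.add_apply, Submodule.coe_add, hx, hy]
  | @homogeneous k x =>
    have hx := hd k x x.2
    by_cases h : k = n - 1
    · subst h
      rw [sub_add_cancel] at hx
      rw [DirectSum.decompose_of_mem_same ℳ hx, DirectSum.decompose_of_mem_same ℳ x.2]
    · rw [DirectSum.decompose_of_mem_ne ℳ hx fun h' => h (by omega),
        DirectSum.decompose_of_mem_ne ℳ x.2 h, map_zero]

theorem sub_mem_range_of_cohMap_comp {dM : M →ₗ[R] M} {dN : N →ₗ[R] N} {φ : M →ₗ[R] N}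
    {ψ : N →ₗ[R] M} {ε ε' : ℤˣ} (hφ : ∀ x, φ (dM x) = ε • dN (φ x))
    (hψ : ∀ x, ψ (dN x) = ε' • dM (ψ x))
    (h : cohMap ψ ε' hψ ∘ₗ cohMap φ ε hφ = LinearMap.id) {x : M} (hx : dM x = 0) :
    x - ψ (φ x) ∈ LinearMap.range dM := by
  have h1 := (Submodule.Quotient.eq _).1 (LinearMap.congr_fun h (Submodule.Quotient.mk ⟨x, hx⟩))
  rw [← neg_sub]
  exact Submodule.neg_mem _ h1

end Primitives

/-! ### Images and changes of tuples -/

section Tuples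

variable {R A B M N : Type*} [CommRing R] [AddCommGroup A] [Module R A]
  [AddCommGroup B] [Module R B] [AddCommGroup M] [Module R M] [AddCommGroup N] [Module R N]
  {𝒜 : ℤ → Submodule R A} {ℬ : ℤ → Submodule R B} {ℳ : ℤ → Submodule R M}
  {𝒩 : ℤ → Submodule R N} {X : Alg 𝒜} {Y : Alg ℬ} {P : Bimod X ℳ} {Q : Bimod Y 𝒩} {k l : ℕ}

theorem CyclicTuple.sdegAt_left (t : CyclicTuple A M k l) (i : Fin k) :
    t.sdegAt (i + 1) = t.aDeg i - 1 := by
  have h : ((i : ℕ) + 1 - 1) % (k + l + 2) = i := by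
    rw [Nat.add_sub_cancel, Nat.mod_eq_of_lt (by omega)]
  simp only [CyclicTuple.sdegAt, h, i.2, dif_pos]

theorem CyclicTuple.sdegAt_mid (t : CyclicTuple A M k l) : t.sdegAt (k + 1) = t.mDeg - 1 := by
  have h : (k + 1 - 1) % (k + l + 2) = k := by
    rw [Nat.add_sub_cancel, Nat.mod_eq_of_lt (by omega)]
  simp only [CyclicTuple.sdegAt, h, lt_irrefl, dif_neg, if_true, not_false_eq_true]

theorem CyclicTuple.sdegAt_right (t : CyclicTuple A M k l) (i : Fin l) :
    t.sdegAt (k + 2 + i) = t.bDeg i - 1 := by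
  have h : (k + 2 + (i : ℕ) - 1) % (k + l + 2) = k + 1 + i := by
    rw [show k + 2 + (i : ℕ) - 1 = k + 1 + i by omega, Nat.mod_eq_of_lt (by omega)]
  have h1 : ¬ k + 1 + (i : ℕ) < k := by omega
  have h2 : ¬ k + 1 + (i : ℕ) = k := by omega
  simp only [CyclicTuple.sdegAt, h, h1, h2, dif_neg, if_neg, not_false_eq_true,
    Nat.add_sub_cancel_left, i.2, dif_pos]

theorem CyclicTuple.sdegAt_out (t : CyclicTuple A M k l) : t.sdegAt (k + l + 2) = t.nDeg - 1 := by
  have h : (k + l + 2 - 1) % (k + l + 2) = k + l + 1 := by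
    rw [show k + l + 2 - 1 = k + l + 1 by omega, Nat.mod_eq_of_lt (by omega)]
  have h1 : ¬ k + l + 1 < k := by omega
  have h2 : ¬ k + l + 1 = k := by omega
  have h3 : ¬ k + l + 1 - (k + 1) < l := by omega
  simp only [CyclicTuple.sdegAt, h, h1, h2, h3, dif_neg, if_neg, not_false_eq_true]

theorem exists_fin_of_mem_left {p : ℕ} (hp : p ∈ List.range' 1 k) : ∃ i : Fin k, p = i + 1 := by
  rw [List.mem_range'_1] at hp
  exact ⟨⟨p - 1, by omega⟩, (Nat.sub_add_cancel hp.1).symm⟩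

theorem exists_fin_of_mem_right {p : ℕ} (hp : p ∈ List.range' (k + 2) l) :
    ∃ i : Fin l, p = k + 2 + i := by
  rw [List.mem_range'_1] at hp
  exact ⟨⟨p - (k + 2), by omega⟩, (Nat.add_sub_cancel' hp.1).symm⟩

/-- The total shifted degree of a tuple. -/
def CyclicTuple.total (t : CyclicTuple A M k l) : ℤ :=
  wt t.sdegAt (List.range' 1 k) + t.sdegAt (k + 1) + wt t.sdegAt (List.range' (k + 2) l) +
    t.sdegAt (k + l + 2)

/-- The degree of the entries of a tuple with module entries moved past by a morphism. -/
def CyclicTuple.midDeg (t : CyclicTuple A M k l) : ℤ :=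
  wt t.sdegAt (List.range' (k + 2) l) + t.sdegAt (k + 1)

/-! ### Degrees of image tuples -/

section Image

variable {f : AlgHom X Y} {e : ℤ} (F : ModHom f P Q e) (t : CyclicTuple A M k l)

theorem CyclicTuple.sdegAt_image_left {p : ℕ} (hp : p ∈ List.range' 1 k) :
    (t.image F).sdegAt p = t.sdegAt p := by
  obtain ⟨i, rfl⟩ := exists_fin_of_mem_left hp
  rw [sdegAt_left, sdegAt_left]
  rfl

theorem CyclicTuple.sdegAt_image_right {p : ℕ} (hp : p ∈ List.range' (k + 2) l) :
    (t.image F).sdegAt p = t.sdegAt p := by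
  obtain ⟨i, rfl⟩ := exists_fin_of_mem_right hp
  rw [sdegAt_right, sdegAt_right]
  rfl

theorem CyclicTuple.sdegAt_image_mid : (t.image F).sdegAt (k + 1) = t.sdegAt (k + 1) + e := by
  rw [sdegAt_mid, sdegAt_mid]
  exact add_sub_right_comm _ _ _

theorem CyclicTuple.sdegAt_image_out :
    (t.image F).sdegAt (k + l + 2) = t.sdegAt (k + l + 2) + e := by
  rw [sdegAt_out, sdegAt_out]
  exact add_sub_right_comm _ _ _

theorem CyclicTuple.midDeg_image : (t.image F).midDeg = t.midDeg + e := by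
  rw [midDeg, midDeg, wt_congr fun p hp => t.sdegAt_image_right F hp, sdegAt_image_mid, add_assoc]

theorem CyclicTuple.total_image : (t.image F).total = t.total + 2 * e := by
  rw [total, total, wt_congr fun p hp => t.sdegAt_image_left F hp,
    wt_congr fun p hp => t.sdegAt_image_right F hp, sdegAt_image_mid, sdegAt_image_out]
  ring

end Image

theorem pushA_singleton {α : Type*} (f : AlgHom X Y) (D : α → ℤ) (a : List α → A) (p : α) :
    pushA f.map D a [p] = f.one (a [p]) := by
  rw [pushA, csum, cuts, lsum_singleton]
  exact opEval_single _ _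

theorem pushM_nil {α : Type*} {f : AlgHom X Y} {e : ℤ} (F : ModHom f P Q e) (D : α → ℤ) (c : α)
    (a : List α → A) (m : List α → List α → M) :
    pushM F.map e D c a m [] [] = F.zero (m [] []) := by
  simp only [pushM, bsum, lsum_splits_nil, csum_nil, wt_nil, mul_zero, Int.negOnePow_zero,
    one_smul]
  exact biEval_nil _ _

/-- A morphism maps Massey inner products to Massey inner products, up to a global sign. -/
theorem smul_mem_masseyIP_image {i j : ℤ} {I : InnerProd P i} {J : InnerProd Q j} (Φ : IPHom I J)
    {t : CyclicTuple A M k l} {ρ : R} (hρ : ρ ∈ masseyIP I t) :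
    (Φ.degree * (t.midDeg + j + Φ.degree)).negOnePow • ρ ∈ masseyIP J (t.image Φ.modHom) := by
  obtain ⟨a, m, n, h, hd, rfl⟩ := (mem_masseyIP_iff I t ρ).1 hρ
  refine (mem_masseyIP_iff J _ _).2 ⟨_, _, _, h.push Φ.modHom
    (fun x hx => t.sdegAt_image_left Φ.modHom hx) (fun x hx => t.sdegAt_image_right Φ.modHom hx)
    (t.sdegAt_image_mid Φ.modHom) (t.sdegAt_image_out Φ.modHom), ⟨fun p => ?_, ?_, fun p => ?_, ?_⟩,
    (h.ipsum_eq_push Φ (fun x hx => t.sdegAt_image_left Φ.modHom hx)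
    (fun x hx => t.sdegAt_image_right Φ.modHom hx)
    (t.sdegAt_image_mid Φ.modHom) (t.sdegAt_image_out Φ.modHom)).symm⟩
  · rw [pushA_singleton, hd.left]
    rfl
  · rw [pushM_nil, hd.mid]
    rfl
  · rw [pushA_singleton, hd.right]
    rfl
  · rw [pushM_nil, hd.out]
    rfl

/-- Nonzero values thereby fix the degrees, which is how the global signs are controlled; the value
zero is insensitive to signs. -/
theorem total_eq_of_mem_masseyIP {i : ℤ} {I : InnerProd P i} {t : CyclicTuple A M k l} {ρ : R}
    (hρ : ρ ∈ masseyIP I t) (hρ0 : ρ ≠ 0) : t.total + i + 2 = 0 := by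
  obtain ⟨a, m, n, h, -, rfl⟩ := (mem_masseyIP_iff I t ρ).1 hρ
  by_contra h0
  exact hρ0 (h.ipsum_eq_zero I.toBiFamily h0)

/-- Changing the entries of a system at a set of positions by coboundaries. -/
theorem IsSystem.gauge_list {α : Type*} [DecidableEq α] {D : α → ℤ} {c o : α} {u v : List α}
    {a : List α → A} {m n : List α → List α → M} (h : IsSystem P D c o u v a m n)
    (hw : (u ++ c :: (v ++ [o])).Nodup) (x : α → A) (y : α → M) (hx : ∀ i, x i ∈ 𝒜 (D i))
    (hy : ∀ i, y i ∈ ℳ (D i)) (S : List α) (hS : S ⊆ u ++ c :: (v ++ [o])) (hS' : S.Nodup) :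
    ∃ a' m' n', IsSystem P D c o u v a' m' n' ∧
      (∀ k ∈ S, a' [k] = a [k] + X.d (x k)) ∧ (∀ k ∉ S, a' [k] = a [k]) ∧
      (m' [] [] = m [] [] + if c ∈ S then P.d (y c) else 0) ∧
      (n' [] [] = n [] [] + if o ∈ S then P.d (y o) else 0) ∧
      ∀ {e : ℤ} (I : InnerProd P e), ipsum D c o a' m' n' (ipEval I.toBiFamily) u v =
        ipsum D c o a m n (ipEval I.toBiFamily) u v := by
  induction S with
  | nil => exact ⟨a, m, n, h, by simp, by simp, by simp, by simp, fun _ => rfl⟩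
  | cons i S ih =>
    obtain ⟨hi, hS'⟩ := List.nodup_cons.1 hS'
    obtain ⟨a₁, m₁, n₁, h₁, ha, ha', hm, hn, hI⟩ := ih (fun k hk => hS (by simp [hk])) hS'
    obtain ⟨a₂, m₂, n₂, h₂, hb, hm', hn', hI'⟩ :=
      h₁.gauge hw (hS List.mem_cons_self) (hx i) (hy i)
    refine ⟨a₂, m₂, n₂, h₂, fun k hk => ?_, fun k hk => ?_, ?_, ?_, fun I => (hI' I).trans (hI I)⟩
    · rw [hb]
      by_cases hki : k = i
      · subst hki
        rw [if_pos rfl, ha' k hi]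
      · rw [if_neg hki, add_zero, ha k ((List.mem_cons.1 hk).resolve_left hki)]
    · rw [List.mem_cons, not_or] at hk
      rw [hb, if_neg hk.1, add_zero, ha' k hk.2]
    · rw [hm', hm]
      by_cases hc : c = i
      · subst hc
        simp [hi]
      · simp [hc]
    · rw [hn', hn]
      by_cases ho : o = i
      · subst ho
        simp [hi]
      · simp [ho]

theorem nodup_positions (k l : ℕ) :
    (List.range' 1 k ++ (k + 1) :: (List.range' (k + 2) l ++ [k + l + 2])).Nodup := by
  have h : List.range' 1 k ++ (k + 1) :: (List.range' (k + 2) l ++ [k + l + 2]) =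
      List.range' 1 (k + (l + 1 + 1)) := by
    rw [← range'_append_range', ← range'_append_range', add_comm 1 k, List.range'_succ,
      show k + 1 + (l + 1) = k + l + 2 by omega]
    rfl
  rw [h]
  exact List.nodup_range'

/-- Massey inner products only depend on the cohomology classes of the entries. -/
theorem masseyIP_subset_of_cohomologous {i : ℤ} (I : InnerProd P i) {t t' : CyclicTuple A M k l}
    (hD : t.sdegAt = t'.sdegAt)
    (ha : ∀ p, ∃ x ∈ 𝒜 (t'.aDeg p - 1), t'.a p = t.a p + X.d x)
    (hm : ∃ x ∈ ℳ (t'.mDeg - 1), t'.m = t.m + P.d x)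
    (hb : ∀ p, ∃ x ∈ 𝒜 (t'.bDeg p - 1), t'.b p = t.b p + X.d x)
    (hn : ∃ x ∈ ℳ (t'.nDeg - 1), t'.n = t.n + P.d x) : masseyIP I t ⊆ masseyIP I t' := by
  intro ρ hρ
  obtain ⟨a, m, n, h, hd, rfl⟩ := (mem_masseyIP_iff I t ρ).1 hρ
  rw [hD] at h ⊢
  -- The primitives are assembled into one function on all natural numbers, with default 0 at
  -- positions carrying no algebra entry. The module primitives are treated likewise.
  have hx : ∀ p, ∃ x ∈ 𝒜 (t'.sdegAt p), (∀ q : Fin k, p = q + 1 → t'.a q = t.a q + X.d x) ∧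
      ∀ q : Fin l, p = k + 2 + q → t'.b q = t.b q + X.d x := by
    intro p
    by_cases h1 : p ∈ List.range' 1 k
    · obtain ⟨q, rfl⟩ := exists_fin_of_mem_left h1
      obtain ⟨x, hx, hx'⟩ := ha q
      refine ⟨x, by rwa [t'.sdegAt_left], fun q' hq' => ?_, fun q' hq' => by omega⟩
      obtain rfl : q = q' := Fin.ext (by omega)
      exact hx'
    by_cases h2 : p ∈ List.range' (k + 2) l
    · obtain ⟨q, rfl⟩ := exists_fin_of_mem_right h2
      obtain ⟨x, hx, hx'⟩ := hb q
      refine ⟨x, by rwa [t'.sdegAt_right], fun q' hq' => by omega, fun q' hq' => ?_⟩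
      obtain rfl : q = q' := Fin.ext (by omega)
      exact hx'
    · rw [List.mem_range'_1] at h1 h2
      exact ⟨0, Submodule.zero_mem _, fun q hq => by omega, fun q hq => by omega⟩
  have hy : ∀ p, ∃ y ∈ ℳ (t'.sdegAt p), (p = k + 1 → t'.m = t.m + P.d y) ∧
      (p = k + l + 2 → t'.n = t.n + P.d y) := by
    intro p
    by_cases h1 : p = k + 1
    · obtain ⟨y, hy, hy'⟩ := hm
      exact ⟨y, by rwa [h1, t'.sdegAt_mid], fun _ => hy', fun _ => by omega⟩
    by_cases h2 : p = k + l + 2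
    · obtain ⟨y, hy, hy'⟩ := hn
      exact ⟨y, by rwa [h2, t'.sdegAt_out], fun _ => by omega, fun _ => hy'⟩
    · exact ⟨0, Submodule.zero_mem _, fun h => absurd h h1, fun h => absurd h h2⟩
  choose x hx hxa hxb using hx
  choose y hy hym hyn using hy
  obtain ⟨a', m', n', h', ha', -, hm', hn', hI⟩ := h.gauge_list (nodup_positions k l) x y hx hy _
    (List.Subset.refl _) (nodup_positions k l)
  refine (mem_masseyIP_iff I t' _).2 ⟨a', m', n', h', ⟨fun p => ?_, ?_, fun p => ?_, ?_⟩,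
    (hI I).symm⟩
  · rw [ha' _ (by simp [List.mem_range'_1]; omega), hd.left, hxa _ p rfl]
  · rw [hm', if_pos (by simp), hd.mid, hym _ rfl]
  · rw [ha' _ (by simp [List.mem_range'_1]), hd.right, hxb _ p rfl]
  · rw [hn', if_pos (by simp), hd.out, hyn _ rfl]

/-- The algebra part of a system, completed by zero. -/
theorem zero_mem_masseyIP {i : ℤ} (I : InnerProd P i) {t t' : CyclicTuple A M k l}
    (ha : t.a = t'.a) (hb : t.b = t'.b) (haD : t.aDeg = t'.aDeg) (hbD : t.bDeg = t'.bDeg)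
    (hm : t'.m = 0) (hn : t'.n = 0) (h : (masseyIP I t).Nonempty) : 0 ∈ masseyIP I t' := by
  obtain ⟨ρ, hρ⟩ := h
  obtain ⟨a, m, n, h, hd, -⟩ := (mem_masseyIP_iff I t ρ).1 hρ
  have hu : ∀ p ∈ List.range' 1 k, t'.sdegAt p = t.sdegAt p := by
    intro p hp
    obtain ⟨q, rfl⟩ := exists_fin_of_mem_left hp
    rw [CyclicTuple.sdegAt_left, CyclicTuple.sdegAt_left, haD]
  have hv : ∀ p ∈ List.range' (k + 2) l, t'.sdegAt p = t.sdegAt p := by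
    intro p hp
    obtain ⟨q, rfl⟩ := exists_fin_of_mem_right hp
    rw [CyclicTuple.sdegAt_right, CyclicTuple.sdegAt_right, hbD]
  -- Every term of β contains one module letter, here zero, so the module equations hold trivially.
  have hz : ∀ (D : ℕ → ℤ) (c : ℕ) (p q : List ℕ),
      bsum (letter D a) (midLetter D c fun _ _ => 0) (biEval P.map) p q = 0 := by
    intro D c p q
    simp only [bsum, midLetter, (biAdditive_biEval P.map).mid_zero, csum_zero, lsum_zero]
  refine (mem_masseyIP_iff I t' 0).2 ⟨a, fun _ _ => 0, fun _ _ => 0,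
    { left := fun b hb hb0 => by rw [letter_congr hu a hb]; exact h.left b hb hb0
      right := fun b hb hb0 => by rw [letter_congr hv a hb]; exact h.right b hb hb0
      mid := fun _ _ _ _ => Submodule.zero_mem _
      out := fun _ _ _ _ => Submodule.zero_mem _
      left_eq := fun b hb => by
        rw [csum_congr _ fun b' hb' _ => letter_congr hu a (hb'.trans hb)]
        exact h.left_eq b hb
      right_eq := fun b hb => by
        rw [csum_congr _ fun b' hb' _ => letter_congr hv a (hb'.trans hb)]
        exact h.right_eq b hb
      mid_eq := fun _ _ _ _ => hz _ _ _ _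
      out_eq := fun _ _ _ _ => hz _ _ _ _ },
    ⟨fun p => (hd.left p).trans (congrFun ha p), hm.symm,
      fun p => (hd.right p).trans (congrFun hb p), hn.symm⟩, ?_⟩
  refine (lsum_eq_zero fun s _ => lsum_eq_zero fun r _ => ?_).symm
  simp only [bsum, midLetter, (biAdditive_ipEval I.toBiFamily _).mid_zero, csum_zero, lsum_zero,
    smul_zero]

end Tuples

/-! ### Equivalences -/

section Equivalence

variable {R A B M N : Type*} [CommRing R] [AddCommGroup A] [Module R A]
  [AddCommGroup B] [Module R B] [AddCommGroup M] [Module R M] [AddCommGroup N] [Module R N]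
  {𝒜 : ℤ → Submodule R A} {ℬ : ℤ → Submodule R B} {ℳ : ℤ → Submodule R M}
  {𝒩 : ℤ → Submodule R N}
  [DirectSum.Decomposition 𝒜] [DirectSum.Decomposition ℬ]
  [DirectSum.Decomposition ℳ] [DirectSum.Decomposition 𝒩]
  {X : Alg 𝒜} {Y : Alg ℬ} {P : Bimod X ℳ} {Q : Bimod Y 𝒩} {i j : ℤ}
  {I : InnerProd P i} {J : InnerProd Q j} {Φ : IPHom I J} {Ψ : IPHom J I} {k l : ℕ}

theorem IsQuasiInverse.exists_alg_primitive (h : IsQuasiInverse Φ Ψ) {n : ℤ} {x : A}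
    (hx : x ∈ 𝒜 n) (hd : X.d x = 0) :
    ∃ z ∈ 𝒜 (n - 1), x = Ψ.algHom.one (Φ.algHom.one x) + X.d z := by
  obtain ⟨z, hz, hz'⟩ := exists_homogeneous_primitive (ℳ := 𝒜) (fun _ _ hx => X.d_mem hx) n
    (sub_mem_range_of_cohMap_comp Φ.algHom.one_d Ψ.algHom.one_d h.alg_left hd)
  refine ⟨z, hz, ?_⟩
  rw [← hz', DirectSum.decompose_of_mem_same 𝒜
    (Submodule.sub_mem _ hx (Ψ.algHom.one_mem (Φ.algHom.one_mem hx))), add_sub_cancel]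

/-- The difference between x and its round trip is exact; its degree n part is taken. If the degrees
do not cancel, the round trip of x has no part in degree n, so x itself is a coboundary. -/
theorem IsQuasiInverse.exists_mod_primitive (h : IsQuasiInverse Φ Ψ) {n : ℤ} {x : M}
    (hx : x ∈ ℳ n) (hd : P.d x = 0) :
    ∃ z ∈ ℳ (n - 1),
      x = (if Φ.degree + Ψ.degree = 0 then Ψ.modHom.zero (Φ.modHom.zero x) else 0) + P.d z := by
  obtain ⟨z, hz, hz'⟩ := exists_homogeneous_primitive
    (fun _ _ hx => biZero_mem P.toBiFamily hx) n
    (sub_mem_range_of_cohMap_comp Φ.modHom.zero_d Ψ.modHom.zero_d h.mod_left hd)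
  refine ⟨z, hz, ?_⟩
  have hy : Ψ.modHom.zero (Φ.modHom.zero x) ∈ ℳ (n + Φ.degree + Ψ.degree) :=
    biZero_mem Ψ.modHom.toBiFamily (biZero_mem Φ.modHom.toBiFamily hx)
  have h1 : (DirectSum.decompose ℳ (Ψ.modHom.zero (Φ.modHom.zero x)) n : M) =
      if Φ.degree + Ψ.degree = 0 then Ψ.modHom.zero (Φ.modHom.zero x) else 0 := by
    split_ifs with h0
    · rw [add_assoc, h0, add_zero] at hy
      exact DirectSum.decompose_of_mem_same ℳ hy
    · exact DirectSum.decompose_of_mem_ne ℳ hy (by omega)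
  change _ = P.d z at hz'
  rw [← hz', DirectSum.decompose_sub, DirectSum.sub_apply, Submodule.coe_sub,
    DirectSum.decompose_of_mem_same ℳ hx, h1, add_sub_cancel]

/-- For even e the first exponent is even. For odd e the second factors w + j + e and w + e + i + e'
have opposite parity, so one of the two exponents is even. -/
theorem units_eq_one_or_eq_one_of_degrees {e e' i j w : ℤ} (he : e + e' = 0) (hi : i = j + 2 * e) :
    (e * (w + j + e)).negOnePow = 1 ∨ (e' * (w + e + i + e')).negOnePow = 1 := by
  obtain rfl : e' = -e := by linarith
  rcases Int.even_or_odd e with h | h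
  · exact Or.inl (Int.negOnePow_even _ (h.mul_right _))
  · rcases Int.even_or_odd (w + j + e) with h' | h'
    · exact Or.inl (Int.negOnePow_even _ (h'.mul_left _))
    · refine Or.inr (Int.negOnePow_even _ (Even.mul_left ?_ _))
      rw [show w + e + i + -e = w + j + e + e by rw [hi]; ring]
      exact h'.add_odd h

theorem units_smul_ne_zero {W : Type*} [AddCommGroup W] (ε : ℤˣ) {x : W} (hx : x ≠ 0) :
    ε • x ≠ 0 := (smul_ne_zero_iff_ne ε).2 hx

/-- The round trip restores all degrees and moves entries by coboundaries, so both directions give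
inclusions up to signs ε and ε'. One of these is 1 whenever nonzero values exist on both sides. -/
theorem IsQuasiInverse.masseyIP_eq_of_degree_eq (h : IsQuasiInverse Φ Ψ)
    {t : CyclicTuple A M k l} (ht : t.IsCocycle P) (he : Φ.degree + Ψ.degree = 0) :
    masseyIP I t = masseyIP J (t.image Φ.modHom) := by
  have hD : ((t.image Φ.modHom).image Ψ.modHom).sdegAt = t.sdegAt := by
    funext p
    simp only [CyclicTuple.sdegAt, CyclicTuple.image, add_assoc, he, add_zero]
  have hback : ∀ τ ∈ masseyIP J (t.image Φ.modHom),
      (Ψ.degree * (t.midDeg + Φ.degree + i + Ψ.degree)).negOnePow • τ ∈ masseyIP I t := by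
    intro τ hτ
    have := smul_mem_masseyIP_image Ψ hτ
    rw [t.midDeg_image] at this
    refine masseyIP_subset_of_cohomologous I hD
      (fun p => h.exists_alg_primitive (ht.a_mem p) (ht.a_closed p)) ?_
      (fun p => h.exists_alg_primitive (ht.b_mem p) (ht.b_closed p)) ?_ this
    · have := h.exists_mod_primitive ht.m_mem ht.m_closed
      simp only [he, if_true] at this
      exact this
    · have := h.exists_mod_primitive ht.n_mem ht.n_closed
      simp only [he, if_true] at this
      exact this
  have hsign : ∀ ρ ∈ masseyIP I t, ∀ τ ∈ masseyIP J (t.image Φ.modHom), ρ ≠ 0 → τ ≠ 0 →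
      (Φ.degree * (t.midDeg + j + Φ.degree)).negOnePow = 1 ∨
        (Ψ.degree * (t.midDeg + Φ.degree + i + Ψ.degree)).negOnePow = 1 := by
    intro ρ hρ τ hτ hρ0 hτ0
    have h1 := total_eq_of_mem_masseyIP hρ hρ0
    have h2 := total_eq_of_mem_masseyIP hτ hτ0
    rw [t.total_image] at h2
    exact units_eq_one_or_eq_one_of_degrees he (by linarith)
  have hpush : ∀ ρ ∈ masseyIP I t, _ ∈ masseyIP J (t.image Φ.modHom) := fun ρ hρ =>
    smul_mem_masseyIP_image Φ hρ
  generalize (Φ.degree * (t.midDeg + j + Φ.degree)).negOnePow = ε at hsign hpush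
  generalize (Ψ.degree * (t.midDeg + Φ.degree + i + Ψ.degree)).negOnePow = ε' at hsign hback
  refine Set.Subset.antisymm (fun ρ hρ => ?_) fun τ hτ => ?_
  · have h1 := hpush ρ hρ
    by_cases h0 : ρ = 0
    · rwa [h0, smul_zero, ← h0] at h1
    rcases hsign ρ hρ _ h1 h0 (units_smul_ne_zero ε h0) with rfl | rfl
    · rwa [one_smul] at h1
    · have h2 := hpush _ (hback _ h1)
      rwa [one_smul, smul_smul, Int.units_mul_self, one_smul] at h2
  · have h1 := hback τ hτ
    by_cases h0 : τ = 0
    · rwa [h0, smul_zero, ← h0] at h1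
    rcases hsign _ h1 τ hτ (units_smul_ne_zero ε' h0) h0 with rfl | rfl
    · have h2 := hback _ (hpush _ h1)
      rwa [one_smul, smul_smul, Int.units_mul_self, one_smul] at h2
    · rwa [one_smul] at h1

/-- The round trip shifts the total degree by 2(e + e') ≠ 0, so neither set contains a nonzero
value. It remains to transfer the existence of a cyclic defining system. -/
theorem IsQuasiInverse.masseyIP_eq_of_degree_ne (h : IsQuasiInverse Φ Ψ)
    {t : CyclicTuple A M k l} (ht : t.IsCocycle P) (he : Φ.degree + Ψ.degree ≠ 0) :
    masseyIP I t = masseyIP J (t.image Φ.modHom) := by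
  have hS : ∀ ρ ∈ masseyIP I t, ρ = 0 := by
    intro ρ hρ
    by_contra h0
    have h1 := total_eq_of_mem_masseyIP hρ h0
    have h2 := total_eq_of_mem_masseyIP
      (smul_mem_masseyIP_image Ψ (smul_mem_masseyIP_image Φ hρ))
      (units_smul_ne_zero _ (units_smul_ne_zero _ h0))
    rw [CyclicTuple.total_image, CyclicTuple.total_image] at h2
    omega
  have hT : ∀ τ ∈ masseyIP J (t.image Φ.modHom), τ = 0 := by
    intro τ hτ
    by_contra h0
    have h1 := total_eq_of_mem_masseyIP hτ h0
    have h2 := total_eq_of_mem_masseyIP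
      (smul_mem_masseyIP_image Φ (smul_mem_masseyIP_image Ψ hτ))
      (units_smul_ne_zero _ (units_smul_ne_zero _ h0))
    rw [CyclicTuple.total_image, CyclicTuple.total_image] at h2
    omega
  refine Set.Subset.antisymm (fun ρ hρ => ?_) fun τ hτ => ?_
  · have h1 := smul_mem_masseyIP_image Φ hρ
    rwa [hS ρ hρ, smul_zero, ← hS ρ hρ] at h1
  · let t' : CyclicTuple A M k l :=
      { t with
        a := fun p => Ψ.algHom.one (Φ.algHom.one (t.a p))
        b := fun p => Ψ.algHom.one (Φ.algHom.one (t.b p))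
        m := 0
        n := 0 }
    have h0 : 0 ∈ masseyIP I t' := zero_mem_masseyIP I
      (t := (t.image Φ.modHom).image Ψ.modHom) rfl rfl rfl rfl rfl rfl
      ⟨_, smul_mem_masseyIP_image Ψ hτ⟩
    rw [hT τ hτ]
    refine masseyIP_subset_of_cohomologous I (t := t') (t' := t) rfl
      (fun p => h.exists_alg_primitive (ht.a_mem p) (ht.a_closed p)) ?_
      (fun p => h.exists_alg_primitive (ht.b_mem p) (ht.b_closed p)) ?_ h0
    · simpa only [he, if_false] using h.exists_mod_primitive ht.m_mem ht.m_closed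
    · simpa only [he, if_false] using h.exists_mod_primitive ht.n_mem ht.n_closed

end Equivalence

end AInf

theorem mainTheorem4 {R A B M N : Type*} [CommRing R]
    [AddCommGroup A] [Module R A] [AddCommGroup B] [Module R B]
    [AddCommGroup M] [Module R M] [AddCommGroup N] [Module R N]
    (𝒜 : ℤ → Submodule R A) (ℬ : ℤ → Submodule R B)
    (ℳ : ℤ → Submodule R M) (𝒩 : ℤ → Submodule R N)
    [DirectSum.Decomposition 𝒜] [DirectSum.Decomposition ℬ]
    [DirectSum.Decomposition ℳ] [DirectSum.Decomposition 𝒩]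
    (X : AInf.Alg 𝒜) (Y : AInf.Alg ℬ) (P : AInf.Bimod X ℳ) (Q : AInf.Bimod Y 𝒩)
    (i j : ℤ) (I : AInf.InnerProd P i) (J : AInf.InnerProd Q j)
    (Φ : AInf.IPHom I J) (Ψ : AInf.IPHom J I) (hΦΨ : AInf.IsQuasiInverse Φ Ψ)
    (k l : ℕ) (hkl : 1 ≤ k + l)
    (t : AInf.CyclicTuple A M k l) (ht : t.IsCocycle P) :
    AInf.masseyIP I t = AInf.masseyIP J (t.image Φ.modHom) := by
  by_cases he : Φ.degree + Ψ.degree = 0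
  · exact hΦΨ.masseyIP_eq_of_degree_eq ht he
  · exact hΦΨ.masseyIP_eq_of_degree_ne ht he
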